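/- Let $a\in C^1(\mathbb R)$ be real-valued and consider the discrete Schrödinger equation on $\mathbb Z$ coupled to an oscillator at $0$, $$i\dot\psi(x,t)=-\Delta_L\psi(x,t)-\delta(x)\,a(|\psi(0,t)|^2)\,\psi(0,t),\qquad \Delta_L\psi(x)=\psi(x+1)-2\psi(x)+\psi(x-1).$$ Its nonzero solitary waves $e^{i\theta}\psi_\omega(x)e^{i\omega t}$ are given by $\psi_\omega(x)=C\sigma^{|x|}e^{-k|x|}$, where $C>0$, $\sigma\in\{1,-1\}$, $\sigma a(C^2)>0$, $\sinh k=\sigma a(C^2)/2$ and $\omega+2=2\sigma\cosh k$ (so $\omega>0$ if $\sigma=1$ and $\omega<-4$ if $\sigma=-1$). Write $a=a(C^2)$, $a'=a'(C^2)$. The linearization at such a wave is the operator $\mathbf C=j^{-1}\mathbf B$ on $l^2(\mathbb Z;\mathbb C^2)$, with $$j=\begin{pmatrix}0&-1\\1&0\end{pmatrix},\qquad \mathbf B=-\Delta_L+\omega-\delta(x)\,[a+2a'C^2P_1],\qquad P_1(\chi_1,\chi_2)=(\chi_1,0).$$ Its continuous spectrum is $[-i(\omega+4),-i\omega]\cup[i\omega,i(\omega+4)]$.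 Put $\Phi_\omega=(\psi_\omega,0)$, let $\partial_\omega$ be the derivative along the family of solitary waves (the one through $\psi_\omega$ parametrized by $C$) with respect to the frequency, and set $$\mathbf P^0\chi=\frac{1}{\langle\Phi_\omega,\partial_\omega\Phi_\omega\rangle}\big[\langle\chi,j\partial_\omega\Phi_\omega\rangle\, j\Phi_\omega+\langle\chi,\Phi_\omega\rangle\,\partial_\omega\Phi_\omega\big],\qquad \mathbf P^c=1-\mathbf P^0 .$$ Assume the spectral condition $\{SP\}$: $a'\notin\{0,\ (4a+a^3)/(4C^2)\}$, and $\mathbf C$ has no eigenvalue except $\lambda=0$. Assume also that the edges $\pm i\omega,\ \pm i(\omega+4)$ of the continuous spectrum are not resonances, i.e. for none of these $\lambda$ does $\mathbf Cu=\lambda u$ have a nonzero bounded solution $u:\mathbb Z\to\mathbb C^2$. Then for every $\beta\ge2$ $$\|\mathbf P^c e^{\mathbf Ct}\|_{B(l^1_\beta,\,l^\infty_{-\beta})}=\mathcal O(t^{-3/2}),\qquad t\to\infty,$$ where $\|u\|_{l^1_\beta}=\sum_x(1+|x|)^\beta|u(x)|$ and $\|u\|_{l^\infty_{-\beta}}=\sup_x(1+|x|)^{-\beta}|u(x)|$.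 -/

import Mathlib

open Filter Topology
open scoped ENNReal

noncomputable section

/-! ### The lattice spaces -/

/-- Vectors `(χ₁, χ₂)` at a site; complexified, since the spectrum of a real non-symmetric operator
is considered. -/
abbrev Site : Type := EuclideanSpace ℂ (Fin 2)

/-- The Hilbert space `l² = l²(ℤ; ℂ²)`. -/
abbrev LatL2 : Type := lp (fun _ : ℤ => Site) 2

/-- The norm of `l¹_β`: `∑ₓ (1 + |x|)^β |u(x)|`, with value `∞` outside `l¹_β`. -/
def normL1 (β : ℝ) (u : ℤ → Site) : ℝ≥0∞ :=
  ∑' x : ℤ, ENNReal.ofReal ((1 + |(x : ℝ)|) ^ β) * ‖u x‖ₑ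

/-- The norm of `l^∞_β`: `supₓ (1 + |x|)^β |u(x)|`, with value `∞` outside `l^∞_β`. -/
def normLinf (β : ℝ) (u : ℤ → Site) : ℝ≥0∞ :=
  ⨆ x : ℤ, ENNReal.ofReal ((1 + |(x : ℝ)|) ^ β) * ‖u x‖ₑ

/-- For `β ≥ 0` the space `l¹_β` is contained in `l²`. -/
theorem memLatL2_of_normL1 {β : ℝ} (hβ : 0 ≤ β) {u : ℤ → Site} (hu : normL1 β u < ∞) :
    Memℓp u 2 := by
  have h1 : ∑' x : ℤ, ‖u x‖ₑ < ∞ := by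
    refine lt_of_le_of_lt (ENNReal.tsum_le_tsum fun x => ?_) hu
    have : (1 : ℝ) ≤ (1 + |(x : ℝ)|) ^ β :=
      Real.one_le_rpow (by linarith [abs_nonneg (x : ℝ)]) hβ
    calc ‖u x‖ₑ = 1 * ‖u x‖ₑ := (one_mul _).symm
      _ ≤ _ := by
        gcongr
        rw [← ENNReal.ofReal_one]
        exact ENNReal.ofReal_le_ofReal this
  have h2 : Memℓp u 1 := by
    refine memℓp_gen ?_
    have h3 : Summable fun x : ℤ => ‖u x‖₊ := by
      rw [← ENNReal.tsum_coe_ne_top_iff_summable]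
      exact h1.ne
    have h4 := NNReal.summable_coe.2 h3
    simpa using h4
  exact h2.of_exponent_ge (by norm_num)

/-- The norm of an operator `T` in `𝓑 = B(l¹_β, l^∞_{-β})`, for `β ≥ 0` and `T` given on `l² ⊇ l¹_β`:
the supremum of `‖T χ‖_{l^∞_{-β}}` over the unit ball of `l¹_β`. It is `∞` if `T` does not act
boundedly between these spaces. -/
def opNormB (β : ℝ) (T : LatL2 →L[ℂ] LatL2) : ℝ≥0∞ :=
  ⨆ (χ : LatL2) (_ : normL1 β χ ≤ 1), normLinf (-β) (T χ)

/-! ### Elementary bounded operators on `l²` -/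

/-- The translation `χ ↦ χ(· + n)`. -/
def latShift (n : ℤ) : LatL2 →L[ℂ] LatL2 :=
  LinearMap.mkContinuous
    { toFun := fun χ => ⟨fun x => χ (x + n), memℓp_gen
        (((lp.memℓp χ).summable (by norm_num)).comp_injective (add_left_injective n))⟩
      map_add' := fun _ _ => rfl
      map_smul' := fun _ _ => rfl } 1 (by
    intro χ
    rw [one_mul]
    refine lp.norm_le_of_tsum_le (by norm_num) (norm_nonneg _) ?_
    rw [lp.norm_rpow_eq_tsum (by norm_num) χ]
    exact ((Equiv.addRight n).tsum_eq fun x => ‖χ x‖ ^ (2 : ℝ≥0∞).toReal).le)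

/-- A `2 × 2` matrix as an operator on the fibre `ℂ²`. -/
abbrev siteMatrix (M : Matrix (Fin 2) (Fin 2) ℂ) : Site →L[ℂ] Site :=
  Matrix.toEuclideanCLM (n := Fin 2) (𝕜 := ℂ) M

/-- The operator that applies the same matrix `M` at each site. -/
def latMatrix (M : Matrix (Fin 2) (Fin 2) ℂ) : LatL2 →L[ℂ] LatL2 :=
  LinearMap.mkContinuous
    { toFun := fun χ => ⟨fun x => siteMatrix M (χ x),
        (((lp.memℓp χ).norm).const_mul ‖siteMatrix M‖).mono fun x =>
          (siteMatrix M).le_opNorm (χ x)⟩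
      map_add' := fun χ η => Subtype.ext (funext fun x => map_add (siteMatrix M) (χ x) (η x))
      map_smul' := fun c χ => Subtype.ext (funext fun x => map_smul (siteMatrix M) c (χ x)) }
    ‖siteMatrix M‖ (by
    intro χ
    have h := lp.norm_mono (p := 2) (by norm_num)
      (x := (⟨fun x => siteMatrix M (χ x),
        (((lp.memℓp χ).norm).const_mul ‖siteMatrix M‖).mono fun x =>
          (siteMatrix M).le_opNorm (χ x)⟩ : LatL2)) (y := (‖siteMatrix M‖ : ℂ) • χ) (fun x => by
        rw [lp.coeFn_smul, Pi.smul_apply, norm_smul, Complex.norm_real, norm_norm]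
        exact (siteMatrix M).le_opNorm (χ x))
    rw [norm_smul, Complex.norm_real, norm_norm] at h
    exact h)

/-- `δ(x) M`: the operator that applies the matrix `M` at the site `0` and is zero elsewhere. -/
def latDelta (M : Matrix (Fin 2) (Fin 2) ℂ) : LatL2 →L[ℂ] LatL2 :=
  (lp.singleContinuousLinearMap ℂ (fun _ : ℤ => Site) 2 0).comp
    ((siteMatrix M).comp (lp.evalCLM ℂ (fun _ : ℤ => Site) 2 0))

/-- The difference Laplacian `(Δ_L χ)(x) = χ(x+1) - 2 χ(x) + χ(x-1)` on `l²`. -/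
def latLaplacian : LatL2 →L[ℂ] LatL2 :=
  latShift 1 - (2 : ℂ) • ContinuousLinearMap.id ℂ LatL2 + latShift (-1)

/-- The matrix `j`. -/
def matJ : Matrix (Fin 2) (Fin 2) ℂ := !![0, -1; 1, 0]

/-- The projector `P₁ : (χ₁, χ₂) ↦ (χ₁, 0)`. -/
def matP1 : Matrix (Fin 2) (Fin 2) ℂ := !![1, 0; 0, 0]

/-! ### Solitary waves -/

/-- `k(c)` with `sinh k = σ a(c²) / 2`. -/
def decayRate (a : ℝ → ℝ) (σ c : ℝ) : ℝ := Real.arsinh (σ * a (c ^ 2) / 2)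

/-- The frequency `ω(c)` of the solitary wave with amplitude `c`: `ω + 2 = σ 2 cosh k(c)`. -/
def waveFrequency (a : ℝ → ℝ) (σ c : ℝ) : ℝ := σ * (2 * Real.cosh (decayRate a σ c)) - 2

/-- The profile `ψ(x) = c σ^{|x|} e^{-k(c)|x|}` of the solitary wave with amplitude `c`. -/
def waveProfile (a : ℝ → ℝ) (σ c : ℝ) (x : ℤ) : ℝ :=
  c * σ ^ x.natAbs * Real.exp (-(decayRate a σ c * (x.natAbs : ℝ)))

/-- A nonzero solitary wave `ψ_ω(x) e^{iωt}` of the equation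
`i ∂ₜψ = -Δ_L ψ - δ(x) F(ψ(0,t))`, `F(ψ) = a(|ψ|²) ψ`, `a ∈ C¹(ℝ)` (its constant phase is
normalised to `0`). The coordinate on the manifold of solitary waves is the amplitude `C = ψ_ω(0) > 0`;
`σ = 1` is the family with `a(C²) > 0`, `ω > 0`, and `σ = -1` the family with
`a(C²) < 0`, `ω < -4`. -/
structure SolitaryWave where
  a : ℝ → ℝ
  contDiff_a : ContDiff ℝ 1 a
  σ : ℝ
  σ_eq : σ = 1 ∨ σ = -1
  C : ℝ
  C_pos : 0 < C
  a_pos : 0 < σ * a (C ^ 2)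

namespace SolitaryWave

variable (S : SolitaryWave)

/-- The frequency `ω`. -/
def ω : ℝ := waveFrequency S.a S.σ S.C

/-- The decay rate `k(ω) > 0`. -/
def k : ℝ := decayRate S.a S.σ S.C

/-- The profile `ψ_ω`. -/
def ψ (x : ℤ) : ℝ := waveProfile S.a S.σ S.C x

/-- `∂_ω ψ_ω`, the derivative along the family of solitary waves with respect to the frequency,
computed in the coordinate `c`: `(∂ψ/∂c) / (dω/dc)` at `c = C`. -/
def dψ (x : ℤ) : ℝ :=
  deriv (fun c => waveProfile S.a S.σ c x) S.C / deriv (waveFrequency S.a S.σ) S.C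

/-- `a'` at the point `C²`. -/
def a' : ℝ := deriv S.a (S.C ^ 2)

theorem k_pos : 0 < S.k := by
  have := S.a_pos
  exact Real.arsinh_pos_iff.2 (by linarith)

theorem sinh_k : Real.sinh S.k = S.σ * S.a (S.C ^ 2) / 2 := Real.sinh_arsinh _

theorem cosh_k : Real.cosh S.k = |S.ω + 2| / 2 := by
  have h : S.ω + 2 = S.σ * (2 * Real.cosh S.k) := by
    simp [ω, waveFrequency, k]
  have h1 : |S.σ| = 1 := by rcases S.σ_eq with h | h <;> simp [h]
  rw [h, abs_mul, h1, abs_of_pos (by positivity)]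
  ring

theorem ψ_zero : S.ψ 0 = S.C := by simp [ψ, waveProfile]

/-- `ψ_ω` solves the stationary equation
`-ω ψ_ω(x) = -Δ_L ψ_ω(x) - δ(x) F(ψ_ω(0))`. -/
theorem stationary (x : ℤ) :
    -S.ω * S.ψ x = -(S.ψ (x + 1) - 2 * S.ψ x + S.ψ (x - 1))
      - (if x = 0 then S.a (S.ψ 0 ^ 2) * S.ψ 0 else 0) := by
  have hσ : S.σ * S.σ = 1 := by rcases S.σ_eq with h | h <;> simp [h]
  have ha : S.a (S.C ^ 2) = S.σ * (Real.exp S.k - Real.exp (-S.k)) := by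
    have h := S.sinh_k
    rw [Real.sinh_eq] at h
    linear_combination (-S.a (S.C ^ 2)) * hσ - 2 * S.σ * h
  have hω : S.ω = S.σ * (Real.exp S.k + Real.exp (-S.k)) - 2 := by
    have h := Real.cosh_eq S.k
    rw [show S.ω = S.σ * (2 * Real.cosh S.k) - 2 from rfl]
    linear_combination 2 * S.σ * h
  have hp : Real.exp S.k * Real.exp (-S.k) = 1 := by rw [← Real.exp_add]; simp
  have hψ : ∀ y : ℤ, S.ψ y = S.C * (S.σ * Real.exp (-S.k)) ^ y.natAbs := by
    intro y
    have e : Real.exp (-S.k) ^ y.natAbs = Real.exp (-(S.k * (y.natAbs : ℝ))) := by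
      rw [← Real.exp_nat_mul]; congr 1; ring
    rw [mul_pow, e, ← mul_assoc]
    rfl
  have hr : ∀ n : ℕ, S.ω * (S.σ * Real.exp (-S.k)) ^ (n + 1)
      = (S.σ * Real.exp (-S.k)) ^ (n + 2) - 2 * (S.σ * Real.exp (-S.k)) ^ (n + 1)
        + (S.σ * Real.exp (-S.k)) ^ n := by
    intro n
    rw [hω]
    linear_combination (S.σ * Real.exp (-S.k)) ^ n * (S.σ ^ 2 * hp + hσ)
  rcases lt_trichotomy x 0 with hx | rfl | hx
  · obtain ⟨n, rfl⟩ : ∃ n : ℕ, x = -((n : ℤ) + 1) := ⟨(-x - 1).toNat, by omega⟩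
    rw [if_neg hx.ne, hψ, hψ, hψ, show (-((n : ℤ) + 1)).natAbs = n + 1 by omega,
      show (-((n : ℤ) + 1) + 1).natAbs = n by omega,
      show (-((n : ℤ) + 1) - 1).natAbs = n + 2 by omega]
    linear_combination (-S.C) * hr n
  · rw [if_pos rfl, S.ψ_zero, ha, hω, hψ, hψ]
    simp
    ring
  · obtain ⟨n, rfl⟩ : ∃ n : ℕ, x = (n : ℤ) + 1 := ⟨(x - 1).toNat, by omega⟩
    rw [if_neg hx.ne', hψ, hψ, hψ, show ((n : ℤ) + 1).natAbs = n + 1 by omega,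
      show ((n : ℤ) + 1 + 1).natAbs = n + 2 by omega,
      show ((n : ℤ) + 1 - 1).natAbs = n by omega]
    linear_combination (-S.C) * hr n

theorem summable_weight {r : ℝ} (h0 : 0 ≤ r) (h1 : r < 1) (A B : ℝ) :
    Summable fun x : ℤ => (A + B * (x.natAbs : ℝ)) * r ^ x.natAbs := by
  have h : Summable fun n : ℕ => (A + B * (n : ℝ)) * r ^ n := by
    have e1 := (summable_geometric_of_lt_one h0 h1).mul_left A
    have e2 := (summable_pow_mul_geometric_of_norm_lt_one 1
      (by rwa [Real.norm_of_nonneg h0] : ‖r‖ < 1)).mul_left B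
    refine (e1.add e2).congr fun n => ?_
    simp
    ring
  exact Summable.of_nat_of_neg (by simpa using h) (by simpa using h)

theorem memℓp_of_bound {f : ℤ → ℝ} {k A B : ℝ} (hk : 0 < k)
    (hf : ∀ x, |f x| ≤ (A + B * (x.natAbs : ℝ)) * Real.exp (-(k * (x.natAbs : ℝ)))) :
    Memℓp (fun x => (!₂[(f x : ℂ), 0] : Site)) 2 := by
  have h1 : Memℓp (fun x => (!₂[(f x : ℂ), 0] : Site)) 1 := by
    refine memℓp_gen ?_
    have hs := summable_weight (Real.exp_nonneg (-k)) (by simpa using hk) A B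
    refine Summable.of_nonneg_of_le (fun x => by positivity) (fun x => ?_) hs
    have e : Real.exp (-k) ^ x.natAbs = Real.exp (-(k * (x.natAbs : ℝ))) := by
      rw [← Real.exp_nat_mul]; congr 1; ring
    rw [e]
    simpa [EuclideanSpace.norm_eq, Real.sqrt_sq_eq_abs] using hf x
  exact h1.of_exponent_ge (by norm_num)

theorem abs_ψ_le (x : ℤ) :
    |S.ψ x| ≤ (S.C + 0 * (x.natAbs : ℝ)) * Real.exp (-(S.k * (x.natAbs : ℝ))) := by
  have h1 : |S.σ| = 1 := by rcases S.σ_eq with h | h <;> simp [h]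
  simp [ψ, waveProfile, abs_mul, h1, abs_of_pos S.C_pos, k]

theorem abs_dψ_le : ∃ A B : ℝ, ∀ x : ℤ,
    |S.dψ x| ≤ (A + B * (x.natAbs : ℝ)) * Real.exp (-(S.k * (x.natAbs : ℝ))) := by
  have h1 : |S.σ| = 1 := by rcases S.σ_eq with h | h <;> simp [h]
  have ha : Differentiable ℝ S.a := S.contDiff_a.differentiable (by norm_num)
  obtain ⟨k', hk'⟩ : ∃ k', HasDerivAt (decayRate S.a S.σ) k' S.C := by
    have : DifferentiableAt ℝ (decayRate S.a S.σ) S.C := by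
      unfold decayRate
      refine Real.differentiable_arsinh.differentiableAt.comp S.C ?_
      fun_prop
    exact ⟨_, this.hasDerivAt⟩
  set W := deriv (waveFrequency S.a S.σ) S.C
  refine ⟨1 / |W|, |S.C * k'| / |W|, fun x => ?_⟩
  have hd : HasDerivAt (fun c => waveProfile S.a S.σ c x)
      (S.σ ^ x.natAbs * ((1 - S.C * k' * (x.natAbs : ℝ)) *
        Real.exp (-(S.k * (x.natAbs : ℝ))))) S.C := by
    unfold waveProfile
    have h2 := ((hk'.mul_const (x.natAbs : ℝ)).neg).exp
    have h3 := ((hasDerivAt_id S.C).mul_const (S.σ ^ x.natAbs)).mul h2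
    refine h3.congr_deriv ?_
    simp only [k, id, Pi.neg_apply]
    ring
  have hle : |1 - S.C * k' * (x.natAbs : ℝ)| ≤ 1 + |S.C * k'| * (x.natAbs : ℝ) := by
    refine (abs_sub _ _).trans ?_
    rw [abs_one, abs_mul (S.C * k'), Nat.abs_cast]
  rw [dψ, hd.deriv, abs_div, abs_mul, abs_pow, h1, one_pow, one_mul, abs_mul, Real.abs_exp]
  calc _ ≤ (1 + |S.C * k'| * (x.natAbs : ℝ)) * Real.exp (-(S.k * (x.natAbs : ℝ))) / |W| := by
        gcongr
    _ = _ := by ring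

/-- The real form `Φ_ω = (ψ_ω, 0)` of the solitary wave. -/
def Φ : LatL2 := ⟨fun x => !₂[(S.ψ x : ℂ), 0], memℓp_of_bound S.k_pos S.abs_ψ_le⟩

/-- `∂_ω Φ_ω = (∂_ω ψ_ω, 0)`. -/
def dΦ : LatL2 := ⟨fun x => !₂[(S.dψ x : ℂ), 0], by
  obtain ⟨A, B, h⟩ := S.abs_dψ_le
  exact memℓp_of_bound S.k_pos h⟩

/-! ### The linearization at a solitary wave -/

/-- The matrix `a(C²) + 2 a'(C²) C² P₁`. -/
def couplingMatrix : Matrix (Fin 2) (Fin 2) ℂ :=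
  ((S.a (S.C ^ 2) : ℝ) : ℂ) • (1 : Matrix (Fin 2) (Fin 2) ℂ) +
    ((2 * S.a' * S.C ^ 2 : ℝ) : ℂ) • matP1

/-- `𝐁 = -Δ_L + ω - δ(x) [a(C²) + 2 a'(C²) C² P₁]` on `l²`. -/
def opB : LatL2 →L[ℂ] LatL2 :=
  -latLaplacian + (S.ω : ℂ) • ContinuousLinearMap.id ℂ LatL2 - latDelta S.couplingMatrix

/-- The linearized operator `𝐂 = j⁻¹ 𝐁` on `l²`. -/
def opC : LatL2 →L[ℂ] LatL2 := (latMatrix matJ⁻¹).comp S.opB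

/-- The expression `𝐂 u` for an arbitrary function `u` on the lattice. -/
def exprC (u : ℤ → Site) (x : ℤ) : Site :=
  siteMatrix matJ⁻¹ (-(u (x + 1) - (2 : ℂ) • u x + u (x - 1)) + (S.ω : ℂ) • u x
    - (if x = 0 then siteMatrix S.couplingMatrix (u 0) else 0))

theorem opC_apply (χ : LatL2) (x : ℤ) : S.opC χ x = S.exprC χ x := by
  have hd : (latDelta S.couplingMatrix χ) x
      = if x = 0 then siteMatrix S.couplingMatrix (χ 0) else 0 := by
    change lp.single (E := fun _ : ℤ => Site) 2 0 (siteMatrix S.couplingMatrix (χ 0)) x = _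
    by_cases hx : x = 0
    · subst hx
      simp
    · simp [hx]
  unfold exprC
  rw [← hd]
  rfl

/-- The dynamical group `e^{𝐂t}` of the linearized equation `∂ₜχ = 𝐂 χ` in `l²`. -/
def group (t : ℝ) : LatL2 →L[ℂ] LatL2 := NormedSpace.exp ((t : ℂ) • S.opC)

/-- The symplectic projection
`𝐏⁰χ = ⟨Φ_ω, ∂_ωΦ_ω⟩⁻¹ [⟨χ, j ∂_ωΦ_ω⟩ j Φ_ω + ⟨χ, Φ_ω⟩ ∂_ωΦ_ω]`
onto the generalized null space of `𝐂`. -/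
def projNull : LatL2 →L[ℂ] LatL2 :=
  (inner ℂ S.Φ S.dΦ)⁻¹ •
    ((innerSL ℂ (latMatrix matJ S.dΦ)).smulRight (latMatrix matJ S.Φ) +
      (innerSL ℂ S.Φ).smulRight S.dΦ)

/-- The projection `𝐏ᶜ = 1 - 𝐏⁰` onto the continuous spectral subspace. -/
def projCont : LatL2 →L[ℂ] LatL2 := ContinuousLinearMap.id ℂ LatL2 - S.projNull

/-- The spectral condition `{SP}`: the solitary wave is non-degenerate, and `𝐂` has no eigenvalue
except `0`. -/
structure SpectralCondition : Prop where
  a'_ne_zero : S.a' ≠ 0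
  a'_ne : S.a' ≠ (4 * S.a (S.C ^ 2) + S.a (S.C ^ 2) ^ 3) / (4 * S.C ^ 2)
  eigenvalue_eq_zero : ∀ lam : ℂ,
    Module.End.HasEigenvalue (S.opC : LatL2 →ₗ[ℂ] LatL2) lam → lam = 0

/-- The edges `±iω`, `±i(ω+4)` of the continuous spectrum
`[-i(ω+4), -iω] ∪ [iω, i(ω+4)]` of `𝐂`. -/
def edges : Set ℂ :=
  {Complex.I * S.ω, -(Complex.I * S.ω), Complex.I * (S.ω + 4), -(Complex.I * (S.ω + 4))}

/-- `lam` is a resonance: the equation `𝐂 u = lam u` has a nonzero bounded solution. At an edge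
this means that the determinant in the denominator of the resolvent kernel vanishes there. -/
def IsResonance (lam : ℂ) : Prop :=
  ∃ u : ℤ → Site, u ≠ 0 ∧ (∃ M : ℝ, ∀ x, ‖u x‖ ≤ M) ∧ ∀ x, S.exprC u x = lam • u x

end SolitaryWave

end

/-! In the eigenbasis (1, i), (1, -i) of j the operator 𝐂 is a pair of scalar lattice operators with
symbols ±i(z - 2 cos θ), z = ω + 2, coupled only at the site 0. Its resolvent is therefore explicit.
If r and s are the roots in the unit disc of r + 1/r = z + il and s + 1/s = z - il, the resolvent
kernel at l is a Dirichlet kernel plus a correction from the site 0 whose denominator is the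
determinant `resDet`. On the continuous spectrum one root runs over the unit circle and the other
stays strictly inside.

The hypotheses enter through this determinant. A zero with both roots inside the disc yields an
eigenfunction. A zero on the continuous spectrum is forced to an edge by taking imaginary parts, and
there it yields a bounded solution. So `resDet_ne_zero` holds on the closed right half plane away
from 0. At l = 0 the determinant vanishes to second order with leading coefficient governed by
`detCoeff`, which is nonzero because of the excluded value of a'; up to a factor this number is also
⟨Φ_ω, ∂_ωΦ_ω⟩ (`inner_Φ_dΦ`).

Integrating the resolvent over the continuous spectrum against a multiplier g(l) gives the spectral
integral `specInt`, on which two facts are needed. By the resolvent equation on the circle, applying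
𝐂 multiplies g by l: the source δ_y contributes the integral of a constant, which vanishes by
oddness. Hence e^{𝐂t} turns the multiplier 1 into e^{tl}, by the exponential series (`group_apply`).
For g = 1 the integral is evaluated by Cauchy's theorem: l → ∞ contributes the identity and l → 0 a
combination of jΦ_ω and ∂_ωΦ_ω. Passing from l to -l interchanges r and s, so the contour folds into
the right half plane. Thus δ_y v plus a null vector is a spectral integral with g = 1
(`exists_specVec_eq`), and 𝐏ᶜe^{𝐂t} annihilates the null vector (`projCont_group_eq_zero`).

What remains are integrals of sin θ e^{is cos θ} f(θ) over a period, with s = ±2t and f periodic and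
C² because the determinant does not vanish on the circle, edges included. Since sin θ e^{is cos θ}
is an exact derivative, one integration by parts gains 1/t, and the stationary points 0 and π of the
phase give a further t^{-1/2} (`C2Bound.norm_integral_sin_mul_le`). Two derivatives of f are used;
on powers r^{|x|}, r^{|y|} they cost (1+|x|)²(1+|y|)², which is absorbed by the weights for β ≥ 2.
-/

noncomputable section

/-! ### Oscillatory integrals with phase cos θ -/

-- The phase is stationary only at 0 and π. Near these points the integral is bounded by length; in
-- between, integration by parts against 1/(s sin θ) costs O(1/(|s| ε)). The choice ε = |s|^{-1/2}
-- balances the two.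
open MeasureTheory intervalIntegral in
theorem norm_integral_exp_cos_mul_le {G G' : ℝ → ℂ} {M s : ℝ} (hs : 1 ≤ |s|)
    (hG : ∀ θ, HasDerivAt G (G' θ) θ) (hG' : Continuous G')
    (hM : ∀ θ, ‖G θ‖ ≤ M) (hM' : ∀ θ, ‖G' θ‖ ≤ M) :
    ‖∫ θ in (0 : ℝ)..Real.pi, Complex.exp (Complex.I * (s * Real.cos θ)) * G θ‖
      ≤ 14 * M * |s| ^ (-(1 / 2) : ℝ) := by
  have hM0 : 0 ≤ M := (norm_nonneg _).trans (hM 0)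
  have hs0 : (0 : ℝ) < |s| := by linarith
  set ε : ℝ := |s| ^ (-(1 / 2) : ℝ) with hε
  have hε0 : 0 < ε := Real.rpow_pos_of_pos hs0 _
  have hε1 : ε ≤ 1 := Real.rpow_le_one_of_one_le_of_nonpos hs (by norm_num)
  have hεs : ε * ε * |s| = 1 := by
    rw [hε, ← Real.rpow_add hs0]
    norm_num
    rw [Real.rpow_neg_one]
    exact inv_mul_cancel₀ hs0.ne'
  have hpi := Real.pi_gt_three
  have hpi4 := Real.pi_le_four
  have hGc : Continuous G := continuous_iff_continuousAt.2 fun θ => (hG θ).continuousAt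
  set e : ℝ → ℂ := fun θ => Complex.exp (Complex.I * (s * Real.cos θ)) with he
  have hec : Continuous e := by fun_prop
  have hen : ∀ θ, ‖e θ‖ = 1 := fun θ => by
    have : Complex.I * (s * Real.cos θ) = ((s * Real.cos θ : ℝ) : ℂ) * Complex.I := by
      push_cast; ring
    rw [he]; simp only [this, Complex.norm_exp_ofReal_mul_I]
  have hint : ∀ a b : ℝ, IntervalIntegrable (fun θ => e θ * G θ) volume a b := fun a b =>
    (hec.mul hGc).intervalIntegrable a b
  have hsplit : (∫ θ in (0 : ℝ)..Real.pi, e θ * G θ) = (∫ θ in (0 : ℝ)..ε, e θ * G θ) +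
      (∫ θ in ε..(Real.pi - ε), e θ * G θ) + ∫ θ in (Real.pi - ε)..Real.pi, e θ * G θ := by
    rw [integral_add_adjacent_intervals (hint _ _) (hint _ _),
      integral_add_adjacent_intervals (hint _ _) (hint _ _)]
  have hb : ∀ a b : ℝ, ‖∫ θ in a..b, e θ * G θ‖ ≤ M * |b - a| := fun a b =>
    norm_integral_le_of_norm_le_const fun θ _ => by rw [norm_mul, hen, one_mul]; exact hM θ
  have h1 : ‖∫ θ in (0 : ℝ)..ε, e θ * G θ‖ ≤ M * ε := by
    simpa [abs_of_pos hε0] using hb 0 ε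
  have h3 : ‖∫ θ in (Real.pi - ε)..Real.pi, e θ * G θ‖ ≤ M * ε := by
    simpa [abs_of_pos hε0] using hb (Real.pi - ε) Real.pi
  have hsin : ∀ θ ∈ Set.uIcc ε (Real.pi - ε), 0 < Real.sin θ := by
    intro θ hθ
    rw [Set.uIcc_of_le (by linarith)] at hθ
    exact Real.sin_pos_of_pos_of_lt_pi (by linarith [hθ.1]) (by linarith [hθ.2])
  -- Jordan's inequality sin ε ≥ 2ε/π, together with π ≤ 4.
  have hsinε : ε / 2 ≤ Real.sin ε := by
    have := Real.mul_le_sin hε0.le (by linarith)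
    refine le_trans ?_ this
    rw [div_mul_eq_mul_div, le_div_iff₀ (by linarith)]
    nlinarith
  have hsε0 : 0 < Real.sin ε := by linarith
  set u : ℝ → ℂ := fun θ => G θ / Real.sin θ with hu
  set u' : ℝ → ℂ := fun θ => (G' θ * Real.sin θ - G θ * Real.cos θ) / (Real.sin θ : ℂ) ^ 2 with hu'
  have hsC : ∀ θ, HasDerivAt (fun θ : ℝ => ((Real.sin θ : ℝ) : ℂ)) ((Real.cos θ : ℝ) : ℂ) θ :=
    fun θ => (Real.hasDerivAt_sin θ).ofReal_comp
  have hcC : ∀ θ, HasDerivAt (fun θ : ℝ => ((Real.cos θ : ℝ) : ℂ)) ((-Real.sin θ : ℝ) : ℂ) θ :=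
    fun θ => (Real.hasDerivAt_cos θ).ofReal_comp
  have hud : ∀ θ ∈ Set.uIcc ε (Real.pi - ε), HasDerivAt u (u' θ) θ := fun θ hθ =>
    (hG θ).div (hsC θ) (by exact_mod_cast (hsin θ hθ).ne')
  have hed : ∀ θ ∈ Set.uIcc ε (Real.pi - ε),
      HasDerivAt e (e θ * (Complex.I * (s * ((-Real.sin θ : ℝ) : ℂ)))) θ := fun θ _ =>
    (((hcC θ).const_mul (s : ℂ)).const_mul Complex.I).cexp
  have hu'c : ContinuousOn u' (Set.uIcc ε (Real.pi - ε)) := by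
    refine ContinuousOn.div (by fun_prop) (by fun_prop) fun θ hθ => ?_
    exact pow_ne_zero _ (by exact_mod_cast (hsin θ hθ).ne')
  have hibp := integral_mul_deriv_eq_deriv_mul hud hed hu'c.intervalIntegrable
    ((by fun_prop : Continuous _).intervalIntegrable _ _)
  have hsne : (s : ℂ) ≠ 0 := by
    intro h
    have : s = 0 := by exact_mod_cast h
    simp [this] at hs0
  have hL : (∫ θ in ε..(Real.pi - ε), u θ * (e θ * (Complex.I * (s * ((-Real.sin θ : ℝ) : ℂ)))))
      = -(Complex.I * s) * ∫ θ in ε..(Real.pi - ε), e θ * G θ := by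
    rw [← intervalIntegral.integral_const_mul]
    refine integral_congr fun θ hθ => ?_
    have : (Real.sin θ : ℂ) ≠ 0 := by exact_mod_cast (hsin θ hθ).ne'
    simp only [hu]
    push_cast
    push_cast at this
    field_simp
  have hub : ∀ θ, ‖u θ‖ ≤ M * (1 / |Real.sin θ|) := fun θ => by
    rw [hu]
    simp only [norm_div, Complex.norm_real, Real.norm_eq_abs]
    rw [mul_one_div]
    gcongr
    exact hM θ
  have hu'b : ∀ θ, ‖u' θ‖ ≤ 2 * M * (1 / Real.sin θ ^ 2) := fun θ => by
    rw [hu']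
    simp only [norm_div, norm_pow, Complex.norm_real, Real.norm_eq_abs, sq_abs]
    rw [mul_one_div]
    gcongr
    refine (norm_sub_le _ _).trans ?_
    simp only [norm_mul, Complex.norm_real, Real.norm_eq_abs]
    have := Real.abs_sin_le_one θ
    have := Real.abs_cos_le_one θ
    nlinarith [hM θ, hM' θ, norm_nonneg (G θ), norm_nonneg (G' θ), abs_nonneg (Real.sin θ),
      abs_nonneg (Real.cos θ)]
  -- The derivative of G / sin is O(1/sin²), and 1/sin² has the primitive -cot, so its integral is
  -- only of size 1/sin ε.
  have hcot : ∀ θ ∈ Set.uIcc ε (Real.pi - ε),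
      HasDerivAt (fun θ => -(Real.cos θ / Real.sin θ)) (1 / Real.sin θ ^ 2) θ := fun θ hθ => by
    have h := ((Real.hasDerivAt_cos θ).div (Real.hasDerivAt_sin θ) (hsin θ hθ).ne').neg
    refine h.congr_deriv ?_
    rw [← neg_div]
    congr 1
    nlinarith [Real.sin_sq_add_cos_sq θ]
  have hsqc : ContinuousOn (fun θ => 1 / Real.sin θ ^ 2) (Set.uIcc ε (Real.pi - ε)) :=
    ContinuousOn.div (by fun_prop) (by fun_prop) fun θ hθ => pow_ne_zero _ (hsin θ hθ).ne'
  have hI : (∫ θ in ε..(Real.pi - ε), 1 / Real.sin θ ^ 2) ≤ 2 / Real.sin ε := by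
    rw [integral_eq_sub_of_hasDerivAt hcot hsqc.intervalIntegrable, Real.cos_pi_sub,
      Real.sin_pi_sub]
    have := Real.cos_le_one ε
    rw [show -(-Real.cos ε / Real.sin ε) - -(Real.cos ε / Real.sin ε)
      = 2 * Real.cos ε / Real.sin ε by ring]
    gcongr
    linarith
  have hR2 : ‖∫ θ in ε..(Real.pi - ε), u' θ * e θ‖ ≤ 2 * M * (2 / Real.sin ε) := by
    refine (norm_integral_le_of_norm_le (by linarith) (ae_of_all _ fun θ _ => ?_)
      (hsqc.intervalIntegrable.const_mul (2 * M))).trans ?_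
    · rw [norm_mul, hen, mul_one]; exact hu'b θ
    · rw [intervalIntegral.integral_const_mul]
      gcongr
  have hmid : |s| * ‖∫ θ in ε..(Real.pi - ε), e θ * G θ‖ ≤ 6 * M / Real.sin ε := by
    have h := congrArg norm hibp
    rw [hL, norm_mul, norm_neg, norm_mul, Complex.norm_I, one_mul, Complex.norm_real,
      Real.norm_eq_abs] at h
    rw [h]
    refine (norm_sub_le _ _).trans ?_
    have e1 : ‖u (Real.pi - ε) * e (Real.pi - ε)‖ ≤ M * (1 / Real.sin ε) := by
      rw [norm_mul, hen, mul_one]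
      have := hub (Real.pi - ε)
      rwa [Real.sin_pi_sub, abs_of_pos hsε0] at this
    have e2 : ‖u ε * e ε‖ ≤ M * (1 / Real.sin ε) := by
      rw [norm_mul, hen, mul_one]
      have := hub ε
      rwa [abs_of_pos hsε0] at this
    have e3 := norm_sub_le (u (Real.pi - ε) * e (Real.pi - ε)) (u ε * e ε)
    calc _ ≤ M * (1 / Real.sin ε) + M * (1 / Real.sin ε) + 2 * M * (2 / Real.sin ε) := by
          linarith
      _ = _ := by ring
  have h2 : ‖∫ θ in ε..(Real.pi - ε), e θ * G θ‖ ≤ 12 * M * ε := by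
    set X := ‖∫ θ in ε..(Real.pi - ε), e θ * G θ‖
    have h4 : 6 * M / Real.sin ε ≤ 12 * M / ε := by
      rw [div_le_div_iff₀ hsε0 hε0]
      nlinarith
    calc X = ε * ε * (|s| * X) := by rw [← mul_assoc, hεs, one_mul]
      _ ≤ ε * ε * (12 * M / ε) := by gcongr; exact hmid.trans h4
      _ = 12 * M * ε := by field_simp
  -- The three pieces contribute Mε, 12Mε and Mε.
  rw [hsplit]
  refine (norm_add₃_le).trans ?_
  linarith

/-! ### Calculus of uniform C² bounds -/

/-- `f` is twice continuously differentiable, and `f`, `f'`, `f''` are bounded by `M`. -/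
def C2Bound (f : ℝ → ℂ) (M : ℝ) : Prop :=
  ∃ f1 f2 : ℝ → ℂ, (∀ θ, HasDerivAt f (f1 θ) θ) ∧ (∀ θ, HasDerivAt f1 (f2 θ) θ) ∧
    Continuous f2 ∧ ∀ θ, ‖f θ‖ ≤ M ∧ ‖f1 θ‖ ≤ M ∧ ‖f2 θ‖ ≤ M

namespace C2Bound

variable {f g : ℝ → ℂ} {M N : ℝ}

theorem nonneg (hf : C2Bound f M) : 0 ≤ M := by
  obtain ⟨f1, f2, -, -, -, h⟩ := hf
  exact (norm_nonneg _).trans (h 0).1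

theorem continuous (hf : C2Bound f M) : Continuous f := by
  obtain ⟨f1, f2, h, -⟩ := hf
  exact continuous_iff_continuousAt.2 fun θ => (h θ).continuousAt

theorem mono (hf : C2Bound f M) (h : M ≤ N) : C2Bound f N := by
  obtain ⟨f1, f2, h1, h2, h3, h4⟩ := hf
  exact ⟨f1, f2, h1, h2, h3, fun θ => ⟨(h4 θ).1.trans h, (h4 θ).2.1.trans h, (h4 θ).2.2.trans h⟩⟩

theorem zero : C2Bound (fun _ => 0) 0 :=
  ⟨fun _ => 0, fun _ => 0, fun θ => hasDerivAt_const _ _, fun θ => hasDerivAt_const _ _,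
    continuous_const, by simp⟩

theorem add (hf : C2Bound f M) (hg : C2Bound g N) : C2Bound (fun θ => f θ + g θ) (M + N) := by
  obtain ⟨f1, f2, hf1, hf2, hf3, hf4⟩ := hf
  obtain ⟨g1, g2, hg1, hg2, hg3, hg4⟩ := hg
  refine ⟨fun θ => f1 θ + g1 θ, fun θ => f2 θ + g2 θ, fun θ => (hf1 θ).add (hg1 θ),
    fun θ => (hf2 θ).add (hg2 θ), hf3.add hg3, fun θ => ⟨?_, ?_, ?_⟩⟩
  · exact (norm_add_le _ _).trans (add_le_add (hf4 θ).1 (hg4 θ).1)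
  · exact (norm_add_le _ _).trans (add_le_add (hf4 θ).2.1 (hg4 θ).2.1)
  · exact (norm_add_le _ _).trans (add_le_add (hf4 θ).2.2 (hg4 θ).2.2)

theorem sum {ι : Type*} (s : Finset ι) {F : ι → ℝ → ℂ} (hF : ∀ i ∈ s, C2Bound (F i) M) :
    C2Bound (fun θ => ∑ i ∈ s, F i θ) (s.card * M) := by
  classical
  induction s using Finset.induction_on with
  | empty => simpa using zero
  | insert i s hi ih =>
    have h := (hF i (by simp)).add (ih fun j hj => hF j (by simp [hj]))
    simp only [Finset.sum_insert hi, Finset.card_insert_of_notMem hi]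
    refine h.mono (le_of_eq ?_)
    push_cast
    ring

theorem mul (hf : C2Bound f M) (hg : C2Bound g N) :
    C2Bound (fun θ => f θ * g θ) (4 * M * N) := by
  have hM := hf.nonneg
  have hN := hg.nonneg
  obtain ⟨f1, f2, hf1, hf2, hf3, hf4⟩ := hf
  obtain ⟨g1, g2, hg1, hg2, hg3, hg4⟩ := hg
  have hfc : Continuous f := continuous_iff_continuousAt.2 fun θ => (hf1 θ).continuousAt
  have hgc : Continuous g := continuous_iff_continuousAt.2 fun θ => (hg1 θ).continuousAt
  have hf1c : Continuous f1 := continuous_iff_continuousAt.2 fun θ => (hf2 θ).continuousAt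
  have hg1c : Continuous g1 := continuous_iff_continuousAt.2 fun θ => (hg2 θ).continuousAt
  have key : ∀ {p q : ℂ}, ‖p‖ ≤ M → ‖q‖ ≤ N → ‖p * q‖ ≤ M * N := fun hp hq => by
    rw [norm_mul]; exact mul_le_mul hp hq (norm_nonneg _) hM
  have hMN := mul_nonneg hM hN
  refine ⟨fun θ => f1 θ * g θ + f θ * g1 θ,
    fun θ => (f2 θ * g θ + f1 θ * g1 θ) + (f1 θ * g1 θ + f θ * g2 θ),
    fun θ => (hf1 θ).mul (hg1 θ),
    fun θ => ((hf2 θ).mul (hg1 θ)).add ((hf1 θ).mul (hg2 θ)), by fun_prop,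
    fun θ => ⟨?_, ?_, ?_⟩⟩
  · refine (key (hf4 θ).1 (hg4 θ).1).trans (by linarith)
  · have e1 := key (hf4 θ).2.1 (hg4 θ).1
    have e2 := key (hf4 θ).1 (hg4 θ).2.1
    exact (norm_add_le _ _).trans (by linarith)
  · have e1 := key (hf4 θ).2.2 (hg4 θ).1
    have e2 := key (hf4 θ).2.1 (hg4 θ).2.1
    have e3 := key (hf4 θ).1 (hg4 θ).2.2
    have e4 := norm_add_le (f2 θ * g θ) (f1 θ * g1 θ)
    have e5 := norm_add_le (f1 θ * g1 θ) (f θ * g2 θ)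
    exact (norm_add_le _ _).trans (by linarith)

/-- Two derivatives bring down at most k², and the remaining powers of f are bounded by 1. This
quadratic growth is the origin of the weight (1+|x|)². -/
theorem pow (hf : C2Bound f M) (hM : 1 ≤ M) (h1 : ∀ θ, ‖f θ‖ ≤ 1) (k : ℕ) :
    C2Bound (fun θ => f θ ^ k) ((1 + k) ^ 2 * M ^ 2) := by
  obtain ⟨f1, f2, hf1, hf2, hf3, hf4⟩ := hf
  have hfc : Continuous f := continuous_iff_continuousAt.2 fun θ => (hf1 θ).continuousAt
  have hf1c : Continuous f1 := continuous_iff_continuousAt.2 fun θ => (hf2 θ).continuousAt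
  have hp : ∀ (j : ℕ) θ, ‖f θ ^ j‖ ≤ 1 := fun j θ => by
    rw [norm_pow]; exact pow_le_one₀ (norm_nonneg _) (h1 θ)
  have hk : (0 : ℝ) ≤ k := Nat.cast_nonneg k
  have hk1 : ((k - 1 : ℕ) : ℝ) ≤ k := by exact_mod_cast Nat.sub_le k 1
  have hMM : M ≤ M ^ 2 := by nlinarith
  -- The truncated exponents k - 1 and k - 2 are harmless: whenever truncation occurs, the
  -- coefficient in front is 0.
  refine ⟨fun θ => k * f θ ^ (k - 1) * f1 θ,
    fun θ => (k * (((k - 1 : ℕ) : ℂ) * f θ ^ (k - 1 - 1) * f1 θ)) * f1 θ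
      + k * f θ ^ (k - 1) * f2 θ,
    fun θ => (hf1 θ).pow k,
    fun θ => (((hf1 θ).pow (k - 1)).const_mul (k : ℂ)).mul (hf2 θ), by fun_prop,
    fun θ => ⟨?_, ?_, ?_⟩⟩
  · refine (hp k θ).trans ?_
    nlinarith [mul_nonneg hk hk]
  · rw [norm_mul, norm_mul, Complex.norm_natCast]
    calc (k : ℝ) * ‖f θ ^ (k - 1)‖ * ‖f1 θ‖ ≤ k * 1 * M := by
          gcongr
          · exact hp _ θ
          · exact (hf4 θ).2.1
      _ ≤ _ := by nlinarith [mul_nonneg hk hk, mul_nonneg hk (sq_nonneg M)]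
  · refine (norm_add_le _ _).trans ?_
    simp only [norm_mul, Complex.norm_natCast]
    calc (k : ℝ) * (((k - 1 : ℕ) : ℝ) * ‖f θ ^ (k - 1 - 1)‖ * ‖f1 θ‖) * ‖f1 θ‖
          + k * ‖f θ ^ (k - 1)‖ * ‖f2 θ‖ ≤ k * (k * 1 * M) * M + k * 1 * M := by
          gcongr
          · exact hp _ θ
          · exact (hf4 θ).2.1
          · exact (hf4 θ).2.1
          · exact hp _ θ
          · exact (hf4 θ).2.2
      _ ≤ _ := by nlinarith [mul_nonneg hk hk, mul_nonneg hk (sq_nonneg M)]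

theorem exists_of_periodic {T : ℝ} (hT : 0 < T) (hf : ContDiff ℝ 2 f)
    (hp : Function.Periodic f T) : ∃ M, 1 ≤ M ∧ C2Bound f M := by
  have hd1 : Differentiable ℝ f := hf.differentiable (by norm_num)
  have hf1 : ContDiff ℝ 1 (deriv f) := ((contDiff_succ_iff_deriv (n := 1)).1
    (by simpa [one_add_one_eq_two] using hf)).2.2
  have hd2 : Differentiable ℝ (deriv f) := hf1.differentiable (by norm_num)
  have hc2 : Continuous (deriv (deriv f)) := hf1.continuous_deriv (by norm_num)
  have hp1 : Function.Periodic (deriv f) T := fun x => by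
    rw [← deriv_comp_add_const]
    congr 1
    exact funext hp
  have hp2 : Function.Periodic (deriv (deriv f)) T := fun x => by
    rw [← deriv_comp_add_const]
    congr 1
    exact funext hp1
  have hb : ∀ {g : ℝ → ℂ}, Function.Periodic g T → Continuous g → ∃ M, ∀ θ, ‖g θ‖ ≤ M := by
    intro g hg hgc
    obtain ⟨M, hM⟩ := (hg.isBounded_of_continuous hT.ne' hgc).exists_norm_le
    exact ⟨M, fun θ => hM _ ⟨θ, rfl⟩⟩
  obtain ⟨M0, h0⟩ := hb hp hf.continuous
  obtain ⟨M1, h1⟩ := hb hp1 hd2.continuous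
  obtain ⟨M2, h2⟩ := hb hp2 hc2
  refine ⟨max 1 (max M0 (max M1 M2)), le_max_left _ _, deriv f, deriv (deriv f),
    fun θ => (hd1 θ).hasDerivAt, fun θ => (hd2 θ).hasDerivAt, hc2, fun θ => ⟨?_, ?_, ?_⟩⟩
  · exact (h0 θ).trans (by simp)
  · exact (h1 θ).trans (by simp)
  · exact (h2 θ).trans (by simp)

-- Up to the factor -is, sin θ e^{is cos θ} is the derivative of e^{is cos θ}. Integration by parts
-- gains 1/|s| and the boundary terms cancel by `hπ`. The integral with f' is split at 0, the
-- negative half is reflected, and each half costs 14 M |s|^{-1/2}.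
open intervalIntegral in
theorem norm_integral_sin_mul_le (hf : C2Bound f M) (hπ : f Real.pi = f (-Real.pi)) {s : ℝ}
    (hs : 1 ≤ |s|) :
    ‖∫ θ in (-Real.pi)..Real.pi, Real.sin θ * (Complex.exp (Complex.I * (s * Real.cos θ)) * f θ)‖
      ≤ 28 * M * |s| ^ (-(3 / 2) : ℝ) := by
  have hfc := hf.continuous
  obtain ⟨f1, f2, hf1, hf2, hf3, hf4⟩ := hf
  have hf1c : Continuous f1 := continuous_iff_continuousAt.2 fun θ => (hf2 θ).continuousAt
  have hs0 : (0 : ℝ) < |s| := by linarith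
  set e : ℝ → ℂ := fun θ => Complex.exp (Complex.I * (s * Real.cos θ)) with he
  have hec : Continuous e := by fun_prop
  have hed : ∀ θ, HasDerivAt e (e θ * (Complex.I * (s * ((-Real.sin θ : ℝ) : ℂ)))) θ := fun θ =>
    ((((Real.hasDerivAt_cos θ).ofReal_comp).const_mul (s : ℂ)).const_mul Complex.I).cexp
  have hibp := integral_mul_deriv_eq_deriv_mul (a := -Real.pi) (b := Real.pi)
    (fun θ _ => hf1 θ) (fun θ _ => hed θ) (hf1c.intervalIntegrable _ _)
    ((by fun_prop : Continuous _).intervalIntegrable _ _)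
  have heπ : e (-Real.pi) = e Real.pi := by simp [he]
  rw [hπ, heπ, sub_self, zero_sub] at hibp
  have hL : (∫ θ in (-Real.pi)..Real.pi, f θ * (e θ * (Complex.I * (s * ((-Real.sin θ : ℝ) : ℂ)))))
      = -(Complex.I * s) * ∫ θ in (-Real.pi)..Real.pi, Real.sin θ * (e θ * f θ) := by
    rw [← intervalIntegral.integral_const_mul]
    refine integral_congr fun θ _ => ?_
    push_cast
    ring
  have hi : ∀ a b : ℝ, IntervalIntegrable (fun θ => f1 θ * e θ) MeasureTheory.volume a b :=
    fun a b => (hf1c.mul hec).intervalIntegrable a b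
  have hsp : (∫ θ in (-Real.pi)..Real.pi, f1 θ * e θ)
      = (∫ θ in (0 : ℝ)..Real.pi, e θ * f1 (-θ)) + ∫ θ in (0 : ℝ)..Real.pi, e θ * f1 θ := by
    rw [← integral_add_adjacent_intervals (hi (-Real.pi) 0) (hi 0 Real.pi)]
    congr 1
    · rw [← neg_zero, ← integral_comp_neg, neg_zero]
      refine integral_congr fun θ _ => ?_
      simp only [he, Real.cos_neg]
      ring
    · exact integral_congr fun θ _ => mul_comm _ _
  have hb1 := norm_integral_exp_cos_mul_le hs hf2 hf3 (fun θ => (hf4 θ).2.1)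
    (fun θ => (hf4 θ).2.2)
  have hb2 := norm_integral_exp_cos_mul_le (G := fun θ => f1 (-θ)) (G' := fun θ => -f2 (-θ)) hs
    (fun θ => by
      have h := (hf2 (-θ)).scomp θ (hasDerivAt_neg θ)
      simpa [Function.comp_def] using h) (by fun_prop) (fun θ => (hf4 (-θ)).2.1)
    (fun θ => by rw [norm_neg]; exact (hf4 (-θ)).2.2)
  have h := congrArg norm hibp
  rw [hL, norm_mul, norm_neg, norm_neg, norm_mul, Complex.norm_I, one_mul, Complex.norm_real,
    Real.norm_eq_abs, hsp] at h
  have h' := h.le.trans ((norm_add_le _ _).trans (add_le_add hb2 hb1))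
  have hpow : |s| ^ (-(1 / 2) : ℝ) = |s| * |s| ^ (-(3 / 2) : ℝ) := by
    nth_rewrite 2 [← Real.rpow_one |s|]
    rw [← Real.rpow_add hs0]
    norm_num
  rw [hpow] at h'
  refine le_of_mul_le_mul_left ?_ hs0
  linarith

end C2Bound

/-! ### Contour integration in the right half plane -/

/-- The closed right half-plane without its origin. -/
def puncturedHalfPlane : Set ℂ := {l | 0 ≤ l.re ∧ l ≠ 0}

-- The limit of l h(l) is uniform in the angle, which is what the filter `atTop ×ˢ ⊤` records, so it
-- passes under the integral over a half circle. One statement serves both radii tending to ∞ and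
-- radii tending to 0.
open intervalIntegral in
theorem tendsto_integral_arc {h : ℂ → ℂ} {c : ℂ} {u : ℕ → ℝ} {F : Filter ℂ}
    (hc : ContinuousOn h puncturedHalfPlane)
    (hF : Tendsto (fun l => l * h l) (F ⊓ 𝓟 puncturedHalfPlane) (𝓝 c))
    (hu : Tendsto (fun p : ℕ × ℝ => Complex.exp (u p.1 + p.2 * Complex.I)) (atTop ×ˢ ⊤) F) :
    Tendsto (fun N => ∫ y in (-(Real.pi / 2))..(Real.pi / 2),
      Complex.exp (u N + y * Complex.I) * h (Complex.exp (u N + y * Complex.I)))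
      atTop (𝓝 (Real.pi * c)) := by
  have hmem : ∀ x y : ℝ, y ∈ Set.Icc (-(Real.pi / 2)) (Real.pi / 2) →
      Complex.exp (x + y * Complex.I) ∈ puncturedHalfPlane := fun x y hy => by
    refine ⟨?_, Complex.exp_ne_zero _⟩
    rw [Complex.exp_re]
    simp only [Complex.add_re, Complex.ofReal_re, Complex.mul_re, Complex.I_re, mul_zero,
      Complex.ofReal_im, Complex.I_im, Complex.add_im, Complex.mul_im, mul_one, add_zero, sub_zero,
      zero_add]
    exact mul_nonneg (Real.exp_nonneg _) (Real.cos_nonneg_of_mem_Icc hy)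
  have hpi := Real.pi_pos
  rw [Metric.tendsto_atTop]
  intro ε hε
  have hε' : 0 < ε / (2 * Real.pi) := by positivity
  have h1 := (Metric.tendsto_nhds.1 hF) _ hε'
  rw [eventually_inf_principal] at h1
  have h2 := hu.eventually h1
  obtain ⟨s, hs, t, ht, hst⟩ := mem_prod_iff.1 h2
  rw [mem_top] at ht
  obtain ⟨N0, hN0⟩ := mem_atTop_sets.1 hs
  refine ⟨N0, fun N hN => ?_⟩
  have hb : ∀ y ∈ Set.Icc (-(Real.pi / 2)) (Real.pi / 2),
      ‖Complex.exp (u N + y * Complex.I) * h (Complex.exp (u N + y * Complex.I)) - c‖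
        ≤ ε / (2 * Real.pi) := fun y hy => by
    have := hst (Set.mk_mem_prod (hN0 N hN) (ht ▸ Set.mem_univ y)) (hmem _ _ hy)
    rw [dist_eq_norm] at this
    exact this.le
  have hcont : ContinuousOn (fun y : ℝ => Complex.exp (u N + y * Complex.I) *
      h (Complex.exp (u N + y * Complex.I))) (Set.uIcc (-(Real.pi / 2)) (Real.pi / 2)) := by
    rw [Set.uIcc_of_le (by linarith)]
    refine ContinuousOn.mul (by fun_prop) (hc.comp (by fun_prop) fun y hy => hmem _ _ hy)
  have hconst : (Real.pi * c : ℂ) = ∫ y in (-(Real.pi / 2))..(Real.pi / 2), c := by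
    rw [integral_const]
    simp
  rw [dist_eq_norm, hconst, ← integral_sub hcont.intervalIntegrable (by simp)]
  refine (norm_integral_le_of_norm_le_const (C := ε / (2 * Real.pi)) fun y hy => ?_).trans_lt ?_
  · rw [Set.uIoc_of_le (by linarith)] at hy
    exact hb y ⟨hy.1.le, hy.2⟩
  · rw [abs_of_pos (by linarith), sub_neg_eq_add, add_halves]
    field_simp
    linarith

open intervalIntegral in
/-- Cauchy's theorem on a half-annulus, in the limit of a large outer and a small inner radius. -/
theorem integral_axis_eq {h : ℂ → ℂ} {cI c0 : ℂ} (hc : ContinuousOn h puncturedHalfPlane)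
    (hd : DifferentiableOn ℂ h {l | 0 < l.re})
    (hI : Tendsto (fun l => l * h l) (Bornology.cobounded ℂ ⊓ 𝓟 puncturedHalfPlane) (𝓝 cI))
    (h0 : Tendsto (fun l => l * h l) (𝓝 0 ⊓ 𝓟 puncturedHalfPlane) (𝓝 c0))
    {a b : ℝ} (ha : 0 < a) (hab : a < b)
    (hj : ∀ τ : ℝ, 0 < τ → τ ∉ Set.Icc a b → h (Complex.I * τ) + h (-(Complex.I * τ)) = 0) :
    ∫ τ in a..b, (h (Complex.I * τ) + h (-(Complex.I * τ))) = Real.pi * (cI - c0) := by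
  set J : ℝ → ℂ := fun τ => h (Complex.I * τ) + h (-(Complex.I * τ)) with hJ
  have hb : 0 < b := ha.trans hab
  have hpi := Real.pi_pos
  -- With l = e^ζ the half-annulus becomes a rectangle of height π and h(l) dl = g(ζ) dζ, so
  -- Cauchy's theorem for rectangles applies.
  set g : ℂ → ℂ := fun ζ => Complex.exp ζ * h (Complex.exp ζ) with hg
  have hre : ∀ x y : ℝ, (Complex.exp (x + y * Complex.I)).re = Real.exp x * Real.cos y := by
    intro x y
    rw [Complex.exp_re]
    simp
  have hJc : ContinuousOn J (Set.Ioi 0) := by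
    refine ContinuousOn.add (hc.comp (by fun_prop) fun τ hτ => ?_)
      (hc.comp (by fun_prop) fun τ hτ => ?_)
    · exact ⟨by simp, by simpa using (ne_of_gt hτ : τ ≠ 0)⟩
    · exact ⟨by simp, by simpa using (ne_of_gt hτ : τ ≠ 0)⟩
  have hIio : ∀ {s t : ℝ}, 0 < s → 0 < t → Set.uIcc s t ⊆ Set.Ioi 0 := fun hs ht x hx =>
    lt_of_lt_of_le (lt_min hs ht) hx.1
  have hJi : ∀ {s t : ℝ}, 0 < s → 0 < t → IntervalIntegrable J MeasureTheory.volume s t :=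
    fun hs ht => (hJc.mono (hIio hs ht)).intervalIntegrable
  -- the integral of `J` over a larger interval
  have hJbig : ∀ {s t : ℝ}, 0 < s → s < a → b < t → ∫ τ in s..t, J τ = ∫ τ in a..b, J τ := by
    intro s t hs hsa hbt
    have z1 : ∫ τ in s..a, J τ = 0 := by
      have : ∫ τ in s..a, J τ = ∫ τ in s..a, (0 : ℂ) := by
        refine integral_congr_Ioo_of_le hsa.le fun τ hτ => ?_
        exact hj τ (hs.trans hτ.1) fun hm => absurd hm.1 (not_le.2 hτ.2)
      simpa using this
    have z2 : ∫ τ in b..t, J τ = 0 := by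
      have : ∫ τ in b..t, J τ = ∫ τ in b..t, (0 : ℂ) := by
        refine integral_congr_Ioo_of_le hbt.le fun τ hτ => ?_
        exact hj τ (hb.trans hτ.1) fun hm => absurd hm.2 (not_le.2 hτ.1)
      simpa using this
    rw [← integral_add_adjacent_intervals (hJi hs ha) (hJi ha (hb.trans hbt)),
      ← integral_add_adjacent_intervals (hJi ha hb) (hJi hb (hb.trans hbt)), z1, z2]
    simp
  -- Cauchy's theorem in logarithmic coordinates
  have hCauchy : ∀ u v : ℝ, u ≤ v → (∫ τ in (Real.exp u)..(Real.exp v), J τ) =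
      (∫ y in (-(Real.pi / 2))..(Real.pi / 2), g (v + y * Complex.I)) -
        ∫ y in (-(Real.pi / 2))..(Real.pi / 2), g (u + y * Complex.I) := by
    intro u v huv
    have hrect := Complex.integral_boundary_rect_eq_zero_of_continuousOn_of_differentiableOn g
      ⟨u, -(Real.pi / 2)⟩ ⟨v, Real.pi / 2⟩ (by
        refine ContinuousOn.mul (by fun_prop) (hc.comp (by fun_prop) fun ζ hζ => ?_)
        refine ⟨?_, Complex.exp_ne_zero _⟩
        rw [Complex.exp_re]
        refine mul_nonneg (Real.exp_nonneg _) (Real.cos_nonneg_of_mem_Icc ?_)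
        have := hζ.2
        simpa [Set.uIcc_of_le (show -(Real.pi / 2) ≤ Real.pi / 2 by linarith)] using this)
      (by
        refine DifferentiableOn.mul (by fun_prop) (hd.comp (by fun_prop) fun ζ hζ => ?_)
        have h2 := hζ.2
        simp only [min_eq_left (show -(Real.pi / 2) ≤ Real.pi / 2 by linarith),
          max_eq_right (show -(Real.pi / 2) ≤ Real.pi / 2 by linarith)] at h2
        change 0 < (Complex.exp ζ).re
        rw [Complex.exp_re]
        exact mul_pos (Real.exp_pos _) (Real.cos_pos_of_mem_Ioo h2))
    have e1 : ∀ x : ℝ, Complex.exp (x + (-(Real.pi / 2) : ℝ) * Complex.I)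
        = -(Complex.I * Real.exp x) := fun x => by
      rw [Complex.exp_add, Complex.exp_mul_I, ← Complex.ofReal_cos, ← Complex.ofReal_sin,
        Real.cos_neg, Real.sin_neg]
      simp [mul_comm]
    have e2 : ∀ x : ℝ, Complex.exp (x + (Real.pi / 2 : ℝ) * Complex.I)
        = Complex.I * Real.exp x := fun x => by
      rw [Complex.exp_add, Complex.exp_mul_I, ← Complex.ofReal_cos, ← Complex.ofReal_sin]
      simp [mul_comm]
    have hcomp : ∀ k : ℝ, k = 1 ∨ k = -1 → ContinuousOn (fun x : ℝ => (Real.exp x : ℂ) *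
        h (k * (Complex.I * Real.exp x))) (Set.uIcc u v) := by
      intro k hk
      refine ContinuousOn.mul (by fun_prop) (hc.comp (by fun_prop) fun x _ => ?_)
      rcases hk with rfl | rfl <;> exact ⟨by simp, by simp⟩
    have i1 := hcomp 1 (Or.inl rfl)
    have i2 := hcomp (-1) (Or.inr rfl)
    have hsub : (∫ τ in (Real.exp u)..(Real.exp v), J τ)
        = ∫ x in u..v, ((Real.exp x : ℂ) * h ((1 : ℝ) * (Complex.I * Real.exp x)) +
          (Real.exp x : ℂ) * h ((-1 : ℝ) * (Complex.I * Real.exp x))) := by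
      rw [← integral_deriv_smul_comp' (f := Real.exp) (f' := Real.exp) (g := J)
        (fun x _ => Real.hasDerivAt_exp x) (by fun_prop) (hJc.mono ?_)]
      · refine integral_congr fun x _ => ?_
        simp only [hJ, Function.comp_apply, Complex.real_smul]
        push_cast
        rw [one_mul, neg_one_mul, mul_add]
      · rintro _ ⟨x, -, rfl⟩
        exact Real.exp_pos x
    rw [hsub, integral_add i1.intervalIntegrable i2.intervalIntegrable]
    have j1 : (∫ x in u..v, g (x + (-(Real.pi / 2) : ℝ) * Complex.I)) =
        -(Complex.I * ∫ x in u..v, (Real.exp x : ℂ) * h ((-1 : ℝ) * (Complex.I * Real.exp x))) := by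
      rw [← integral_const_mul, ← intervalIntegral.integral_neg]
      refine integral_congr fun x _ => ?_
      simp only [hg, e1]
      push_cast
      rw [neg_one_mul]
      ring
    have j2 : (∫ x in u..v, g (x + (Real.pi / 2 : ℝ) * Complex.I)) =
        Complex.I * ∫ x in u..v, (Real.exp x : ℂ) * h ((1 : ℝ) * (Complex.I * Real.exp x)) := by
      rw [← integral_const_mul]
      refine integral_congr fun x _ => ?_
      simp only [hg, e2]
      push_cast
      rw [one_mul]
      ring
    simp only [smul_eq_mul] at hrect
    rw [j1, j2] at hrect
    refine mul_left_cancel₀ Complex.I_ne_zero ?_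
    linear_combination -hrect
  have hexp : ∀ x y : ℝ, ‖Complex.exp (x + y * Complex.I)‖ = Real.exp x := fun x y => by
    rw [Complex.norm_exp]; simp
  have tI : Tendsto (fun p : ℕ × ℝ => Complex.exp (((p.1 : ℝ) : ℂ) + p.2 * Complex.I))
      (atTop ×ˢ ⊤) (Bornology.cobounded ℂ) := by
    rw [← tendsto_norm_atTop_iff_cobounded]
    simp only [hexp]
    exact (Real.tendsto_exp_atTop.comp tendsto_natCast_atTop_atTop).comp tendsto_fst
  have t0 : Tendsto (fun p : ℕ × ℝ => Complex.exp (((-(p.1 : ℝ) : ℝ) : ℂ) + p.2 * Complex.I))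
      (atTop ×ˢ ⊤) (𝓝 0) := by
    rw [tendsto_zero_iff_norm_tendsto_zero]
    simp only [hexp]
    exact (Real.tendsto_exp_neg_atTop_nhds_zero.comp tendsto_natCast_atTop_atTop).comp tendsto_fst
  have l1 := (tendsto_integral_arc (u := fun N => (N : ℝ)) hc hI tI).sub
    (tendsto_integral_arc (u := fun N => -(N : ℝ)) hc h0 t0)
  -- Since `J` vanishes outside [a, b], its integral over [e^{-N}, e^N] is eventually constant in N.
  have hev : (fun _ : ℕ => ∫ τ in a..b, J τ) =ᶠ[atTop] fun N : ℕ =>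
      (∫ y in (-(Real.pi / 2))..(Real.pi / 2), g (((N : ℝ) : ℂ) + y * Complex.I)) -
        ∫ y in (-(Real.pi / 2))..(Real.pi / 2), g (((-(N : ℝ) : ℝ) : ℂ) + y * Complex.I) := by
    have u1 : ∀ᶠ N : ℕ in atTop, b < Real.exp N :=
      (Real.tendsto_exp_atTop.comp tendsto_natCast_atTop_atTop).eventually_gt_atTop b
    have u2 : ∀ᶠ N : ℕ in atTop, Real.exp (-(N : ℝ)) < a :=
      (Real.tendsto_exp_neg_atTop_nhds_zero.comp tendsto_natCast_atTop_atTop).eventually_lt_const ha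
    filter_upwards [u1, u2] with N h1 h2
    have hN : (0 : ℝ) ≤ N := Nat.cast_nonneg N
    rw [← hCauchy _ _ (by linarith), hJbig (Real.exp_pos _) h2 h1]
  have := tendsto_nhds_unique (tendsto_const_nhds.congr' hev) l1
  rw [this]
  ring

/-! ### The inverse Joukowski map on the upper half plane -/

/-- The square root of `-i w`, which is continuous on the closed upper half plane. -/
def rotSqrt (w : ℂ) : ℂ := (-(Complex.I * w)) ^ (((2 : ℕ) : ℂ)⁻¹)

/-- The solution `r` of `r + 1/r = ζ` in the closed unit disc, for `ζ` in the closed upper half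
plane. -/
def joukInv (ζ : ℂ) : ℂ :=
  (rotSqrt (ζ + 2) - rotSqrt (ζ - 2)) / (rotSqrt (ζ + 2) + rotSqrt (ζ - 2))

theorem rotSqrt_sq (w : ℂ) : rotSqrt w ^ 2 = -(Complex.I * w) :=
  Complex.cpow_nat_inv_pow _ two_ne_zero

theorem rotSqrt_re_nonneg (w : ℂ) : 0 ≤ (rotSqrt w).re := by
  unfold rotSqrt
  by_cases h : -(Complex.I * w) = 0
  · rw [h, Complex.zero_cpow (by simp)]
    simp
  · rw [Complex.cpow_def_of_ne_zero h, Complex.exp_re]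
    refine mul_nonneg (Real.exp_nonneg _) (Real.cos_nonneg_of_mem_Icc ?_)
    have e : (Complex.log (-(Complex.I * w)) * ((2 : ℕ) : ℂ)⁻¹).im
        = Complex.arg (-(Complex.I * w)) / 2 := by
      have : ((2 : ℕ) : ℂ)⁻¹ = ((2⁻¹ : ℝ) : ℂ) := by push_cast; rfl
      rw [this, Complex.im_mul_ofReal, Complex.log_im]
      ring
    rw [e]
    have h1 := Complex.neg_pi_lt_arg (-(Complex.I * w))
    have h2 := Complex.arg_le_pi (-(Complex.I * w))
    constructor <;> linarith

theorem rotSqrt_re_sq_sub (w : ℂ) : (rotSqrt w).re ^ 2 - (rotSqrt w).im ^ 2 = w.im := by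
  have h := congrArg Complex.re (rotSqrt_sq w)
  simp [sq] at h
  linarith

theorem rotSqrt_re_mul_im (w : ℂ) : 2 * ((rotSqrt w).re * (rotSqrt w).im) = -w.re := by
  have h := congrArg Complex.im (rotSqrt_sq w)
  simp [sq] at h
  linarith

theorem continuousAt_rotSqrt {w : ℂ} (hw : 0 ≤ w.im) : ContinuousAt rotSqrt w := by
  have : ContinuousAt (fun x : ℂ => x ^ (((2 : ℕ) : ℂ)⁻¹)) (-(Complex.I * w)) :=
    Complex.continuousAt_cpow_const_of_re_pos (Or.inl (by simpa using hw)) (by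
      norm_num)
  exact ContinuousAt.comp (f := fun w : ℂ => -(Complex.I * w)) this (by fun_prop)

theorem differentiableAt_rotSqrt {w : ℂ} (hw : 0 < w.im) : DifferentiableAt ℂ rotSqrt w := by
  unfold rotSqrt
  exact DifferentiableAt.cpow_const (by fun_prop) (Or.inl (by simpa using hw))

theorem rotSqrt_add_ne (ζ : ℂ) : rotSqrt (ζ + 2) + rotSqrt (ζ - 2) ≠ 0 := by
  intro h
  have h1 := rotSqrt_sq (ζ + 2)
  have h2 := rotSqrt_sq (ζ - 2)
  have : Complex.I = 0 := by
    linear_combination (1 / 4 : ℂ) * (h1 - h2) - (1 / 4 : ℂ) * (rotSqrt (ζ + 2) - rotSqrt (ζ - 2)) * h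
  exact Complex.I_ne_zero this

theorem rotSqrt_sub_ne (ζ : ℂ) : rotSqrt (ζ + 2) - rotSqrt (ζ - 2) ≠ 0 := by
  intro h
  have h1 := rotSqrt_sq (ζ + 2)
  have h2 := rotSqrt_sq (ζ - 2)
  have : Complex.I = 0 := by
    linear_combination (1 / 4 : ℂ) * (h1 - h2) - (1 / 4 : ℂ) * (rotSqrt (ζ + 2) + rotSqrt (ζ - 2)) * h
  exact Complex.I_ne_zero this

theorem joukInv_ne_zero (ζ : ℂ) : joukInv ζ ≠ 0 :=
  div_ne_zero (rotSqrt_sub_ne ζ) (rotSqrt_add_ne ζ)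

/-- With A and B the rotated square roots of ζ + 2 and ζ - 2, the sum is 2(A² + B²)/(A² - B²), where
A² + B² = -2iζ and A² - B² = -4i. -/
theorem joukInv_add_inv (ζ : ℂ) : joukInv ζ + (joukInv ζ)⁻¹ = ζ := by
  have h1 := rotSqrt_sq (ζ + 2)
  have h2 := rotSqrt_sq (ζ - 2)
  have n1 := rotSqrt_add_ne ζ
  have n2 := rotSqrt_sub_ne ζ
  unfold joukInv
  rw [inv_div]
  field_simp
  linear_combination (2 - ζ) * h1 + (2 + ζ) * h2

theorem continuousAt_joukInv {ζ : ℂ} (h : 0 ≤ ζ.im) : ContinuousAt joukInv ζ := by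
  have h1 : ContinuousAt (fun ζ => rotSqrt (ζ + 2)) ζ :=
    ContinuousAt.comp (f := fun ζ : ℂ => ζ + 2) (continuousAt_rotSqrt (by simpa using h)) (by fun_prop)
  have h2 : ContinuousAt (fun ζ => rotSqrt (ζ - 2)) ζ :=
    ContinuousAt.comp (f := fun ζ : ℂ => ζ - 2) (continuousAt_rotSqrt (by simpa using h)) (by fun_prop)
  exact (h1.sub h2).div (h1.add h2) (rotSqrt_add_ne ζ)

theorem differentiableAt_joukInv {ζ : ℂ} (h : 0 < ζ.im) : DifferentiableAt ℂ joukInv ζ := by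
  have h1 : DifferentiableAt ℂ (fun ζ => rotSqrt (ζ + 2)) ζ :=
    DifferentiableAt.comp (f := fun ζ : ℂ => ζ + 2) ζ (differentiableAt_rotSqrt (by simpa using h)) (by fun_prop)
  have h2 : DifferentiableAt ℂ (fun ζ => rotSqrt (ζ - 2)) ζ :=
    DifferentiableAt.comp (f := fun ζ : ℂ => ζ - 2) ζ (differentiableAt_rotSqrt (by simpa using h)) (by fun_prop)
  exact (h1.sub h2).div (h1.add h2) (rotSqrt_add_ne ζ)

theorem abs_rotSqrt_im_le {w : ℂ} (h : 0 ≤ w.im) : |(rotSqrt w).im| ≤ (rotSqrt w).re :=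
  abs_le_of_sq_le_sq (by linarith [rotSqrt_re_sq_sub w]) (rotSqrt_re_nonneg w)

/-- Both square roots lie in the sector |Im| ≤ Re, so the real part of one times the conjugate of
the other is nonnegative, and their difference is no longer than their sum. -/
theorem norm_joukInv_le {ζ : ℂ} (h : 0 ≤ ζ.im) : ‖joukInv ζ‖ ≤ 1 := by
  have h1 := abs_le.1 (abs_rotSqrt_im_le (w := ζ + 2) (by simpa using h))
  have h2 := abs_le.1 (abs_rotSqrt_im_le (w := ζ - 2) (by simpa using h))
  unfold joukInv
  rw [norm_div]
  refine div_le_one_of_le₀ ?_ (norm_nonneg _)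
  refine abs_le_of_sq_le_sq' ?_ (norm_nonneg _) |>.2
  rw [← Complex.normSq_eq_norm_sq, ← Complex.normSq_eq_norm_sq, Complex.normSq_apply,
    Complex.normSq_apply]
  simp only [Complex.sub_re, Complex.sub_im, Complex.add_re, Complex.add_im]
  nlinarith [mul_nonneg (sub_nonneg.2 h1.2) (sub_nonneg.2 h2.2),
    mul_nonneg (neg_le_iff_add_nonneg.1 h1.1) (neg_le_iff_add_nonneg.1 h2.1)]

/-- On the cut the two square roots lie on the boundary rays Im = ±Re. The sign decides which of the
two unimodular roots is the boundary value from above: e^{-iθ} and not e^{iθ}, as used in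
`joukInv_two_cos`. -/
theorem joukInv_im_nonpos {x : ℝ} (h : |x| ≤ 2) : (joukInv x).im ≤ 0 := by
  have hx := abs_le.1 h
  have a1 := rotSqrt_re_sq_sub (x - 2)
  have a2 := rotSqrt_re_mul_im (x - 2)
  have b1 := rotSqrt_re_sq_sub (x + 2)
  have b2 := rotSqrt_re_mul_im (x + 2)
  have a0 := rotSqrt_re_nonneg (x - 2)
  have b0 := rotSqrt_re_nonneg (x + 2)
  unfold joukInv
  set A := rotSqrt (x - 2)
  set B := rotSqrt (x + 2)
  simp at a1 a2 b1 b2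
  have hA : A.im = A.re := by
    rcases sq_eq_sq_iff_eq_or_eq_neg.1 (sub_eq_zero.1 a1) with e | e
    · exact e.symm
    · have : A.im = 0 := by nlinarith
      rw [e, this]; simp
  have hB : B.im = -B.re := by
    rcases sq_eq_sq_iff_eq_or_eq_neg.1 (sub_eq_zero.1 b1) with e | e
    · have : B.im = 0 := by nlinarith
      rw [e, this]; simp
    · linarith
  rw [Complex.div_im, ← sub_div]
  refine div_nonpos_of_nonpos_of_nonneg ?_ (Complex.normSq_nonneg _)
  simp only [Complex.sub_re, Complex.sub_im, Complex.add_re, Complex.add_im, hA, hB]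
  nlinarith [mul_nonneg a0 b0]

/-- The Joukowski map is injective on the unit disc. -/
theorem joukowski_unique {r s : ℂ} (hr : r ≠ 0) (hs : s ≠ 0) (h : r + r⁻¹ = s + s⁻¹)
    (hr1 : ‖r‖ < 1) (hs1 : ‖s‖ ≤ 1) : r = s := by
  have h1 : (r - s) * (1 - r * s) = 0 := by
    field_simp at h
    linear_combination -h
  rcases mul_eq_zero.1 h1 with e | e
  · exact sub_eq_zero.1 e
  · have : ‖r * s‖ = 1 := by rw [← sub_eq_zero.1 e, norm_one]
    rw [norm_mul] at this
    nlinarith [norm_nonneg r, norm_nonneg s]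

theorem add_inv_of_norm_one {r : ℂ} (h : ‖r‖ = 1) : r + r⁻¹ = ((2 * r.re : ℝ) : ℂ) := by
  rw [Complex.inv_eq_conj h, Complex.add_conj]

theorem joukInv_two_cos {θ : ℝ} (h0 : 0 ≤ θ) (hπ : θ ≤ Real.pi) :
    joukInv ((2 * Real.cos θ : ℝ) : ℂ) = Complex.exp (-(θ * Complex.I)) := by
  set x : ℝ := 2 * Real.cos θ with hx
  have hx2 : |x| ≤ 2 := by
    rw [hx, abs_mul, abs_two]
    linarith [Real.abs_cos_le_one θ]
  have hs := joukInv_add_inv x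
  have hn := norm_joukInv_le (ζ := x) (by simp)
  have hi := joukInv_im_nonpos hx2
  have hz := joukInv_ne_zero x
  set r := joukInv x
  have e1 : Complex.exp (-(θ * Complex.I)) = ⟨Real.cos θ, -Real.sin θ⟩ := by
    rw [← neg_mul, ← Complex.ofReal_neg, Complex.exp_mul_I, ← Complex.ofReal_cos,
      ← Complex.ofReal_sin, Complex.ext_iff]
    simp [Complex.cos_ofReal_re, Complex.sin_ofReal_re, Complex.cos_ofReal_im, Complex.sin_ofReal_im]
  have e2 : Complex.exp (-(θ * Complex.I)) ≠ 0 := Complex.exp_ne_zero _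
  have e3 : ‖Complex.exp (-(θ * Complex.I))‖ = 1 := by
    rw [← neg_mul, ← Complex.ofReal_neg, Complex.norm_exp_ofReal_mul_I]
  have hr1 : ‖r‖ = 1 := by
    by_contra hne
    have hlt : ‖r‖ < 1 := lt_of_le_of_ne hn hne
    have := joukowski_unique hz e2 (by rw [hs, add_inv_of_norm_one e3, e1]) hlt e3.le
    rw [this, e3] at hlt
    exact lt_irrefl _ hlt
  rw [add_inv_of_norm_one hr1] at hs
  have hre : r.re = Real.cos θ := by
    have : 2 * r.re = x := by exact_mod_cast hs
    rw [hx] at this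
    linarith
  have him : r.im = -Real.sin θ := by
    have hs0 := Real.sin_nonneg_of_nonneg_of_le_pi h0 hπ
    have : r.re ^ 2 + r.im ^ 2 = 1 := by
      have := Complex.sq_norm r
      rw [hr1, Complex.normSq_apply] at this
      linarith
    have h2 : (-r.im) ^ 2 = Real.sin θ ^ 2 := by
      rw [hre] at this
      nlinarith [Real.sin_sq_add_cos_sq θ]
    have := (sq_eq_sq₀ (by linarith) hs0).1 h2
    linarith
  rw [e1]
  exact Complex.ext hre him

theorem joukInv_real_norm_lt {x : ℝ} (h : 2 < |x|) : ‖joukInv x‖ < 1 := by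
  refine lt_of_le_of_ne (norm_joukInv_le (by simp)) fun h1 => ?_
  have hs := joukInv_add_inv x
  rw [add_inv_of_norm_one h1] at hs
  have h2 : 2 * (joukInv x).re = x := by exact_mod_cast hs
  have h3 := Complex.abs_re_le_norm (joukInv x)
  rw [← h2, abs_mul, abs_two] at h
  linarith

/-! ### Resolvent kernels -/

/-- The kernel of the Dirichlet resolvent of the difference Laplacian:
`(r^{|x-y|} - r^{|x|+|y|}) / (r⁻¹ - r)`. -/
def dirKernel (x y : ℤ) (r : ℂ) : ℂ :=
  ∑ j ∈ Finset.range ((x.natAbs + y.natAbs - (x - y).natAbs) / 2),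
    r ^ ((x - y).natAbs + 1 + 2 * j)

/-- The determinant in the denominator of the resolvent kernel. -/
def resDet (m n r s : ℂ) : ℂ := (1 - r ^ 2 - m * r) * (1 - s ^ 2 - m * s) - n ^ 2 * r * s

/-- The diagonal entry of the resolvent kernel. -/
def diagKernel (m n : ℂ) (x y : ℤ) (r s : ℂ) : ℂ :=
  dirKernel x y r + r ^ (x.natAbs + y.natAbs + 1) * (1 - s ^ 2 - m * s) / resDet m n r s

/-- The off-diagonal entry of the resolvent kernel. -/
def offKernel (m n : ℂ) (x y : ℤ) (r s : ℂ) : ℂ :=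
  n * r ^ (x.natAbs + 1) * s ^ (y.natAbs + 1) / resDet m n r s

theorem resDet_symm (m n r s : ℂ) : resDet m n s r = resDet m n r s := by
  unfold resDet; ring

/-- The closed form, cleared of a denominator that vanishes at r = ±1. The finite sum is its
polynomial continuation to these points, which correspond to the edges of the spectrum. -/
theorem dirKernel_mul (x y : ℤ) (r : ℂ) :
    dirKernel x y r * (1 - r ^ 2)
      = r * (r ^ (x - y).natAbs - r ^ x.natAbs * r ^ y.natAbs) := by
  unfold dirKernel
  set N := (x.natAbs + y.natAbs - (x - y).natAbs) / 2 with hN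
  have hN2 : x.natAbs + y.natAbs = (x - y).natAbs + 2 * N := by omega
  rw [← pow_add, hN2]
  have h1 : ∑ j ∈ Finset.range N, r ^ ((x - y).natAbs + 1 + 2 * j)
      = r ^ ((x - y).natAbs + 1) * ∑ j ∈ Finset.range N, (r ^ 2) ^ j := by
    rw [Finset.mul_sum]
    refine Finset.sum_congr rfl fun j _ => ?_
    rw [pow_add _ _ (2 * j), pow_mul r 2 j]
  rw [h1, mul_assoc, geom_sum_mul_neg, pow_add, pow_add, pow_mul]
  ring

theorem dirKernel_zero_left (y : ℤ) (r : ℂ) : dirKernel 0 y r = 0 := by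
  unfold dirKernel
  rw [show ((0 : ℤ).natAbs + y.natAbs - (0 - y).natAbs) / 2 = 0 by omega]
  simp

theorem pow_natAbs_recurrence {r : ℂ} (hr : r ≠ 0) (x : ℤ) :
    (r + r⁻¹) * r ^ x.natAbs - r ^ (x + 1).natAbs - r ^ (x - 1).natAbs
      = if x = 0 then r⁻¹ - r else 0 := by
  rcases lt_trichotomy x 0 with h | rfl | h
  · obtain ⟨k, rfl⟩ : ∃ k : ℕ, x = -((k : ℤ) + 1) := ⟨(-x - 1).toNat, by omega⟩
    rw [if_neg h.ne, show (-((k : ℤ) + 1)).natAbs = k + 1 by omega,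
      show (-((k : ℤ) + 1) + 1).natAbs = k by omega,
      show (-((k : ℤ) + 1) - 1).natAbs = k + 2 by omega]
    field_simp
    ring
  · simp
  · obtain ⟨k, rfl⟩ : ∃ k : ℕ, x = (k : ℤ) + 1 := ⟨(x - 1).toNat, by omega⟩
    rw [if_neg h.ne', show ((k : ℤ) + 1).natAbs = k + 1 by omega,
      show ((k : ℤ) + 1 + 1).natAbs = k + 2 by omega,
      show ((k : ℤ) + 1 - 1).natAbs = k by omega]
    field_simp
    ring

theorem dirKernel_recurrence {r : ℂ} (hr : r ≠ 0) (hr2 : 1 - r ^ 2 ≠ 0) (x y : ℤ) :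
    (r + r⁻¹) * dirKernel x y r - dirKernel (x + 1) y r - dirKernel (x - 1) y r
      = (if x = y then 1 else 0) - (if x = 0 then r ^ y.natAbs else 0) := by
  refine mul_right_cancel₀ hr2 ?_
  have h1 := pow_natAbs_recurrence hr (x - y)
  have h2 := pow_natAbs_recurrence hr x
  have e1 := dirKernel_mul x y r
  have e2 := dirKernel_mul (x + 1) y r
  have e3 := dirKernel_mul (x - 1) y r
  rw [show x + 1 - y = x - y + 1 by ring] at e2
  rw [show x - 1 - y = x - y - 1 by ring] at e3
  have e4 : r * (r⁻¹ - r) = 1 - r ^ 2 := by field_simp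
  have e5 : ((r + r⁻¹) * dirKernel x y r - dirKernel (x + 1) y r - dirKernel (x - 1) y r)
      * (1 - r ^ 2) = r * (if x - y = 0 then r⁻¹ - r else 0)
        - r * r ^ y.natAbs * (if x = 0 then r⁻¹ - r else 0) := by
    rw [← h1, ← h2]
    linear_combination (r + r⁻¹) * e1 - e2 - e3
  rw [e5]
  simp only [sub_eq_zero]
  split_ifs
  · linear_combination (1 - r ^ y.natAbs) * e4
  · linear_combination e4
  · linear_combination -r ^ y.natAbs * e4
  · ring

theorem diagKernel_zero (m n : ℂ) (y : ℤ) (r s : ℂ) :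
    diagKernel m n 0 y r s = r ^ (y.natAbs + 1) * (1 - s ^ 2 - m * s) / resDet m n r s := by
  simp [diagKernel, dirKernel_zero_left]

/-- The Dirichlet kernel solves the free equation up to a defect -r^{|y|} at the site 0, and r^{|x|}
solves it up to r⁻¹ - r there. The coefficient of r^{|x|} solves, jointly with that of s^{|x|} in
`offKernel`, the 2 × 2 matching system at 0, whose determinant is `resDet` up to the factor rs. The
step `e4` is its first equation, and `offKernel_recurrence` contains the second. -/
theorem diagKernel_recurrence {m n r s : ℂ} (hr : r ≠ 0) (hr2 : 1 - r ^ 2 ≠ 0)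
    (hD : resDet m n r s ≠ 0) (x y : ℤ) :
    (r + r⁻¹) * diagKernel m n x y r s - diagKernel m n (x + 1) y r s
      - diagKernel m n (x - 1) y r s
      - (if x = 0 then m * diagKernel m n 0 y r s + n * offKernel m n 0 y s r else 0)
      = if x = y then 1 else 0 := by
  have h1 := dirKernel_recurrence hr hr2 x y
  have h2 := pow_natAbs_recurrence hr x
  have e0 : ∀ x : ℤ, diagKernel m n x y r s = dirKernel x y r +
      r ^ x.natAbs * (r ^ (y.natAbs + 1) * (1 - s ^ 2 - m * s) / resDet m n r s) := fun x => by
    unfold diagKernel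
    rw [show x.natAbs + y.natAbs + 1 = x.natAbs + (y.natAbs + 1) by ring, pow_add]
    ring
  have e3 : r ^ y.natAbs * resDet m n r s = (r⁻¹ - r) *
      (r ^ (y.natAbs + 1) * (1 - s ^ 2 - m * s)) - (m * (r ^ (y.natAbs + 1) * (1 - s ^ 2 - m * s))
        + n * (n * s * r ^ (y.natAbs + 1))) := by
    unfold resDet
    field_simp
    ring
  have e4 : r ^ y.natAbs = (r⁻¹ - r) *
      (r ^ (y.natAbs + 1) * (1 - s ^ 2 - m * s) / resDet m n r s)
        - (m * diagKernel m n 0 y r s + n * offKernel m n 0 y s r) := by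
    rw [diagKernel_zero, offKernel, resDet_symm m n r s]
    simp only [Int.natAbs_zero, zero_add, pow_one]
    have := e3
    field_simp at this ⊢
    linear_combination this
  simp only [e0 x, e0 (x + 1), e0 (x - 1)]
  set κ := r ^ (y.natAbs + 1) * (1 - s ^ 2 - m * s) / resDet m n r s
  by_cases hx : x = 0
  · simp only [hx, if_true] at h1 h2 ⊢
    linear_combination h1 + κ * h2 - e4
  · simp only [hx, if_false] at h1 h2 ⊢
    linear_combination h1 + κ * h2

theorem offKernel_recurrence {m n r s : ℂ} (hs : s ≠ 0) (x y : ℤ) :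
    (s + s⁻¹) * offKernel m n x y s r - offKernel m n (x + 1) y s r
      - offKernel m n (x - 1) y s r
      - (if x = 0 then m * offKernel m n 0 y s r + n * diagKernel m n 0 y r s else 0) = 0 := by
  have h2 := pow_natAbs_recurrence hs x
  have e0 : ∀ x : ℤ, offKernel m n x y s r =
      s ^ x.natAbs * (n * s * r ^ (y.natAbs + 1) / resDet m n r s) := fun x => by
    rw [offKernel, resDet_symm, pow_succ]
    ring
  have e4 : (s⁻¹ - s) * (n * s * r ^ (y.natAbs + 1) / resDet m n r s)
        - (m * offKernel m n 0 y s r + n * diagKernel m n 0 y r s) = 0 := by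
    rw [diagKernel_zero, offKernel, resDet_symm m n r s]
    simp only [Int.natAbs_zero, zero_add, pow_one]
    field_simp
    ring
  simp only [e0 x, e0 (x + 1), e0 (x - 1)]
  set κ := n * s * r ^ (y.natAbs + 1) / resDet m n r s
  by_cases hx : x = 0
  · simp only [hx, if_true] at h2 ⊢
    linear_combination κ * h2 + e4
  · simp only [hx, if_false] at h2 ⊢
    linear_combination κ * h2

/-! ### Behaviour of the kernels at infinity -/

/-- Only the power r¹ survives, and it occurs exactly for x = y and j = 0. At x = y = 0 the sum is
empty; there the missing term comes from the correction in `diagKernel`. -/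
theorem tendsto_mul_dirKernel {F : Filter ℂ} {r : ℂ → ℂ} {c : ℂ} (hr : Tendsto r F (𝓝 0))
    (hlr : Tendsto (fun l => l * r l) F (𝓝 c)) (x y : ℤ) :
    Tendsto (fun l => l * dirKernel x y (r l)) F
      (𝓝 (if x = y ∧ x ≠ 0 then c else 0)) := by
  have h : Tendsto (fun l => l * dirKernel x y (r l)) F
      (𝓝 (∑ j ∈ Finset.range ((x.natAbs + y.natAbs - (x - y).natAbs) / 2),
        c * 0 ^ ((x - y).natAbs + 2 * j))) := by
    unfold dirKernel
    simp only [Finset.mul_sum]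
    refine tendsto_finsetSum _ fun j _ => ?_
    refine (hlr.mul (hr.pow ((x - y).natAbs + 2 * j))).congr fun l => ?_
    ring
  convert h using 2
  by_cases hxy : x = y
  · subst hxy
    by_cases hx : x = 0
    · simp [hx]
    · obtain ⟨k, hk⟩ : ∃ k, x.natAbs = k + 1 := ⟨x.natAbs - 1, by omega⟩
      have : (x.natAbs + x.natAbs - (x - x).natAbs) / 2 = k + 1 := by
        rw [sub_self]
        simp only [Int.natAbs_zero]
        omega
      rw [this, Finset.sum_range_succ', if_pos ⟨rfl, hx⟩]
      simp
  · rw [if_neg (fun h => hxy h.1), Finset.sum_eq_zero]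
    intro j _
    rw [zero_pow (by omega), mul_zero]

theorem tendsto_resDet {F : Filter ℂ} {m n : ℂ} {r s : ℂ → ℂ} (hr : Tendsto r F (𝓝 0))
    (hs : Tendsto s F (𝓝 0)) : Tendsto (fun l => resDet m n (r l) (s l)) F (𝓝 1) := by
  have h : Tendsto (fun l => resDet m n (r l) (s l)) F (𝓝 (resDet m n 0 0)) := by
    unfold resDet
    exact (((tendsto_const_nhds.sub (hr.pow 2)).sub (hr.const_mul m)).mul
      ((tendsto_const_nhds.sub (hs.pow 2)).sub (hs.const_mul m))).sub
      ((hr.const_mul (n ^ 2)).mul hs)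
  simpa [resDet] using h

theorem tendsto_mul_diagKernel {F : Filter ℂ} {m n c : ℂ} {r s : ℂ → ℂ} (hr : Tendsto r F (𝓝 0))
    (hs : Tendsto s F (𝓝 0)) (hlr : Tendsto (fun l => l * r l) F (𝓝 c)) (x y : ℤ) :
    Tendsto (fun l => l * diagKernel m n x y (r l) (s l)) F (𝓝 (if x = y then c else 0)) := by
  have h1 := tendsto_mul_dirKernel hr hlr x y
  have h2 := ((hlr.mul (hr.pow (x.natAbs + y.natAbs))).mul
    ((tendsto_const_nhds (x := (1 : ℂ)).sub (hs.pow 2)).sub (hs.const_mul m))).div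
    (tendsto_resDet (m := m) (n := n) hr hs) one_ne_zero
  have h3 := h1.add h2
  refine (h3.congr fun l => ?_).trans (le_of_eq ?_)
  · unfold diagKernel
    simp only [Pi.div_apply]
    ring
  · congr 1
    by_cases hxy : x = y
    · subst hxy
      by_cases hx : x = 0
      · simp [hx]
      · simp [hx]
    · have : x.natAbs + y.natAbs ≠ 0 := by omega
      rw [if_neg hxy, if_neg (fun h => hxy h.1), zero_pow this]
      simp

theorem tendsto_mul_offKernel {F : Filter ℂ} {m n c : ℂ} {r s : ℂ → ℂ} (hr : Tendsto r F (𝓝 0))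
    (hs : Tendsto s F (𝓝 0)) (hlr : Tendsto (fun l => l * r l) F (𝓝 c)) (x y : ℤ) :
    Tendsto (fun l => l * offKernel m n x y (r l) (s l)) F (𝓝 0) := by
  have h2 := (((hlr.const_mul n).mul (hr.pow x.natAbs)).mul (hs.pow (y.natAbs + 1))).div
    (tendsto_resDet (m := m) (n := n) hr hs) one_ne_zero
  refine (h2.congr fun l => ?_).trans (le_of_eq ?_)
  · unfold offKernel
    simp only [Pi.div_apply]
    ring
  · simp

/-! ### The contour formula in the angular coordinate -/

open intervalIntegral in
/-- `integral_axis_eq` for a function whose jump is supported on the interval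
`{z - 2 cos θ}`, in the coordinate `θ`. -/
theorem integral_cos_eq {h : ℂ → ℂ} {cI c0 : ℂ} (hc : ContinuousOn h puncturedHalfPlane)
    (hd : DifferentiableOn ℂ h {l | 0 < l.re})
    (hI : Tendsto (fun l => l * h l) (Bornology.cobounded ℂ ⊓ 𝓟 puncturedHalfPlane) (𝓝 cI))
    (h0 : Tendsto (fun l => l * h l) (𝓝 0 ⊓ 𝓟 puncturedHalfPlane) (𝓝 c0))
    {z : ℝ} (hz : 2 < |z|)
    (hj : ∀ τ : ℝ, 2 < |z - τ| → 2 < |z + τ| → h (Complex.I * τ) + h (-(Complex.I * τ)) = 0) :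
    ∫ θ in (0 : ℝ)..Real.pi, ((2 * Real.sin θ : ℝ) : ℂ) *
      (h (Complex.I * ((z - 2 * Real.cos θ : ℝ) : ℂ)) +
        h (-(Complex.I * ((z - 2 * Real.cos θ : ℝ) : ℂ)))) = Real.pi * (cI - c0) := by
  rw [← integral_axis_eq hc hd hI h0 (a := |z| - 2) (b := |z| + 2) (by linarith) (by linarith)]
  · set J : ℝ → ℂ := fun τ => h (Complex.I * τ) + h (-(Complex.I * τ)) with hJ
    have hJc : ContinuousOn J {τ | τ ≠ 0} := by
      refine ContinuousOn.add (hc.comp (by fun_prop) fun τ hτ => ?_)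
        (hc.comp (by fun_prop) fun τ hτ => ?_)
      · exact ⟨by simp, by simpa using (hτ : τ ≠ 0)⟩
      · exact ⟨by simp, by simpa using (hτ : τ ≠ 0)⟩
    rcases lt_abs.1 hz with hz0 | hz0
    · rw [abs_of_pos (by linarith)]
      have hs := integral_deriv_smul_comp' (a := 0) (b := Real.pi)
        (f := fun θ => z - 2 * Real.cos θ) (f' := fun θ => 2 * Real.sin θ) (g := J)
        (fun θ _ => by
          have := ((Real.hasDerivAt_cos θ).const_mul 2).const_sub z
          exact this.congr_deriv (by ring)) (by fun_prop)
        (hJc.mono (by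
          rintro _ ⟨θ, -, rfl⟩
          have := Real.cos_le_one θ
          exact ne_of_gt (by linarith)))
      simp only [Real.cos_zero, Real.cos_pi, mul_one, mul_neg, sub_neg_eq_add] at hs
      rw [← hs]
      refine integral_congr fun θ _ => ?_
      simp only [hJ, Function.comp_apply, Complex.real_smul]
    -- For z < 0 the positive variable is τ = -(z - 2 cos θ). As `J` is even, this leaves the
    -- integrand unchanged.
    · rw [abs_of_neg (by linarith)]
      have hs := integral_deriv_smul_comp' (a := 0) (b := Real.pi)
        (f := fun θ => -z + 2 * Real.cos θ) (f' := fun θ => -(2 * Real.sin θ)) (g := J)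
        (fun θ _ => by
          have := ((Real.hasDerivAt_cos θ).const_mul 2).const_add (-z)
          exact this.congr_deriv (by ring)) (by fun_prop)
        (hJc.mono (by
          rintro _ ⟨θ, -, rfl⟩
          have := Real.neg_one_le_cos θ
          exact ne_of_gt (by linarith)))
      simp only [Real.cos_zero, Real.cos_pi, mul_one, mul_neg, ← sub_eq_add_neg] at hs
      rw [integral_symm (-z - 2) (-z + 2)] at hs
      rw [← neg_eq_iff_eq_neg.2 hs, ← intervalIntegral.integral_neg]
      refine integral_congr fun θ _ => ?_
      simp only [hJ, Function.comp_apply, Complex.real_smul, neg_smul, neg_neg]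
      have e : Complex.I * ((-z + 2 * Real.cos θ : ℝ) : ℂ)
          = -(Complex.I * ((z - 2 * Real.cos θ : ℝ) : ℂ)) := by
        push_cast; ring
      rw [e, neg_neg, add_comm]
  · intro τ hτ hm
    have key : |z| - τ < -2 ∨ 2 < |z| - τ := by
      by_contra hcon
      push Not at hcon
      exact hm ⟨by linarith, by linarith⟩
    refine hj τ ?_ ?_
    · rcases abs_cases z with ⟨e, h'⟩ | ⟨e, h'⟩ <;> rw [e] at key hz
      · rcases key with k | k
        · exact lt_abs.2 (Or.inr (by linarith))
        · exact lt_abs.2 (Or.inl (by linarith))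
      · exact lt_abs.2 (Or.inr (by linarith))
    · rcases abs_cases z with ⟨e, h'⟩ | ⟨e, h'⟩ <;> rw [e] at key hz
      · exact lt_abs.2 (Or.inl (by linarith))
      · rcases key with k | k
        · exact lt_abs.2 (Or.inl (by linarith))
        · exact lt_abs.2 (Or.inr (by linarith))

/-! ### The exponents of the resolvent as functions of the spectral parameter -/

/-- The root of `r + r⁻¹ = z + i l` in the unit disc, for `0 ≤ re l`. -/
def resPlus (z : ℝ) (l : ℂ) : ℂ := joukInv (z + Complex.I * l)

/-- The root of `s + s⁻¹ = z - i l` in the unit disc, for `0 ≤ re l`. -/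
def resMinus (z : ℝ) (l : ℂ) : ℂ := -joukInv (-z + Complex.I * l)

theorem resPlus_add_inv (z : ℝ) (l : ℂ) :
    resPlus z l + (resPlus z l)⁻¹ = z + Complex.I * l := joukInv_add_inv _

theorem resMinus_add_inv (z : ℝ) (l : ℂ) :
    resMinus z l + (resMinus z l)⁻¹ = z - Complex.I * l := by
  have h := joukInv_add_inv (-z + Complex.I * l)
  unfold resMinus
  rw [inv_neg]
  linear_combination -h

theorem joukInv_eq {r : ℂ} (hr : r ≠ 0) (h1 : ‖r‖ < 1) {ζ : ℂ} (hζ : 0 ≤ ζ.im)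
    (h : r + r⁻¹ = ζ) : joukInv ζ = r :=
  (joukowski_unique hr (joukInv_ne_zero ζ) (by rw [h, joukInv_add_inv]) h1
    (norm_joukInv_le hζ)).symm

theorem neg_joukInv_neg {x : ℝ} (hx : 2 < |x|) : -joukInv ((-x : ℝ) : ℂ) = joukInv x := by
  refine (joukInv_eq (neg_ne_zero.2 (joukInv_ne_zero _)) ?_ (by simp) ?_).symm
  · rw [norm_neg]
    exact joukInv_real_norm_lt (by rwa [abs_neg])
  · have := joukInv_add_inv ((-x : ℝ) : ℂ)
    push_cast at this ⊢
    rw [inv_neg]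
    linear_combination -this

theorem resPlus_I_mul (z τ : ℝ) : resPlus z (Complex.I * τ) = joukInv ((z - τ : ℝ) : ℂ) := by
  unfold resPlus
  congr 1
  push_cast
  linear_combination (τ : ℂ) * Complex.I_mul_I

theorem resPlus_neg_I_mul (z τ : ℝ) :
    resPlus z (-(Complex.I * τ)) = joukInv ((z + τ : ℝ) : ℂ) := by
  unfold resPlus
  congr 1
  push_cast
  linear_combination (-τ : ℂ) * Complex.I_mul_I

theorem resMinus_I_mul (z τ : ℝ) :
    resMinus z (Complex.I * τ) = -joukInv ((-(z + τ) : ℝ) : ℂ) := by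
  unfold resMinus
  congr 2
  push_cast
  linear_combination (τ : ℂ) * Complex.I_mul_I

theorem resMinus_neg_I_mul (z τ : ℝ) :
    resMinus z (-(Complex.I * τ)) = -joukInv ((-(z - τ) : ℝ) : ℂ) := by
  unfold resMinus
  congr 2
  push_cast
  linear_combination (-τ : ℂ) * Complex.I_mul_I

theorem continuousOn_resPlus (z : ℝ) : ContinuousOn (resPlus z) {l | 0 ≤ l.re} := fun l hl =>
  (ContinuousAt.comp (f := fun l : ℂ => (z : ℂ) + Complex.I * l)
    (continuousAt_joukInv (by simpa using hl)) (by fun_prop)).continuousWithinAt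

theorem continuousOn_resMinus (z : ℝ) : ContinuousOn (resMinus z) {l | 0 ≤ l.re} := fun l hl =>
  (ContinuousAt.comp (f := fun l : ℂ => -(z : ℂ) + Complex.I * l)
    (continuousAt_joukInv (by simpa using hl)) (by fun_prop)).neg.continuousWithinAt

theorem differentiableOn_resPlus (z : ℝ) : DifferentiableOn ℂ (resPlus z) {l | 0 < l.re} :=
  fun l hl => (DifferentiableAt.comp (f := fun l : ℂ => (z : ℂ) + Complex.I * l) l
    (differentiableAt_joukInv (by simpa using hl)) (by fun_prop)).differentiableWithinAt

theorem differentiableOn_resMinus (z : ℝ) : DifferentiableOn ℂ (resMinus z) {l | 0 < l.re} :=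
  fun l hl => (DifferentiableAt.comp (f := fun l : ℂ => -(z : ℂ) + Complex.I * l) l
    (differentiableAt_joukInv (by simpa using hl)) (by fun_prop)).neg.differentiableWithinAt

/-- From 1/r = c + il - r and |r| ≤ 1 it follows that 1/(l r) tends to i. -/
theorem tendsto_mul_joukInv (c : ℝ) :
    Tendsto (fun l => l * joukInv (c + Complex.I * l))
      (Bornology.cobounded ℂ ⊓ 𝓟 puncturedHalfPlane) (𝓝 (-Complex.I)) := by
  have hinv : Tendsto (fun l : ℂ => l⁻¹) (Bornology.cobounded ℂ ⊓ 𝓟 puncturedHalfPlane) (𝓝 0) :=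
    tendsto_inv₀_cobounded.mono_left inf_le_left
  have h1 : Tendsto (fun l : ℂ => (c - joukInv (c + Complex.I * l)) * l⁻¹)
      (Bornology.cobounded ℂ ⊓ 𝓟 puncturedHalfPlane) (𝓝 0) := by
    refine squeeze_zero_norm' (a := fun l : ℂ => (|c| + 1) * ‖l⁻¹‖) ?_ ?_
    · filter_upwards [mem_inf_of_right (mem_principal_self _)] with l hl
      rw [norm_mul]
      gcongr
      refine (norm_sub_le _ _).trans ?_
      gcongr
      · simp
      · exact norm_joukInv_le (by simpa using hl.1)
    · simpa using hinv.norm.const_mul (|c| + 1)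
  have h2 := (h1.add_const Complex.I).inv₀ (by simp)
  simp only [zero_add, Complex.inv_I] at h2
  refine h2.congr' ?_
  filter_upwards [mem_inf_of_right (mem_principal_self _)] with l hl
  have e := joukInv_add_inv (c + Complex.I * l)
  have hne := joukInv_ne_zero (c + Complex.I * l)
  have hl0 := hl.2
  rw [← inv_inv (l * joukInv (c + Complex.I * l)), mul_inv]
  congr 1
  rw [show (joukInv (c + Complex.I * l))⁻¹ = c + Complex.I * l - joukInv (c + Complex.I * l) by
    linear_combination e]
  field_simp
  ring

theorem tendsto_joukInv_cobounded (c : ℝ) :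
    Tendsto (fun l => joukInv (c + Complex.I * l))
      (Bornology.cobounded ℂ ⊓ 𝓟 puncturedHalfPlane) (𝓝 0) := by
  have hinv : Tendsto (fun l : ℂ => l⁻¹) (Bornology.cobounded ℂ ⊓ 𝓟 puncturedHalfPlane) (𝓝 0) :=
    tendsto_inv₀_cobounded.mono_left inf_le_left
  have h := (tendsto_mul_joukInv c).mul hinv
  rw [mul_zero] at h
  refine h.congr' ?_
  filter_upwards [mem_inf_of_right (mem_principal_self _)] with l hl
  have := hl.2
  field_simp

/-! ### Expansion of roots, determinant and kernels at l = 0 -/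

section NearZero

variable {r0 : ℝ}

theorem two_lt_abs_add_inv (h0 : r0 ≠ 0) (h1 : |r0| < 1) : 2 < |r0 + r0⁻¹| := by
  have hp : 0 < |r0| := abs_pos.2 h0
  have e : |r0 + r0⁻¹| = |r0| + |r0|⁻¹ := by
    rcases lt_or_gt_of_ne h0 with h | h
    · rw [abs_of_neg h, abs_of_neg (by have := inv_lt_zero.2 h; linarith), inv_neg]
      ring
    · rw [abs_of_pos h, abs_of_pos (by positivity)]
  rw [e]
  have : 0 < (1 - |r0|) ^ 2 / |r0| := div_pos (by nlinarith) hp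
  have e2 : |r0| + |r0|⁻¹ = 2 + (1 - |r0|) ^ 2 / |r0| := by
    field_simp
    ring
  linarith

theorem joukInv_base (h0 : r0 ≠ 0) (h1 : |r0| < 1) :
    joukInv ((r0 + r0⁻¹ : ℝ) : ℂ) = r0 :=
  joukInv_eq (by exact_mod_cast h0) (by simpa using h1) (by simp only [Complex.ofReal_im, le_refl])
    (by push_cast; rfl)

theorem resPlus_zero (h0 : r0 ≠ 0) (h1 : |r0| < 1) : resPlus (r0 + r0⁻¹) 0 = r0 := by
  unfold resPlus
  rw [mul_zero, add_zero, joukInv_base h0 h1]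

theorem resMinus_zero (h0 : r0 ≠ 0) (h1 : |r0| < 1) : resMinus (r0 + r0⁻¹) 0 = r0 := by
  unfold resMinus
  rw [mul_zero, add_zero, ← Complex.ofReal_neg, neg_joukInv_neg (two_lt_abs_add_inv h0 h1),
    joukInv_base h0 h1]

/-- Subtracting the equations at l and at 0 gives the slope exactly, as κR/(R - 1/r0), so continuity
of R up to the boundary is enough to pass to the limit. -/
theorem hasDerivWithinAt_of_add_inv {R : ℂ → ℂ} {κ : ℂ} (h0 : r0 ≠ 0) (h1 : |r0| < 1)
    (hc : ContinuousOn R {l | 0 ≤ l.re}) (hR0 : R 0 = r0) (hne : ∀ l, R l ≠ 0)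
    (hR : ∀ l, R l + (R l)⁻¹ = (r0 + r0⁻¹ : ℝ) + κ * l) :
    HasDerivWithinAt R (-κ * r0 / (r0⁻¹ - r0)) puncturedHalfPlane 0 := by
  have hr : (r0 : ℂ) ≠ 0 := by exact_mod_cast h0
  have ha : (r0 : ℂ)⁻¹ - r0 ≠ 0 := by
    have : r0⁻¹ - r0 ≠ 0 := by
      intro h
      have h2 : r0 * r0 = 1 := by
        field_simp at h
        linarith
      nlinarith [abs_mul_abs_self r0, abs_nonneg r0]
    exact_mod_cast this
  rw [hasDerivWithinAt_iff_tendsto_slope' (fun h => h.2 rfl), Complex.ofReal_inv]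
  have hT : Tendsto R (𝓝[puncturedHalfPlane] 0) (𝓝 r0) := by
    rw [← hR0]
    exact (hc 0 (by simp)).mono (fun l hl => hl.1)
  have h2 := (hT.const_mul κ).div (hT.sub_const ((r0 : ℂ)⁻¹))
    (by rw [← neg_sub]; exact neg_ne_zero.2 ha)
  have e : κ * (r0 : ℂ) / (r0 - (r0 : ℂ)⁻¹) = -κ * r0 / ((r0 : ℂ)⁻¹ - r0) := by
    rw [← neg_sub, div_neg, neg_mul, neg_div]
  rw [e] at h2
  refine h2.congr' ?_
  have hev : ∀ᶠ l in 𝓝[puncturedHalfPlane] 0, R l - (r0 : ℂ)⁻¹ ≠ 0 :=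
    (hT.sub_const ((r0 : ℂ)⁻¹)).eventually_ne (by rw [← neg_sub]; exact neg_ne_zero.2 ha)
  filter_upwards [hev, self_mem_nhdsWithin] with l h3 h4
  have hl := h4.2
  have h5 := hR l
  have h6 := hne l
  rw [Pi.div_apply, slope_def_field, hR0, sub_zero]
  push_cast at h5
  rw [div_eq_div_iff h3 hl]
  linear_combination -(R l) * h5 + mul_inv_cancel₀ h6 - mul_inv_cancel₀ hr

theorem hasDerivWithinAt_resPlus (h0 : r0 ≠ 0) (h1 : |r0| < 1) :
    HasDerivWithinAt (resPlus (r0 + r0⁻¹)) (-Complex.I * r0 / (r0⁻¹ - r0)) puncturedHalfPlane 0 :=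
  hasDerivWithinAt_of_add_inv h0 h1 (continuousOn_resPlus _) (resPlus_zero h0 h1)
    (fun _ => joukInv_ne_zero _) (resPlus_add_inv _)

theorem hasDerivWithinAt_resMinus (h0 : r0 ≠ 0) (h1 : |r0| < 1) :
    HasDerivWithinAt (resMinus (r0 + r0⁻¹)) (Complex.I * r0 / (r0⁻¹ - r0)) puncturedHalfPlane 0 := by
  have := hasDerivWithinAt_of_add_inv (κ := -Complex.I) h0 h1 (continuousOn_resMinus _)
    (resMinus_zero h0 h1) (fun _ => neg_ne_zero.2 (joukInv_ne_zero _))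
    (fun l => by rw [resMinus_add_inv]; ring)
  simpa using this

end NearZero

/-- With p = r⁻¹ - r and q = s⁻¹ - s, the determinant over rs is (p + q - 2a)(p + q - 2n)/2 - w².
Rationalising p + q - 2a twice, by p + q + 2a and by pq + a², extracts a factor w². This makes the
second-order zero at w = 0 explicit and leaves a quotient with a visible limit. -/
theorem resDet_eq_of_add_inv {r s z w a n : ℂ} (hr : r ≠ 0) (hs : s ≠ 0) (hrz : r + r⁻¹ = z + w)
    (hsz : s + s⁻¹ = z - w) (ha : a ^ 2 = z ^ 2 - 4) (hw : w ≠ 0)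
    (h1 : (r⁻¹ - r) + (s⁻¹ - s) + 2 * a ≠ 0) (h2 : (r⁻¹ - r) * (s⁻¹ - s) + a ^ 2 ≠ 0) :
    resDet (a + n) n r s / (r * s * w ^ 2) = ((r⁻¹ - r) + (s⁻¹ - s) - 2 * n) / 2 *
      (2 * ((r⁻¹ - r) * (s⁻¹ - s) + a ^ 2) + 2 * (2 * a ^ 2 - 4 * z ^ 2 + w ^ 2)) /
        (((r⁻¹ - r) + (s⁻¹ - s) + 2 * a) * ((r⁻¹ - r) * (s⁻¹ - s) + a ^ 2)) - 1 := by
  have hp : (r⁻¹ - r) ^ 2 = (z + w) ^ 2 - 4 := by rw [← hrz]; field_simp; ring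
  have hq : (s⁻¹ - s) ^ 2 = (z - w) ^ 2 - 4 := by rw [← hsz]; field_simp; ring
  have hD : resDet (a + n) n r s
      = r * s * (((r⁻¹ - r) - (a + n)) * ((s⁻¹ - s) - (a + n)) - n ^ 2) := by
    unfold resDet; field_simp
  rw [hD]
  set p := r⁻¹ - r
  set q := s⁻¹ - s
  have e1 : (p - (a + n)) * (q - (a + n)) - n ^ 2
      = (p + q - 2 * a) * (p + q - 2 * n) / 2 - w ^ 2 := by
    linear_combination (-1 / 2 : ℂ) * hp - (1 / 2 : ℂ) * hq + ha
  have e2 : (p + q - 2 * a) * (p + q + 2 * a) * (p * q + a ^ 2)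
      = w ^ 2 * (2 * (p * q + a ^ 2) + 2 * (2 * a ^ 2 - 4 * z ^ 2 + w ^ 2)) := by
    have e3 : (p * q) ^ 2 = ((z + w) ^ 2 - 4) * ((z - w) ^ 2 - 4) := by
      rw [mul_pow, hp, hq]
    have e4 : (p * q - a ^ 2) * (p * q + a ^ 2) = w ^ 2 * (2 * a ^ 2 - 4 * z ^ 2 + w ^ 2) := by
      linear_combination e3 - (a ^ 2 + z ^ 2 - 4) * ha - 2 * w ^ 2 * ha
    linear_combination (p * q + a ^ 2) * (hp + hq - 2 * ha) + 2 * e4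
  have e5 : p + q - 2 * a = w ^ 2 * (2 * (p * q + a ^ 2) + 2 * (2 * a ^ 2 - 4 * z ^ 2 + w ^ 2)) /
      ((p + q + 2 * a) * (p * q + a ^ 2)) := by
    rw [eq_div_iff (mul_ne_zero h1 h2)]
    linear_combination e2
  rw [e1, e5]
  field_simp

section NearZero

variable {r0 : ℝ}

theorem tendsto_resPlus_zero (h0 : r0 ≠ 0) (h1 : |r0| < 1) :
    Tendsto (resPlus (r0 + r0⁻¹)) (𝓝[puncturedHalfPlane] 0) (𝓝 r0) := by
  have := (hasDerivWithinAt_resPlus h0 h1).continuousWithinAt.tendsto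
  rwa [resPlus_zero h0 h1] at this

theorem tendsto_resMinus_zero (h0 : r0 ≠ 0) (h1 : |r0| < 1) :
    Tendsto (resMinus (r0 + r0⁻¹)) (𝓝[puncturedHalfPlane] 0) (𝓝 r0) := by
  have := (hasDerivWithinAt_resMinus h0 h1).continuousWithinAt.tendsto
  rwa [resMinus_zero h0 h1] at this

theorem inv_sub_ne_zero (h0 : r0 ≠ 0) (h1 : |r0| < 1) : r0⁻¹ - r0 ≠ 0 := by
  intro h
  have h2 : r0 * r0 = 1 := by
    field_simp at h
    linarith
  nlinarith [abs_mul_abs_self r0, abs_nonneg r0]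

/-- The leading coefficient of the determinant at `0`. -/
def detCoeff (r0 n : ℝ) : ℝ :=
  (4 * n - (r0⁻¹ - r0) * (r0 + r0⁻¹) ^ 2) / (r0⁻¹ - r0) ^ 3

theorem tendsto_resDet_zero (h0 : r0 ≠ 0) (h1 : |r0| < 1) (n : ℝ) :
    Tendsto (fun l => resDet (((r0⁻¹ - r0 : ℝ) : ℂ) + n) n (resPlus (r0 + r0⁻¹) l)
      (resMinus (r0 + r0⁻¹) l) / (resPlus (r0 + r0⁻¹) l * resMinus (r0 + r0⁻¹) l * l ^ 2))
      (𝓝[puncturedHalfPlane] 0) (𝓝 (-detCoeff r0 n)) := by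
  have hr : (r0 : ℂ) ≠ 0 := by exact_mod_cast h0
  have ha0 := inv_sub_ne_zero h0 h1
  have haC : (((r0⁻¹ - r0 : ℝ)) : ℂ) ≠ 0 := by exact_mod_cast ha0
  have tr := tendsto_resPlus_zero h0 h1
  have ts := tendsto_resMinus_zero h0 h1
  set z : ℝ := r0 + r0⁻¹ with hz
  set a : ℝ := r0⁻¹ - r0 with ha
  have haz : (a : ℂ) ^ 2 = (z : ℂ) ^ 2 - 4 := by
    rw [hz, ha]
    push_cast
    field_simp
    ring
  have tp : Tendsto (fun l => (resPlus z l)⁻¹ - resPlus z l) (𝓝[puncturedHalfPlane] 0) (𝓝 a) := by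
    have := (tr.inv₀ hr).sub tr
    rw [ha]; push_cast; exact this
  have tq : Tendsto (fun l => (resMinus z l)⁻¹ - resMinus z l) (𝓝[puncturedHalfPlane] 0)
      (𝓝 a) := by
    have := (ts.inv₀ hr).sub ts
    rw [ha]; push_cast; exact this
  have tw : Tendsto (fun l => (Complex.I * l)) (𝓝[puncturedHalfPlane] 0) (𝓝 0) := by
    have : Tendsto (fun l => (Complex.I * l)) (𝓝 0) (𝓝 (Complex.I * 0)) :=
      (continuous_const.mul continuous_id).tendsto 0
    rw [mul_zero] at this
    exact this.mono_left inf_le_left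
  have t1 := (tp.add tq).add_const (2 * (a : ℂ))
  have t2 := (tp.mul tq).add_const ((a : ℂ) ^ 2)
  have n1 : (a : ℂ) + a + 2 * a ≠ 0 := by
    rw [show (a : ℂ) + a + 2 * a = 4 * a by ring]
    exact mul_ne_zero (by norm_num) haC
  have n2 : (a : ℂ) * a + a ^ 2 ≠ 0 := by
    rw [show (a : ℂ) * a + a ^ 2 = 2 * a ^ 2 by ring]
    exact mul_ne_zero (by norm_num) (pow_ne_zero _ haC)
  have t3 := ((((((tp.add tq).sub_const (2 * (n : ℂ))).div_const 2).mul ((t2.const_mul 2).add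
    (((tw.pow 2).const_add (2 * (a : ℂ) ^ 2 - 4 * (z : ℂ) ^ 2)).const_mul 2))).div (t1.mul t2)
      (mul_ne_zero n1 n2)).sub_const 1).neg
  refine (t3.congr' ?_).trans (le_of_eq ?_)
  · filter_upwards [t1.eventually_ne n1, t2.eventually_ne n2, self_mem_nhdsWithin] with l e1 e2 hl
    have hl0 := hl.2
    have hw : Complex.I * l ≠ 0 := mul_ne_zero Complex.I_ne_zero hl0
    have hres := resDet_eq_of_add_inv (n := n) (joukInv_ne_zero _)
      (neg_ne_zero.2 (joukInv_ne_zero _))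
      (resPlus_add_inv z l) (resMinus_add_inv z l) haz hw e1 e2
    have hI : (Complex.I * l) ^ 2 = -l ^ 2 := by rw [mul_pow, Complex.I_sq]; ring
    rw [← neg_neg (l ^ 2), ← hI, mul_neg, div_neg, neg_inj]
    rw [Pi.div_apply]
    exact hres.symm
  · congr 1
    unfold detCoeff
    rw [← hz, ← ha]
    push_cast
    rw [neg_inj, show (z : ℂ) ^ 2 = a ^ 2 + 4 by linear_combination -haz]
    field_simp
    ring

theorem tendsto_mul_sub_of_hasDerivWithinAt {f g : ℂ → ℂ} {f' c : ℂ}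
    (hf : HasDerivWithinAt f f' puncturedHalfPlane 0) (hf0 : f 0 = 0)
    (hg : Tendsto (fun l => g l) (𝓝[puncturedHalfPlane] 0) (𝓝 c)) :
    Tendsto (fun l => f l / l * g l) (𝓝[puncturedHalfPlane] 0) (𝓝 (f' * c)) := by
  rw [hasDerivWithinAt_iff_tendsto_slope' (fun h => h.2 rfl)] at hf
  refine (hf.mul hg).congr fun l => ?_
  rw [slope_def_field, hf0, sub_zero, sub_zero]

theorem hasDerivWithinAt_pow_base {R : ℂ → ℂ} {κ a : ℂ} (hR0 : R 0 = r0)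
    (hd : HasDerivWithinAt R (κ * r0 / a) puncturedHalfPlane 0) (k : ℕ) :
    HasDerivWithinAt (fun l => R l ^ k) (k * r0 ^ k * κ / a) puncturedHalfPlane 0 := by
  refine (hd.pow k).congr_deriv ?_
  rw [hR0]
  rcases k with _ | k
  · simp
  · rw [Nat.add_sub_cancel, pow_succ]
    ring

theorem hasDerivWithinAt_inv_sub_base (h0 : r0 ≠ 0) {R : ℂ → ℂ} {κ a : ℂ} (hR0 : R 0 = r0)
    (hd : HasDerivWithinAt R (κ * r0 / a) puncturedHalfPlane 0) :
    HasDerivWithinAt (fun l => (R l)⁻¹ - R l) (-κ * (r0 + (r0 : ℂ)⁻¹) / a)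
      puncturedHalfPlane 0 := by
  have hr : (r0 : ℂ) ≠ 0 := by exact_mod_cast h0
  refine ((hd.inv (by rwa [hR0])).sub hd).congr_deriv ?_
  rw [hR0]
  field_simp
  ring

/-- Dividing by a determinant of order l² suggests a double pole. However, both roots equal r0 at l
= 0, so the numerator of the antisymmetrised kernel vanishes there and only a simple pole remains.
Its coefficient is the derivative of the numerator over the leading coefficient of the determinant.
-/
theorem tendsto_mul_diagKernel_zero (h0 : r0 ≠ 0) (h1 : |r0| < 1) {n : ℝ}
    (hE : detCoeff r0 n ≠ 0) (x y : ℤ) :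
    Tendsto (fun l => l * (diagKernel (((r0⁻¹ - r0 : ℝ) : ℂ) + n) n x y
        (resPlus (r0 + r0⁻¹) l) (resMinus (r0 + r0⁻¹) l) -
      diagKernel (((r0⁻¹ - r0 : ℝ) : ℂ) + n) n x y (resMinus (r0 + r0⁻¹) l)
        (resPlus (r0 + r0⁻¹) l))) (𝓝[puncturedHalfPlane] 0)
      (𝓝 (-(2 * Complex.I) * ((r0 ^ (x.natAbs + y.natAbs) *
        (n * (x.natAbs + y.natAbs) - (r0 + r0⁻¹)) / ((r0⁻¹ - r0) * detCoeff r0 n) : ℝ) : ℂ))) := by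
  have hr : (r0 : ℂ) ≠ 0 := by exact_mod_cast h0
  have ha0 := inv_sub_ne_zero h0 h1
  have haC : (((r0⁻¹ - r0 : ℝ)) : ℂ) ≠ 0 := by exact_mod_cast ha0
  have tr := tendsto_resPlus_zero h0 h1
  have ts := tendsto_resMinus_zero h0 h1
  have dr := hasDerivWithinAt_resPlus h0 h1
  have ds := hasDerivWithinAt_resMinus h0 h1
  have r00 := resPlus_zero h0 h1
  have s00 := resMinus_zero h0 h1
  have tD := (tendsto_resDet_zero h0 h1 n).inv₀ (neg_ne_zero.2 (by exact_mod_cast hE))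
  have hrne : ∀ l, resPlus (r0 + r0⁻¹) l ≠ 0 := fun _ => joukInv_ne_zero _
  have hsne : ∀ l, resMinus (r0 + r0⁻¹) l ≠ 0 := fun _ => neg_ne_zero.2 (joukInv_ne_zero _)
  set R := resPlus (r0 + r0⁻¹)
  set T := resMinus (r0 + r0⁻¹)
  set z : ℝ := r0 + r0⁻¹ with hz
  set a : ℝ := r0⁻¹ - r0 with ha
  set N := x.natAbs + y.natAbs with hN
  have dr' : HasDerivWithinAt R (-Complex.I * r0 / (a : ℂ)) puncturedHalfPlane 0 := by
    rw [ha]; push_cast; exact_mod_cast dr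
  have ds' : HasDerivWithinAt T (Complex.I * r0 / (a : ℂ)) puncturedHalfPlane 0 := by
    rw [ha]; push_cast; exact_mod_cast ds
  have dK : HasDerivWithinAt (fun l => R l ^ N * ((T l)⁻¹ - T l - ((a : ℂ) + n))
      - T l ^ N * ((R l)⁻¹ - R l - ((a : ℂ) + n))) _ puncturedHalfPlane 0 :=
    ((hasDerivWithinAt_pow_base r00 dr' N).mul
      ((hasDerivWithinAt_inv_sub_base h0 s00 ds').sub_const ((a : ℂ) + n))).sub
    ((hasDerivWithinAt_pow_base s00 ds' N).mul
      ((hasDerivWithinAt_inv_sub_base h0 r00 dr').sub_const ((a : ℂ) + n)))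
  have t1 := tendsto_mul_sub_of_hasDerivWithinAt dK (by simp [r00, s00]) tD
  have tl : Tendsto (fun l : ℂ => l) (𝓝[puncturedHalfPlane] 0) (𝓝 0) := inf_le_left
  have tdir : ∀ f : ℂ → ℂ, Tendsto f (𝓝[puncturedHalfPlane] 0) (𝓝 r0) →
      Tendsto (fun l => dirKernel x y (f l)) (𝓝[puncturedHalfPlane] 0) (𝓝 (dirKernel x y r0)) := by
    intro f hf
    unfold dirKernel
    exact tendsto_finsetSum _ fun j _ => hf.pow _
  have t2 := (tl.mul ((tdir R tr).sub (tdir T ts))).add t1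
  refine (t2.congr' ?_).trans (le_of_eq ?_)
  · filter_upwards [self_mem_nhdsWithin] with l hl
    have hl0 := hl.2
    have hR := hrne l
    have hT := hsne l
    have e1 : R l ^ N * ((T l)⁻¹ - T l - ((a : ℂ) + n)) / l *
        (resDet ((a : ℂ) + n) n (R l) (T l) / (R l * T l * l ^ 2))⁻¹ =
        l * (R l ^ (N + 1) * (1 - T l ^ 2 - ((a : ℂ) + n) * T l) /
          resDet ((a : ℂ) + n) n (R l) (T l)) := by
      rw [inv_div, pow_succ]
      field_simp
      ring
    have e2 : T l ^ N * ((R l)⁻¹ - R l - ((a : ℂ) + n)) / l *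
        (resDet ((a : ℂ) + n) n (R l) (T l) / (R l * T l * l ^ 2))⁻¹ =
        l * (T l ^ (N + 1) * (1 - R l ^ 2 - ((a : ℂ) + n) * R l) /
          resDet ((a : ℂ) + n) n (T l) (R l)) := by
      rw [inv_div, pow_succ, resDet_symm _ _ (R l) (T l)]
      field_simp
      ring
    unfold diagKernel
    rw [sub_div, sub_mul, e1, e2]
    ring
  · congr 1
    have hEC : (detCoeff r0 n : ℂ) ≠ 0 := by exact_mod_cast hE
    have haC' : (r0 : ℂ)⁻¹ - r0 = a := by rw [ha]; push_cast; rfl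
    have hzC : (r0 : ℂ) + (r0 : ℂ)⁻¹ = z := by rw [hz]; push_cast; rfl
    simp only [r00, s00, haC', hzC]
    push_cast
    rw [show (x.natAbs : ℂ) + (y.natAbs : ℂ) = (N : ℂ) by rw [hN]; push_cast; rfl, zero_mul,
      zero_add]
    field_simp
    ring

theorem tendsto_mul_offKernel_zero (h0 : r0 ≠ 0) (h1 : |r0| < 1) {n : ℝ}
    (hE : detCoeff r0 n ≠ 0) (x y : ℤ) :
    Tendsto (fun l => l * (offKernel (((r0⁻¹ - r0 : ℝ) : ℂ) + n) n x y
        (resPlus (r0 + r0⁻¹) l) (resMinus (r0 + r0⁻¹) l) -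
      offKernel (((r0⁻¹ - r0 : ℝ) : ℂ) + n) n x y (resMinus (r0 + r0⁻¹) l)
        (resPlus (r0 + r0⁻¹) l))) (𝓝[puncturedHalfPlane] 0)
      (𝓝 (-(2 * Complex.I) * ((r0 ^ (x.natAbs + y.natAbs) *
        (n * (y.natAbs - x.natAbs)) / ((r0⁻¹ - r0) * detCoeff r0 n) : ℝ) : ℂ))) := by
  have hr : (r0 : ℂ) ≠ 0 := by exact_mod_cast h0
  have ha0 := inv_sub_ne_zero h0 h1
  have haC : (((r0⁻¹ - r0 : ℝ)) : ℂ) ≠ 0 := by exact_mod_cast ha0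
  have dr := hasDerivWithinAt_resPlus h0 h1
  have ds := hasDerivWithinAt_resMinus h0 h1
  have r00 := resPlus_zero h0 h1
  have s00 := resMinus_zero h0 h1
  have tD := (tendsto_resDet_zero h0 h1 n).inv₀ (neg_ne_zero.2 (by exact_mod_cast hE))
  have hrne : ∀ l, resPlus (r0 + r0⁻¹) l ≠ 0 := fun _ => joukInv_ne_zero _
  have hsne : ∀ l, resMinus (r0 + r0⁻¹) l ≠ 0 := fun _ => neg_ne_zero.2 (joukInv_ne_zero _)
  set R := resPlus (r0 + r0⁻¹)
  set T := resMinus (r0 + r0⁻¹)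
  set a : ℝ := r0⁻¹ - r0 with ha
  set X := x.natAbs with hX
  set Y := y.natAbs with hY
  have dr' : HasDerivWithinAt R (-Complex.I * r0 / (a : ℂ)) puncturedHalfPlane 0 := by
    rw [ha]; push_cast; exact_mod_cast dr
  have ds' : HasDerivWithinAt T (Complex.I * r0 / (a : ℂ)) puncturedHalfPlane 0 := by
    rw [ha]; push_cast; exact_mod_cast ds
  have dK : HasDerivWithinAt (fun l => R l ^ X * T l ^ Y - T l ^ X * R l ^ Y) _
      puncturedHalfPlane 0 :=
    ((hasDerivWithinAt_pow_base r00 dr' X).mul (hasDerivWithinAt_pow_base s00 ds' Y)).sub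
    ((hasDerivWithinAt_pow_base s00 ds' X).mul (hasDerivWithinAt_pow_base r00 dr' Y))
  have t1 := (tendsto_mul_sub_of_hasDerivWithinAt dK (by simp [r00, s00]) tD).const_mul (n : ℂ)
  refine (t1.congr' ?_).trans (le_of_eq ?_)
  · filter_upwards [self_mem_nhdsWithin] with l hl
    have hl0 := hl.2
    have hR := hrne l
    have hT := hsne l
    unfold offKernel
    rw [resDet_symm _ _ (R l) (T l), inv_div, ← hX, ← hY]
    simp only [pow_succ]
    field_simp
  · congr 1
    have hEC : (detCoeff r0 n : ℂ) ≠ 0 := by exact_mod_cast hE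
    simp only [r00, s00]
    push_cast
    field_simp
    ring

end NearZero

/-! ### Kernels on the continuous spectrum -/

/-- `e^{iθ}`. -/
def circlePt (θ : ℝ) : ℂ := Complex.exp (θ * Complex.I)

/-- The root `ρ` of `ρ + ρ⁻¹ = 2 z - 2 cos θ` in the unit disc. -/
def innerRoot (z θ : ℝ) : ℂ := joukInv ((2 * z - 2 * Real.cos θ : ℝ) : ℂ)

theorem norm_circlePt (θ : ℝ) : ‖circlePt θ‖ = 1 := Complex.norm_exp_ofReal_mul_I θ

theorem circlePt_ne_zero (θ : ℝ) : circlePt θ ≠ 0 := Complex.exp_ne_zero _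

theorem circlePt_eq (θ : ℝ) : circlePt θ = ⟨Real.cos θ, Real.sin θ⟩ := by
  unfold circlePt
  rw [Complex.exp_mul_I, ← Complex.ofReal_cos, ← Complex.ofReal_sin, Complex.ext_iff]
  simp [Complex.cos_ofReal_re, Complex.sin_ofReal_re, Complex.cos_ofReal_im, Complex.sin_ofReal_im]

theorem circlePt_add_inv (θ : ℝ) :
    circlePt θ + (circlePt θ)⁻¹ = ((2 * Real.cos θ : ℝ) : ℂ) := by
  rw [add_inv_of_norm_one (norm_circlePt θ), circlePt_eq]

theorem two_lt_abs_two_mul_sub {z : ℝ} (hz : 2 < |z|) (θ : ℝ) : 2 < |2 * z - 2 * Real.cos θ| := by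
  have h1 := Real.cos_le_one θ
  have h2 := Real.neg_one_le_cos θ
  rcases lt_abs.1 hz with h | h
  · exact lt_abs.2 (Or.inl (by linarith))
  · exact lt_abs.2 (Or.inr (by linarith))

theorem innerRoot_add_inv (z θ : ℝ) :
    innerRoot z θ + (innerRoot z θ)⁻¹ = ((2 * z - 2 * Real.cos θ : ℝ) : ℂ) :=
  joukInv_add_inv _

theorem innerRoot_ne_zero (z θ : ℝ) : innerRoot z θ ≠ 0 := joukInv_ne_zero _

theorem norm_innerRoot_lt {z : ℝ} (hz : 2 < |z|) (θ : ℝ) : ‖innerRoot z θ‖ < 1 :=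
  joukInv_real_norm_lt (two_lt_abs_two_mul_sub hz θ)

theorem innerRoot_neg (z θ : ℝ) : innerRoot z (-θ) = innerRoot z θ := by
  unfold innerRoot; rw [Real.cos_neg]

theorem resPlus_cos {z θ : ℝ} (h0 : 0 ≤ θ) (hπ : θ ≤ Real.pi) :
    resPlus z (Complex.I * ((z - 2 * Real.cos θ : ℝ) : ℂ)) = circlePt (-θ) := by
  rw [resPlus_I_mul, show z - (z - 2 * Real.cos θ) = 2 * Real.cos θ by ring,
    joukInv_two_cos h0 hπ, circlePt]
  push_cast
  ring_nf

theorem resMinus_cos {z : ℝ} (hz : 2 < |z|) (θ : ℝ) :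
    resMinus z (Complex.I * ((z - 2 * Real.cos θ : ℝ) : ℂ)) = innerRoot z θ := by
  rw [resMinus_I_mul, show z + (z - 2 * Real.cos θ) = 2 * z - 2 * Real.cos θ by ring,
    neg_joukInv_neg (two_lt_abs_two_mul_sub hz θ), innerRoot]

theorem resPlus_neg_cos (z θ : ℝ) :
    resPlus z (-(Complex.I * ((z - 2 * Real.cos θ : ℝ) : ℂ))) = innerRoot z θ := by
  rw [resPlus_neg_I_mul, show z + (z - 2 * Real.cos θ) = 2 * z - 2 * Real.cos θ by ring,
    innerRoot]

theorem resMinus_neg_cos {z θ : ℝ} (h0 : 0 ≤ θ) (hπ : θ ≤ Real.pi) :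
    resMinus z (-(Complex.I * ((z - 2 * Real.cos θ : ℝ) : ℂ))) = circlePt θ := by
  rw [resMinus_neg_I_mul,
    show -(z - (z - 2 * Real.cos θ)) = 2 * Real.cos (Real.pi - θ) by
      rw [Real.cos_pi_sub]; ring,
    joukInv_two_cos (by linarith) (by linarith), circlePt]
  push_cast
  rw [show -(((Real.pi : ℂ) - θ) * Complex.I) = θ * Complex.I - Real.pi * Complex.I by ring,
    Complex.exp_sub, Complex.exp_pi_mul_I]
  ring

theorem contDiff_circlePt : ContDiff ℝ 2 circlePt := by
  unfold circlePt
  exact ((Complex.ofRealCLM.contDiff.of_le le_top).mul contDiff_const).cexp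

theorem analyticAt_rotSqrt {w : ℂ} (h : 0 < w.im ∨ w.re ≠ 0) : AnalyticAt ℂ rotSqrt w := by
  unfold rotSqrt
  refine AnalyticAt.cpow (by fun_prop) analyticAt_const ?_
  rw [Complex.mem_slitPlane_iff]
  simpa using h

theorem analyticAt_joukInv {x : ℝ} (hx : 2 < |x|) : AnalyticAt ℂ joukInv x := by
  have hp : x + 2 ≠ 0 ∧ x - 2 ≠ 0 := by
    rcases lt_abs.1 hx with h | h
    · exact ⟨by linarith, by linarith⟩
    · constructor <;> intro <;> linarith
  have h1 : AnalyticAt ℂ (fun ζ => rotSqrt (ζ + 2)) x :=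
    AnalyticAt.comp (f := fun ζ : ℂ => ζ + 2) (analyticAt_rotSqrt (Or.inr (by simpa using hp.1)))
      (by fun_prop)
  have h2 : AnalyticAt ℂ (fun ζ => rotSqrt (ζ - 2)) x :=
    AnalyticAt.comp (f := fun ζ : ℂ => ζ - 2) (analyticAt_rotSqrt (Or.inr (by simpa using hp.2)))
      (by fun_prop)
  exact (h1.sub h2).div (h1.add h2) (rotSqrt_add_ne x)

theorem contDiff_innerRoot {z : ℝ} (hz : 2 < |z|) : ContDiff ℝ 2 (innerRoot z) := by
  refine contDiff_iff_contDiffAt.2 fun θ => ?_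
  have h1 : ContDiffAt ℝ 2 joukInv ((2 * z - 2 * Real.cos θ : ℝ) : ℂ) :=
    (analyticAt_joukInv (two_lt_abs_two_mul_sub hz θ)).contDiffAt.restrict_scalars ℝ
  have h2 : ContDiff ℝ 2 (fun θ : ℝ => ((2 * z - 2 * Real.cos θ : ℝ) : ℂ)) :=
    (Complex.ofRealCLM.contDiff (n := 2)).comp
      (contDiff_const.sub (contDiff_const.mul (Real.contDiff_cos)))
  exact h1.comp θ h2.contDiffAt

theorem circlePt_periodic : Function.Periodic circlePt (2 * Real.pi) := fun θ => by
  rw [circlePt_eq, circlePt_eq, Real.cos_add_two_pi, Real.sin_add_two_pi]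

theorem innerRoot_periodic (z : ℝ) : Function.Periodic (innerRoot z) (2 * Real.pi) := fun θ => by
  unfold innerRoot
  rw [Real.cos_add_two_pi]

/-- Every point of the circle is a boundary value of an exponent. -/
theorem resDet_circle_ne_zero {z : ℝ} {m n : ℂ} (hz : 2 < |z|)
    (hD : ∀ l ∈ puncturedHalfPlane, resDet m n (resPlus z l) (resMinus z l) ≠ 0) (θ : ℝ) :
    resDet m n (circlePt θ) (innerRoot z θ) ≠ 0 := by
  have hb := Real.arccos_nonneg (Real.cos θ)
  have hπ := Real.arccos_le_pi (Real.cos θ)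
  -- The points e^{-iτ} and e^{iτ}, τ ∈ [0, π], are the boundary values at i(z - 2 cos τ) and at its
  -- negative; θ agrees with one of ±τ modulo 2π.
  set τ := Real.arccos (Real.cos θ) with hτ
  have hcos : Real.cos τ = Real.cos θ :=
    Real.cos_arccos (Real.neg_one_le_cos θ) (Real.cos_le_one θ)
  have hin : innerRoot z τ = innerRoot z θ := by unfold innerRoot; rw [hcos]
  have hne : z - 2 * Real.cos τ ≠ 0 := by
    have h1 := Real.cos_le_one τ
    have h2 := Real.neg_one_le_cos τ
    rcases lt_abs.1 hz with h | h
    · exact ne_of_gt (by linarith)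
    · exact ne_of_lt (by linarith)
  have hneC : Complex.I * ((z - 2 * Real.cos τ : ℝ) : ℂ) ≠ 0 :=
    mul_ne_zero Complex.I_ne_zero (by exact_mod_cast hne)
  have hmem1 : Complex.I * ((z - 2 * Real.cos τ : ℝ) : ℂ) ∈ puncturedHalfPlane :=
    ⟨by rw [Complex.re_mul_ofReal]; simp, hneC⟩
  have hmem2 : -(Complex.I * ((z - 2 * Real.cos τ : ℝ) : ℂ)) ∈ puncturedHalfPlane :=
    ⟨by rw [Complex.neg_re, Complex.re_mul_ofReal]; simp, neg_ne_zero.2 hneC⟩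
  have k1 := hD _ hmem1
  have k2 := hD _ hmem2
  rw [resPlus_cos hb hπ, resMinus_cos hz, hin] at k1
  rw [resPlus_neg_cos, resMinus_neg_cos hb hπ, hin, resDet_symm] at k2
  have hs : Real.sin τ ^ 2 = Real.sin θ ^ 2 := by
    have e1 := Real.sin_sq_add_cos_sq τ
    have e2 := Real.sin_sq_add_cos_sq θ
    rw [hcos] at e1
    linarith
  rcases sq_eq_sq_iff_eq_or_eq_neg.1 hs with h | h
  · have : circlePt θ = circlePt τ := by rw [circlePt_eq, circlePt_eq, hcos, h]
    rwa [this]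
  · have : circlePt θ = circlePt (-τ) := by
      rw [circlePt_eq, circlePt_eq, Real.cos_neg, Real.sin_neg, hcos, h, neg_neg]
    rwa [this]

/-! ### The spectral integral and its value for the multiplier 1 -/

/-- The spectral integral of the kernel `k` with the multiplier `g`. -/
def specInt (z : ℝ) (g : ℂ → ℂ) (k : ℂ → ℂ → ℂ) : ℂ :=
  (Real.pi : ℂ)⁻¹ * ∫ θ in (-Real.pi)..Real.pi, (Real.sin θ : ℂ) *
    (g (Complex.I * ((z - 2 * Real.cos θ : ℝ) : ℂ)) * k (circlePt θ) (innerRoot z θ) -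
      g (-(Complex.I * ((z - 2 * Real.cos θ : ℝ) : ℂ))) * k (innerRoot z θ) (circlePt θ))

-- The antisymmetrised kernel changes sign between iτ and -iτ off the spectrum, since the roots are
-- interchanged there. On the spectrum its two boundary values, for θ in [0, π], assemble into the
-- integrand at θ and at -θ, so the contour formula yields the integral over the whole circle.
open intervalIntegral in
theorem specInt_one {z : ℝ} {k : ℂ → ℂ → ℂ} {cI c0 : ℂ} (hz : 2 < |z|)
    (hk1 : Continuous fun θ => k (circlePt θ) (innerRoot z θ))
    (hk2 : Continuous fun θ => k (innerRoot z θ) (circlePt θ))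
    (hc : ContinuousOn (fun l => k (resPlus z l) (resMinus z l) - k (resMinus z l) (resPlus z l))
      puncturedHalfPlane)
    (hd : DifferentiableOn ℂ
      (fun l => k (resPlus z l) (resMinus z l) - k (resMinus z l) (resPlus z l)) {l | 0 < l.re})
    (hI : Tendsto (fun l => l * (k (resPlus z l) (resMinus z l) - k (resMinus z l) (resPlus z l)))
      (Bornology.cobounded ℂ ⊓ 𝓟 puncturedHalfPlane) (𝓝 cI))
    (h0 : Tendsto (fun l => l * (k (resPlus z l) (resMinus z l) - k (resMinus z l) (resPlus z l)))
      (𝓝 0 ⊓ 𝓟 puncturedHalfPlane) (𝓝 c0)) :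
    specInt z (fun _ => 1) k = -(cI - c0) / 2 := by
  have h := integral_cos_eq hc hd hI h0 hz (fun τ h1 h2 => by
    have e1 : resMinus z (Complex.I * τ) = resPlus z (-(Complex.I * τ)) := by
      rw [resMinus_I_mul, resPlus_neg_I_mul, neg_joukInv_neg h2]
    have e2 : resMinus z (-(Complex.I * τ)) = resPlus z (Complex.I * τ) := by
      rw [resMinus_neg_I_mul, resPlus_I_mul, neg_joukInv_neg h1]
    rw [e1, e2]
    ring)
  set A : ℝ → ℂ := fun θ => (Real.sin θ : ℂ) *
    (k (circlePt θ) (innerRoot z θ) - k (innerRoot z θ) (circlePt θ)) with hA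
  have hAc : Continuous A := by
    refine Continuous.mul (by fun_prop) (hk1.sub hk2)
  have hi : ∀ a b : ℝ, IntervalIntegrable A MeasureTheory.volume a b := fun a b =>
    hAc.intervalIntegrable a b
  have h1 : (∫ θ in (0 : ℝ)..Real.pi, ((2 * Real.sin θ : ℝ) : ℂ) *
      ((k (resPlus z (Complex.I * ((z - 2 * Real.cos θ : ℝ) : ℂ)))
          (resMinus z (Complex.I * ((z - 2 * Real.cos θ : ℝ) : ℂ))) -
        k (resMinus z (Complex.I * ((z - 2 * Real.cos θ : ℝ) : ℂ)))
          (resPlus z (Complex.I * ((z - 2 * Real.cos θ : ℝ) : ℂ)))) +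
      (k (resPlus z (-(Complex.I * ((z - 2 * Real.cos θ : ℝ) : ℂ))))
          (resMinus z (-(Complex.I * ((z - 2 * Real.cos θ : ℝ) : ℂ)))) -
        k (resMinus z (-(Complex.I * ((z - 2 * Real.cos θ : ℝ) : ℂ))))
          (resPlus z (-(Complex.I * ((z - 2 * Real.cos θ : ℝ) : ℂ)))))))
      = ∫ θ in (0 : ℝ)..Real.pi, (-2 : ℂ) * (A (-θ) + A θ) := by
    refine integral_congr fun θ hθ => ?_
    rw [Set.uIcc_of_le Real.pi_pos.le] at hθ
    simp only [hA]
    rw [resPlus_cos hθ.1 hθ.2, resMinus_cos hz, resPlus_neg_cos, resMinus_neg_cos hθ.1 hθ.2,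
      innerRoot_neg, Real.sin_neg]
    push_cast
    ring
  rw [h1, intervalIntegral.integral_const_mul, integral_add (by
    exact (hAc.comp continuous_neg).intervalIntegrable _ _) (hi _ _),
    integral_comp_neg A, neg_zero, integral_add_adjacent_intervals (hi _ _) (hi _ _)] at h
  have hpi : (Real.pi : ℂ) ≠ 0 := by exact_mod_cast Real.pi_ne_zero
  unfold specInt
  simp only [one_mul]
  change (Real.pi : ℂ)⁻¹ * ∫ θ in (-Real.pi)..Real.pi, A θ = _
  field_simp
  linear_combination -h

/-! ### Regularity of the kernels -/

theorem continuousOn_diagKernel {X : Type*} [TopologicalSpace X] {s : Set X} {m n : ℂ} {f g : X → ℂ}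
    (hf : ContinuousOn f s) (hg : ContinuousOn g s)
    (hD : ∀ l ∈ s, resDet m n (f l) (g l) ≠ 0) (x y : ℤ) :
    ContinuousOn (fun l => diagKernel m n x y (f l) (g l)) s := by
  unfold diagKernel dirKernel
  refine ContinuousOn.add (by fun_prop) (ContinuousOn.div (by fun_prop) ?_ hD)
  unfold resDet
  fun_prop

theorem continuousOn_offKernel {X : Type*} [TopologicalSpace X] {s : Set X} {m n : ℂ} {f g : X → ℂ}
    (hf : ContinuousOn f s) (hg : ContinuousOn g s)
    (hD : ∀ l ∈ s, resDet m n (f l) (g l) ≠ 0) (x y : ℤ) :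
    ContinuousOn (fun l => offKernel m n x y (f l) (g l)) s := by
  unfold offKernel
  refine ContinuousOn.div (by fun_prop) ?_ hD
  unfold resDet
  fun_prop

theorem differentiableOn_diagKernel {s : Set ℂ} {m n : ℂ} {f g : ℂ → ℂ}
    (hf : DifferentiableOn ℂ f s) (hg : DifferentiableOn ℂ g s)
    (hD : ∀ l ∈ s, resDet m n (f l) (g l) ≠ 0) (x y : ℤ) :
    DifferentiableOn ℂ (fun l => diagKernel m n x y (f l) (g l)) s := by
  unfold diagKernel dirKernel
  refine DifferentiableOn.add (by fun_prop) (DifferentiableOn.div (by fun_prop) ?_ hD)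
  unfold resDet
  fun_prop

theorem differentiableOn_offKernel {s : Set ℂ} {m n : ℂ} {f g : ℂ → ℂ}
    (hf : DifferentiableOn ℂ f s) (hg : DifferentiableOn ℂ g s)
    (hD : ∀ l ∈ s, resDet m n (f l) (g l) ≠ 0) (x y : ℤ) :
    DifferentiableOn ℂ (fun l => offKernel m n x y (f l) (g l)) s := by
  unfold offKernel
  refine DifferentiableOn.div (by fun_prop) ?_ hD
  unfold resDet
  fun_prop

theorem tendsto_mul_resPlus (z : ℝ) : Tendsto (fun l => l * resPlus z l)
    (Bornology.cobounded ℂ ⊓ 𝓟 puncturedHalfPlane) (𝓝 (-Complex.I)) := tendsto_mul_joukInv z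

theorem tendsto_resPlus_cobounded (z : ℝ) : Tendsto (resPlus z)
    (Bornology.cobounded ℂ ⊓ 𝓟 puncturedHalfPlane) (𝓝 0) := tendsto_joukInv_cobounded z

theorem tendsto_mul_resMinus (z : ℝ) : Tendsto (fun l => l * resMinus z l)
    (Bornology.cobounded ℂ ⊓ 𝓟 puncturedHalfPlane) (𝓝 Complex.I) := by
  have h := (tendsto_mul_joukInv (-z)).neg
  rw [neg_neg] at h
  refine h.congr fun l => ?_
  unfold resMinus
  push_cast
  ring

theorem tendsto_resMinus_cobounded (z : ℝ) : Tendsto (resMinus z)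
    (Bornology.cobounded ℂ ⊓ 𝓟 puncturedHalfPlane) (𝓝 0) := by
  have h := (tendsto_joukInv_cobounded (-z)).neg
  rw [neg_zero] at h
  refine h.congr fun l => ?_
  unfold resMinus
  push_cast
  ring

section

variable {r0 n : ℝ}

theorem continuous_diagKernel_circle {z : ℝ} {m n : ℂ} (hz : 2 < |z|)
    (hD : ∀ θ, resDet m n (circlePt θ) (innerRoot z θ) ≠ 0) (x y : ℤ) :
    (Continuous fun θ => diagKernel m n x y (circlePt θ) (innerRoot z θ)) ∧
      Continuous fun θ => diagKernel m n x y (innerRoot z θ) (circlePt θ) := by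
  have h1 := contDiff_circlePt.continuous
  have h2 := (contDiff_innerRoot hz).continuous
  constructor <;> rw [← continuousOn_univ]
  · exact continuousOn_diagKernel h1.continuousOn h2.continuousOn (fun θ _ => hD θ) x y
  · exact continuousOn_diagKernel h2.continuousOn h1.continuousOn
      (fun θ _ => by rw [resDet_symm]; exact hD θ) x y

theorem continuous_offKernel_circle {z : ℝ} {m n : ℂ} (hz : 2 < |z|)
    (hD : ∀ θ, resDet m n (circlePt θ) (innerRoot z θ) ≠ 0) (x y : ℤ) :
    (Continuous fun θ => offKernel m n x y (circlePt θ) (innerRoot z θ)) ∧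
      Continuous fun θ => offKernel m n x y (innerRoot z θ) (circlePt θ) := by
  have h1 := contDiff_circlePt.continuous
  have h2 := (contDiff_innerRoot hz).continuous
  constructor <;> rw [← continuousOn_univ]
  · exact continuousOn_offKernel h1.continuousOn h2.continuousOn (fun θ _ => hD θ) x y
  · exact continuousOn_offKernel h2.continuousOn h1.continuousOn
      (fun θ _ => by rw [resDet_symm]; exact hD θ) x y

theorem specInt_one_diagKernel (h0 : r0 ≠ 0) (h1 : |r0| < 1) (hE : detCoeff r0 n ≠ 0)
    (hD : ∀ l ∈ puncturedHalfPlane, resDet (((r0⁻¹ - r0 : ℝ) : ℂ) + n) n (resPlus (r0 + r0⁻¹) l)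
      (resMinus (r0 + r0⁻¹) l) ≠ 0) (x y : ℤ) :
    specInt (r0 + r0⁻¹) (fun _ => 1) (diagKernel (((r0⁻¹ - r0 : ℝ) : ℂ) + n) n x y) =
      Complex.I * ((if x = y then 1 else 0) - ((r0 ^ (x.natAbs + y.natAbs) *
        (n * (x.natAbs + y.natAbs) - (r0 + r0⁻¹)) / ((r0⁻¹ - r0) * detCoeff r0 n) : ℝ) : ℂ)) := by
  have hz := two_lt_abs_add_inv h0 h1
  have hz0 := tendsto_mul_diagKernel_zero h0 h1 hE x y
  set z := r0 + r0⁻¹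
  set m : ℂ := ((r0⁻¹ - r0 : ℝ) : ℂ) + n
  have hc := continuous_diagKernel_circle hz (resDet_circle_ne_zero hz hD) x y
  have hD' : ∀ l ∈ puncturedHalfPlane, resDet m n (resMinus z l) (resPlus z l) ≠ 0 := fun l hl => by
    rw [resDet_symm]; exact hD l hl
  have hsub : {l : ℂ | 0 < l.re} ⊆ puncturedHalfPlane := fun l hl =>
    ⟨le_of_lt hl, fun h => by simp [h] at hl⟩
  have c1 := (continuousOn_resPlus z).mono (fun l (hl : l ∈ puncturedHalfPlane) => hl.1)
  have c2 := (continuousOn_resMinus z).mono (fun l (hl : l ∈ puncturedHalfPlane) => hl.1)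
  have hinf : Tendsto (fun l => l * (diagKernel m n x y (resPlus z l) (resMinus z l) -
      diagKernel m n x y (resMinus z l) (resPlus z l)))
      (Bornology.cobounded ℂ ⊓ 𝓟 puncturedHalfPlane)
      (𝓝 ((if x = y then -Complex.I else 0) - (if x = y then Complex.I else 0))) := by
    have t1 := tendsto_mul_diagKernel (m := m) (n := n) (tendsto_resPlus_cobounded z)
      (tendsto_resMinus_cobounded z) (tendsto_mul_resPlus z) x y
    have t2 := tendsto_mul_diagKernel (m := m) (n := n) (tendsto_resMinus_cobounded z)
      (tendsto_resPlus_cobounded z) (tendsto_mul_resMinus z) x y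
    exact (t1.sub t2).congr fun l => by ring
  rw [specInt_one hz hc.1 hc.2
    ((continuousOn_diagKernel c1 c2 hD x y).sub (continuousOn_diagKernel c2 c1 hD' x y))
    ((differentiableOn_diagKernel (differentiableOn_resPlus z) (differentiableOn_resMinus z)
      (fun l hl => hD l (hsub hl)) x y).sub
      (differentiableOn_diagKernel (differentiableOn_resMinus z) (differentiableOn_resPlus z)
      (fun l hl => hD' l (hsub hl)) x y)) hinf hz0]
  split_ifs <;> ring

theorem specInt_one_offKernel (h0 : r0 ≠ 0) (h1 : |r0| < 1) (hE : detCoeff r0 n ≠ 0)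
    (hD : ∀ l ∈ puncturedHalfPlane, resDet (((r0⁻¹ - r0 : ℝ) : ℂ) + n) n (resPlus (r0 + r0⁻¹) l)
      (resMinus (r0 + r0⁻¹) l) ≠ 0) (x y : ℤ) :
    specInt (r0 + r0⁻¹) (fun _ => 1) (offKernel (((r0⁻¹ - r0 : ℝ) : ℂ) + n) n x y) =
      -Complex.I * ((r0 ^ (x.natAbs + y.natAbs) *
        (n * (y.natAbs - x.natAbs)) / ((r0⁻¹ - r0) * detCoeff r0 n) : ℝ) : ℂ) := by
  have hz := two_lt_abs_add_inv h0 h1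
  have hz0 := tendsto_mul_offKernel_zero h0 h1 hE x y
  set z := r0 + r0⁻¹
  set m : ℂ := ((r0⁻¹ - r0 : ℝ) : ℂ) + n
  have hc := continuous_offKernel_circle hz (resDet_circle_ne_zero hz hD) x y
  have hD' : ∀ l ∈ puncturedHalfPlane, resDet m n (resMinus z l) (resPlus z l) ≠ 0 := fun l hl => by
    rw [resDet_symm]; exact hD l hl
  have hsub : {l : ℂ | 0 < l.re} ⊆ puncturedHalfPlane := fun l hl =>
    ⟨le_of_lt hl, fun h => by simp [h] at hl⟩
  have c1 := (continuousOn_resPlus z).mono (fun l (hl : l ∈ puncturedHalfPlane) => hl.1)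
  have c2 := (continuousOn_resMinus z).mono (fun l (hl : l ∈ puncturedHalfPlane) => hl.1)
  have hinf : Tendsto (fun l => l * (offKernel m n x y (resPlus z l) (resMinus z l) -
      offKernel m n x y (resMinus z l) (resPlus z l)))
      (Bornology.cobounded ℂ ⊓ 𝓟 puncturedHalfPlane) (𝓝 (0 - 0)) := by
    have t1 := tendsto_mul_offKernel (m := m) (n := n) (tendsto_resPlus_cobounded z)
      (tendsto_resMinus_cobounded z) (tendsto_mul_resPlus z) x y
    have t2 := tendsto_mul_offKernel (m := m) (n := n) (tendsto_resMinus_cobounded z)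
      (tendsto_resPlus_cobounded z) (tendsto_mul_resMinus z) x y
    exact (t1.sub t2).congr fun l => by ring
  rw [specInt_one hz hc.1 hc.2
    ((continuousOn_offKernel c1 c2 hD x y).sub (continuousOn_offKernel c2 c1 hD' x y))
    ((differentiableOn_offKernel (differentiableOn_resPlus z) (differentiableOn_resMinus z)
      (fun l hl => hD l (hsub hl)) x y).sub
      (differentiableOn_offKernel (differentiableOn_resMinus z) (differentiableOn_resPlus z)
      (fun l hl => hD' l (hsub hl)) x y)) hinf hz0]
  ring

end

/-! ### Decay in time and growth in space of the spectral integrals -/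

-- The multiplier e^{±it(z - 2 cos θ)} is a unimodular constant times e^{∓2it cos θ}, so both terms
-- fall under the oscillatory bound with s = ∓2t. Each costs 28 M; the gains 1/π and 2^{-3/2} are
-- discarded.
open intervalIntegral in
theorem norm_specInt_exp_le {z M : ℝ} {k : ℂ → ℂ → ℂ}
    (h1 : C2Bound (fun θ => k (circlePt θ) (innerRoot z θ)) M)
    (h2 : C2Bound (fun θ => k (innerRoot z θ) (circlePt θ)) M) {t : ℝ} (ht : 1 ≤ |t|) :
    ‖specInt z (fun l => Complex.exp (t * l)) k‖ ≤ 56 * M * |t| ^ (-(3 / 2) : ℝ) := by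
  have hM := h1.nonneg
  have ht2 : 1 ≤ |2 * t| := by rw [abs_mul, abs_two]; linarith
  have ht2' : 1 ≤ |-2 * t| := by rw [abs_mul, abs_neg, abs_two]; linarith
  have hper : circlePt Real.pi = circlePt (-Real.pi) := by
    rw [circlePt_eq, circlePt_eq, Real.cos_neg, Real.sin_neg, Real.sin_pi, neg_zero]
  have b1 := h1.norm_integral_sin_mul_le (by rw [hper, innerRoot_neg]) ht2'
  have b2 := h2.norm_integral_sin_mul_le (by rw [hper, innerRoot_neg]) ht2
  have hc1 := h1.continuous
  have hc2 := h2.continuous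
  set f := fun θ => k (circlePt θ) (innerRoot z θ)
  set g := fun θ => k (innerRoot z θ) (circlePt θ)
  have e : (∫ θ in (-Real.pi)..Real.pi, (Real.sin θ : ℂ) *
      (Complex.exp (t * (Complex.I * ((z - 2 * Real.cos θ : ℝ) : ℂ))) * f θ -
        Complex.exp (t * -(Complex.I * ((z - 2 * Real.cos θ : ℝ) : ℂ))) * g θ)) =
      Complex.exp (((t * z : ℝ) : ℂ) * Complex.I) * (∫ θ in (-Real.pi)..Real.pi,
        Real.sin θ * (Complex.exp (Complex.I * (((-2 * t : ℝ) : ℂ) * Real.cos θ)) * f θ)) -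
      Complex.exp (((-(t * z) : ℝ) : ℂ) * Complex.I) * (∫ θ in (-Real.pi)..Real.pi,
        Real.sin θ * (Complex.exp (Complex.I * (((2 * t : ℝ) : ℂ) * Real.cos θ)) * g θ)) := by
    rw [← intervalIntegral.integral_const_mul, ← intervalIntegral.integral_const_mul,
      ← integral_sub ((by fun_prop : Continuous _).intervalIntegrable _ _)
        ((by fun_prop : Continuous _).intervalIntegrable _ _)]
    refine integral_congr fun θ _ => ?_
    have e1 : Complex.exp (t * (Complex.I * ((z - 2 * Real.cos θ : ℝ) : ℂ))) =
        Complex.exp (((t * z : ℝ) : ℂ) * Complex.I) *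
          Complex.exp (Complex.I * (((-2 * t : ℝ) : ℂ) * Real.cos θ)) := by
      rw [← Complex.exp_add]; congr 1; push_cast; ring
    have e2 : Complex.exp (t * -(Complex.I * ((z - 2 * Real.cos θ : ℝ) : ℂ))) =
        Complex.exp (((-(t * z) : ℝ) : ℂ) * Complex.I) *
          Complex.exp (Complex.I * (((2 * t : ℝ) : ℂ) * Real.cos θ)) := by
      rw [← Complex.exp_add]; congr 1; push_cast; ring
    simp only [e1, e2]
    ring
  have hmono : ∀ s : ℝ, |s| = 2 * |t| → |s| ^ (-(3 / 2) : ℝ) ≤ |t| ^ (-(3 / 2) : ℝ) := fun s hs =>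
    Real.rpow_le_rpow_of_nonpos (by linarith) (by linarith) (by norm_num)
  have m1 := hmono (2 * t) (by rw [abs_mul, abs_two])
  have m2 := hmono (-2 * t) (by rw [abs_mul, abs_neg, abs_two])
  have hp : 0 ≤ |t| ^ (-(3 / 2) : ℝ) := Real.rpow_nonneg (abs_nonneg _) _
  have hsum : ‖∫ θ in (-Real.pi)..Real.pi, (Real.sin θ : ℂ) *
      (Complex.exp (t * (Complex.I * ((z - 2 * Real.cos θ : ℝ) : ℂ))) * f θ -
        Complex.exp (t * -(Complex.I * ((z - 2 * Real.cos θ : ℝ) : ℂ))) * g θ)‖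
      ≤ 56 * M * |t| ^ (-(3 / 2) : ℝ) := by
    rw [e]
    refine (norm_sub_le _ _).trans ?_
    rw [norm_mul, norm_mul, Complex.norm_exp_ofReal_mul_I, Complex.norm_exp_ofReal_mul_I, one_mul,
      one_mul]
    have n1 := b1.trans (mul_le_mul_of_nonneg_left m2 (by positivity))
    have n2 := b2.trans (mul_le_mul_of_nonneg_left m1 (by positivity))
    linarith
  unfold specInt
  rw [norm_mul, norm_inv, Complex.norm_real, Real.norm_of_nonneg Real.pi_pos.le]
  have hpi : Real.pi⁻¹ ≤ 1 := inv_le_one_of_one_le₀ (by linarith [Real.pi_gt_three])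
  calc _ ≤ 1 * (56 * M * |t| ^ (-(3 / 2) : ℝ)) := by
        gcongr
    _ = _ := one_mul _

/-- There are at most min(|x|, |y|) powers, all with exponent at most |x| + |y|. The number of terms
is absorbed in (1 + min)² and the quadratic cost of each in 4(1 + max)², so summation does not raise
the exponent of the weight. -/
theorem C2Bound.dirKernel {f : ℝ → ℂ} {M : ℝ} (hf : C2Bound f M) (hM : 1 ≤ M)
    (h1 : ∀ θ, ‖f θ‖ ≤ 1) (x y : ℤ) :
    C2Bound (fun θ => dirKernel x y (f θ))
      (4 * M ^ 2 * ((1 + |(x : ℝ)|) ^ 2 * (1 + |(y : ℝ)|) ^ 2)) := by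
  unfold _root_.dirKernel
  set N := (x.natAbs + y.natAbs - (x - y).natAbs) / 2 with hN
  have hX : |(x : ℝ)| = x.natAbs := by rw [Nat.cast_natAbs, Int.cast_abs]
  have hY : |(y : ℝ)| = y.natAbs := by rw [Nat.cast_natAbs, Int.cast_abs]
  rw [hX, hY]
  have hNX : N ≤ x.natAbs := by omega
  have hNY : N ≤ y.natAbs := by omega
  set X := x.natAbs
  set Y := y.natAbs
  have hsum := C2Bound.sum (M := (1 + X + Y) ^ 2 * M ^ 2) (Finset.range N)
    (F := fun j θ => f θ ^ ((x - y).natAbs + 1 + 2 * j)) (fun j hj => by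
      have hj' := Finset.mem_range.1 hj
      refine (hf.pow hM h1 _).mono ?_
      have : (x - y).natAbs + 1 + 2 * j ≤ X + Y := by omega
      have h3 : (((x - y).natAbs + 1 + 2 * j : ℕ) : ℝ) ≤ X + Y := by exact_mod_cast this
      exact mul_le_mul_of_nonneg_right (pow_le_pow_left₀ (by positivity) (by linarith) 2)
        (by positivity))
  refine hsum.mono ?_
  rw [Finset.card_range]
  have hNX' : (N : ℝ) ≤ X := by exact_mod_cast hNX
  have hNY' : (N : ℝ) ≤ Y := by exact_mod_cast hNY
  have hN0 : (0 : ℝ) ≤ N := Nat.cast_nonneg _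
  have hX0 : (0 : ℝ) ≤ X := Nat.cast_nonneg _
  have hY0 : (0 : ℝ) ≤ Y := Nat.cast_nonneg _
  have key : (N : ℝ) * (1 + X + Y) ^ 2 ≤ 4 * ((1 + X) ^ 2 * (1 + Y) ^ 2) := by
    rcases le_total (X : ℝ) Y with h | h
    · calc (N : ℝ) * (1 + X + Y) ^ 2 ≤ (1 + X) ^ 2 * (2 * (1 + Y)) ^ 2 := by
            gcongr
            · nlinarith
            · linarith
        _ = _ := by ring
    · calc (N : ℝ) * (1 + X + Y) ^ 2 ≤ (1 + Y) ^ 2 * (2 * (1 + X)) ^ 2 := by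
            gcongr
            · nlinarith
            · linarith
        _ = _ := by ring
  calc (N : ℝ) * ((1 + X + Y) ^ 2 * M ^ 2) = (N * (1 + X + Y) ^ 2) * M ^ 2 := by ring
    _ ≤ (4 * ((1 + X) ^ 2 * (1 + Y) ^ 2)) * M ^ 2 := by gcongr
    _ = _ := by ring

theorem C2Bound.pow_mul_pow {f g w : ℝ → ℂ} {M N L : ℝ} (hf : C2Bound f M) (hM : 1 ≤ M)
    (hf1 : ∀ θ, ‖f θ‖ ≤ 1) (hg : C2Bound g N) (hN : 1 ≤ N) (hg1 : ∀ θ, ‖g θ‖ ≤ 1)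
    (hw : C2Bound w L) (x y : ℤ) :
    C2Bound (fun θ => f θ ^ (x.natAbs + 1) * g θ ^ (y.natAbs + 1) * w θ)
      (256 * M ^ 2 * N ^ 2 * L * ((1 + |(x : ℝ)|) ^ 2 * (1 + |(y : ℝ)|) ^ 2)) := by
  have hL := hw.nonneg
  have hX : |(x : ℝ)| = x.natAbs := by rw [Nat.cast_natAbs, Int.cast_abs]
  have hY : |(y : ℝ)| = y.natAbs := by rw [Nat.cast_natAbs, Int.cast_abs]
  rw [hX, hY]
  refine (((hf.pow hM hf1 _).mul (hg.pow hN hg1 _)).mul hw).mono ?_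
  push_cast
  have h3 : ∀ j : ℕ, (1 + ((j : ℝ) + 1)) ^ 2 ≤ 4 * (1 + j) ^ 2 := fun j => by
    have : (0 : ℝ) ≤ j := Nat.cast_nonneg _
    nlinarith
  calc _ ≤ 4 * (4 * (4 * (1 + (x.natAbs : ℝ)) ^ 2 * M ^ 2) * (4 * (1 + (y.natAbs : ℝ)) ^ 2 * N ^ 2))
        * L := by
        gcongr
        · exact h3 _
        · exact h3 _
    _ = _ := by ring

theorem C2Bound.pow_mul {f w : ℝ → ℂ} {M L : ℝ} (hf : C2Bound f M) (hM : 1 ≤ M)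
    (hf1 : ∀ θ, ‖f θ‖ ≤ 1) (hw : C2Bound w L) (x y : ℤ) :
    C2Bound (fun θ => f θ ^ (x.natAbs + y.natAbs + 1) * w θ)
      (16 * M ^ 2 * L * ((1 + |(x : ℝ)|) ^ 2 * (1 + |(y : ℝ)|) ^ 2)) := by
  have hL := hw.nonneg
  have hX : |(x : ℝ)| = x.natAbs := by rw [Nat.cast_natAbs, Int.cast_abs]
  have hY : |(y : ℝ)| = y.natAbs := by rw [Nat.cast_natAbs, Int.cast_abs]
  rw [hX, hY]
  refine ((hf.pow hM hf1 _).mul hw).mono ?_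
  push_cast
  have hX0 : (0 : ℝ) ≤ x.natAbs := Nat.cast_nonneg _
  have hY0 : (0 : ℝ) ≤ y.natAbs := Nat.cast_nonneg _
  calc _ ≤ 4 * ((2 * ((1 + (x.natAbs : ℝ)) * (1 + y.natAbs))) ^ 2 * M ^ 2) * L := by
        gcongr
        nlinarith [mul_nonneg hX0 hY0]
    _ = _ := by ring

/-- The kernels on the continuous spectrum satisfy uniform `C²` bounds. -/
theorem exists_C2Bound_kernels {z : ℝ} {m n : ℂ} (hz : 2 < |z|)
    (hD : ∀ θ, resDet m n (circlePt θ) (innerRoot z θ) ≠ 0) :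
    ∃ K : ℝ, ∀ x y : ℤ, ∀ k ∈ ({diagKernel m n x y, offKernel m n x y} : Set (ℂ → ℂ → ℂ)),
      C2Bound (fun θ => k (circlePt θ) (innerRoot z θ))
        (K * ((1 + |(x : ℝ)|) ^ 2 * (1 + |(y : ℝ)|) ^ 2)) ∧
      C2Bound (fun θ => k (innerRoot z θ) (circlePt θ))
        (K * ((1 + |(x : ℝ)|) ^ 2 * (1 + |(y : ℝ)|) ^ 2)) := by
  have c1 := contDiff_circlePt
  have c2 := contDiff_innerRoot hz
  have p1 := circlePt_periodic
  have p2 := innerRoot_periodic z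
  have n1 : ∀ θ, ‖circlePt θ‖ ≤ 1 := fun θ => (norm_circlePt θ).le
  have n2 : ∀ θ, ‖innerRoot z θ‖ ≤ 1 := fun θ => (norm_innerRoot_lt hz θ).le
  have hT : 0 < 2 * Real.pi := by positivity
  have cd : ContDiff ℝ 2 fun θ => resDet m n (circlePt θ) (innerRoot z θ) := by
    unfold resDet; fun_prop
  obtain ⟨M, hM, bM⟩ := C2Bound.exists_of_periodic hT c1 p1
  obtain ⟨N, hN, bN⟩ := C2Bound.exists_of_periodic hT c2 p2
  obtain ⟨L1, hL1, bL1⟩ := C2Bound.exists_of_periodic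
    (f := fun θ => (1 - innerRoot z θ ^ 2 - m * innerRoot z θ) / resDet m n (circlePt θ) (innerRoot z θ))
    hT (by
      simp only [div_eq_mul_inv]
      exact ContDiff.mul (by fun_prop) (cd.inv hD)) (fun θ => by simp only [p1 θ, p2 θ])
  obtain ⟨L2, hL2, bL2⟩ := C2Bound.exists_of_periodic
    (f := fun θ => (1 - circlePt θ ^ 2 - m * circlePt θ) / resDet m n (circlePt θ) (innerRoot z θ))
    hT (by
      simp only [div_eq_mul_inv]
      exact ContDiff.mul (by fun_prop) (cd.inv hD)) (fun θ => by simp only [p1 θ, p2 θ])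
  obtain ⟨L3, hL3, bL3⟩ := C2Bound.exists_of_periodic
    (f := fun θ => n / resDet m n (circlePt θ) (innerRoot z θ)) hT (by
      simp only [div_eq_mul_inv]
      exact contDiff_const.mul (cd.inv hD)) (fun θ => by simp only [p1 θ, p2 θ])
  set K := 4 * M ^ 2 + 16 * M ^ 2 * L1 + (4 * N ^ 2 + 16 * N ^ 2 * L2) + 256 * M ^ 2 * N ^ 2 * L3
    with hK
  have a1 : 0 ≤ 4 * M ^ 2 + 16 * M ^ 2 * L1 := by positivity
  have a2 : 0 ≤ 4 * N ^ 2 + 16 * N ^ 2 * L2 := by positivity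
  have a3 : 0 ≤ 256 * M ^ 2 * N ^ 2 * L3 := by positivity
  refine ⟨K, fun x y k hk => ?_⟩
  have hW : 0 ≤ (1 + |(x : ℝ)|) ^ 2 * (1 + |(y : ℝ)|) ^ 2 := by positivity
  rcases hk with rfl | rfl
  · constructor
    · have h := (bM.dirKernel hM n1 x y).add (bM.pow_mul hM n1 bL1 x y)
      rw [← add_mul] at h
      have h' := h.mono (mul_le_mul_of_nonneg_right (by linarith : _ ≤ K) hW)
      simpa only [diagKernel, mul_div_assoc] using h'
    · have h := (bN.dirKernel hN n2 x y).add (bN.pow_mul hN n2 bL2 x y)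
      rw [← add_mul] at h
      have h' := h.mono (mul_le_mul_of_nonneg_right (by linarith : _ ≤ K) hW)
      simpa only [diagKernel, mul_div_assoc, resDet_symm m n (circlePt _)] using h'
  · constructor
    · have h := (bM.pow_mul_pow hM n1 bN hN n2 bL3 x y).mono
        (mul_le_mul_of_nonneg_right (by linarith : _ ≤ K) hW)
      convert h using 2 with θ
      rw [offKernel]
      ring
    · have h := (bN.pow_mul_pow hN n2 bM hM n1 bL3 x y).mono
        (mul_le_mul_of_nonneg_right (by linarith : _ ≤ K) hW)
      convert h using 2 with θ
      rw [offKernel, resDet_symm m n (circlePt _)]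
      ring

/-! ### The functional calculus of the spectral integral -/

/-- The kernel `k` is continuous along the continuous spectrum. -/
def SpecContinuous (z : ℝ) (k : ℂ → ℂ → ℂ) : Prop :=
  (Continuous fun θ => k (circlePt θ) (innerRoot z θ)) ∧
    Continuous fun θ => k (innerRoot z θ) (circlePt θ)

section

variable {z : ℝ} {g : ℂ → ℂ} {k k' : ℂ → ℂ → ℂ}

theorem SpecContinuous.swap (h : SpecContinuous z k) : SpecContinuous z fun r s => k s r :=
  ⟨h.2, h.1⟩

theorem SpecContinuous.const (c : ℂ) : SpecContinuous z fun _ _ => c :=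
  ⟨continuous_const, continuous_const⟩

theorem SpecContinuous.const_mul (h : SpecContinuous z k) (c : ℂ) :
    SpecContinuous z fun r s => c * k r s :=
  ⟨continuous_const.mul h.1, continuous_const.mul h.2⟩

theorem SpecContinuous.add (h : SpecContinuous z k) (h' : SpecContinuous z k') :
    SpecContinuous z fun r s => k r s + k' r s :=
  ⟨h.1.add h'.1, h.2.add h'.2⟩

theorem continuous_specInt_integrand (hg : Continuous g) (hk : SpecContinuous z k) :
    Continuous fun θ : ℝ => (Real.sin θ : ℂ) *
      (g (Complex.I * ((z - 2 * Real.cos θ : ℝ) : ℂ)) * k (circlePt θ) (innerRoot z θ) -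
      g (-(Complex.I * ((z - 2 * Real.cos θ : ℝ) : ℂ))) * k (innerRoot z θ) (circlePt θ)) := by
  exact Continuous.mul (by fun_prop) (((hg.comp (by fun_prop)).mul hk.1).sub
    ((hg.comp (by fun_prop)).mul hk.2))

theorem specInt_const_mul (c : ℂ) :
    specInt z g (fun r s => c * k r s) = c * specInt z g k := by
  unfold specInt
  rw [mul_left_comm, ← intervalIntegral.integral_const_mul c]
  congr 1
  refine intervalIntegral.integral_congr fun θ _ => ?_
  ring

theorem specInt_add (hg : Continuous g) (hk : SpecContinuous z k) (hk' : SpecContinuous z k') :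
    specInt z g (fun r s => k r s + k' r s) = specInt z g k + specInt z g k' := by
  unfold specInt
  rw [← mul_add, ← intervalIntegral.integral_add
    ((continuous_specInt_integrand hg hk).intervalIntegrable _ _)
    ((continuous_specInt_integrand hg hk').intervalIntegrable _ _)]
  congr 1
  refine intervalIntegral.integral_congr fun θ _ => ?_
  ring

theorem specInt_swap : specInt z g (fun r s => k s r) = -specInt z (fun l => g (-l)) k := by
  unfold specInt
  rw [← mul_neg, ← intervalIntegral.integral_neg]
  congr 1
  refine intervalIntegral.integral_congr fun θ _ => ?_
  simp only [neg_neg]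
  ring

/-- The integrand is odd in θ. This is what eliminates the source term of the resolvent equation. -/
theorem specInt_const (c : ℂ) : specInt z g (fun _ _ => c) = 0 := by
  unfold specInt
  set A : ℝ → ℂ := fun θ => (Real.sin θ : ℂ) *
    (g (Complex.I * ((z - 2 * Real.cos θ : ℝ) : ℂ)) * c -
      g (-(Complex.I * ((z - 2 * Real.cos θ : ℝ) : ℂ))) * c) with hA
  have hodd : ∀ θ, A (-θ) = -A θ := fun θ => by
    simp only [hA, Real.sin_neg, Real.cos_neg]
    push_cast
    ring
  have h := intervalIntegral.integral_comp_neg (a := -Real.pi) (b := Real.pi) A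
  simp only [hodd, neg_neg, intervalIntegral.integral_neg] at h
  rw [neg_eq_self.1 h, mul_zero]

/-- A resolvent identity `G = l k + c` along the continuous spectrum. -/
theorem specInt_eq_specInt_mul {G : ℂ → ℂ → ℂ} {c : ℂ} (hg : Continuous g)
    (hk : SpecContinuous z k)
    (h1 : ∀ θ, Real.sin θ ≠ 0 → G (circlePt θ) (innerRoot z θ) =
      Complex.I * ((z - 2 * Real.cos θ : ℝ) : ℂ) * k (circlePt θ) (innerRoot z θ) + c)
    (h2 : ∀ θ, Real.sin θ ≠ 0 → G (innerRoot z θ) (circlePt θ) =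
      -(Complex.I * ((z - 2 * Real.cos θ : ℝ) : ℂ)) * k (innerRoot z θ) (circlePt θ) + c) :
    specInt z g G = specInt z (fun l => g l * l) k := by
  have h3 : specInt z g G = specInt z (fun l => g l * l) k + specInt z g (fun _ _ => c) := by
    have hadd := intervalIntegral.integral_add (μ := MeasureTheory.volume)
      ((continuous_specInt_integrand (g := fun l => g l * l) (hg.mul continuous_id)
        hk).intervalIntegrable (-Real.pi) Real.pi)
      ((continuous_specInt_integrand hg
        (SpecContinuous.const (z := z) c)).intervalIntegrable (-Real.pi) Real.pi)
    unfold specInt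
    rw [← mul_add]
    refine congrArg _ (Eq.trans ?_ hadd)
    refine intervalIntegral.integral_congr fun θ _ => ?_
    -- The resolvent identity is assumed only away from r = ±1; at these points the factor sin θ
    -- makes both sides vanish.
    by_cases hs : Real.sin θ = 0
    · simp [hs]
    · rw [h1 θ hs, h2 θ hs]
      ring
  rw [h3, specInt_const, add_zero]

theorem hasSum_specInt_exp (hk : SpecContinuous z k) (t : ℂ) :
    HasSum (fun p : ℕ => t ^ p / (p.factorial : ℂ) * specInt z (fun l => l ^ p) k)
      (specInt z (fun l => Complex.exp (t * l)) k) := by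
  obtain ⟨C1, hC1⟩ := (isCompact_uIcc (a := -Real.pi) (b := Real.pi)).exists_bound_of_continuousOn
    hk.1.continuousOn
  obtain ⟨C2, hC2⟩ := (isCompact_uIcc (a := -Real.pi) (b := Real.pi)).exists_bound_of_continuousOn
    hk.2.continuousOn
  set B : ℝ := |z| + 2
  have hφ : ∀ θ : ℝ, ‖Complex.I * ((z - 2 * Real.cos θ : ℝ) : ℂ)‖ ≤ B := fun θ => by
    rw [norm_mul, Complex.norm_I, one_mul, Complex.norm_real, Real.norm_eq_abs]
    refine (abs_sub _ _).trans ?_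
    rw [abs_mul, abs_two]
    have := Real.abs_cos_le_one θ
    simp only [B]
    linarith
  have hC10 : 0 ≤ C1 := (norm_nonneg _).trans (hC1 0 (by simp [Real.pi_pos.le]))
  have hC20 : 0 ≤ C2 := (norm_nonneg _).trans (hC2 0 (by simp [Real.pi_pos.le]))
  have hB0 : 0 ≤ B := (norm_nonneg _).trans (hφ 0)
  have hsum : Summable fun p : ℕ => (‖t‖ * B) ^ p / (p.factorial : ℝ) * (C1 + C2) :=
    (Real.summable_pow_div_factorial _).mul_right _
  have h := intervalIntegral.hasSum_integral_of_dominated_convergence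
    (μ := MeasureTheory.volume) (a := -Real.pi) (b := Real.pi)
    (F := fun (p : ℕ) (θ : ℝ) => t ^ p / (p.factorial : ℂ) * ((Real.sin θ : ℂ) *
      ((Complex.I * ((z - 2 * Real.cos θ : ℝ) : ℂ)) ^ p * k (circlePt θ) (innerRoot z θ) -
      (-(Complex.I * ((z - 2 * Real.cos θ : ℝ) : ℂ))) ^ p * k (innerRoot z θ) (circlePt θ))))
    (f := fun θ : ℝ => (Real.sin θ : ℂ) *
      (Complex.exp (t * (Complex.I * ((z - 2 * Real.cos θ : ℝ) : ℂ))) *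
        k (circlePt θ) (innerRoot z θ) -
      Complex.exp (t * -(Complex.I * ((z - 2 * Real.cos θ : ℝ) : ℂ))) *
        k (innerRoot z θ) (circlePt θ)))
    (bound := fun p _ => (‖t‖ * B) ^ p / (p.factorial : ℝ) * (C1 + C2))
    (fun p => ((continuous_specInt_integrand (g := fun l => l ^ p) (by fun_prop) hk).const_mul
      (t ^ p / (p.factorial : ℂ))).aestronglyMeasurable)
    (fun p => Eventually.of_forall fun θ hθ => by
      have hθ' : θ ∈ Set.uIcc (-Real.pi) Real.pi := Set.uIoc_subset_uIcc hθ
      have hsin : ‖(Real.sin θ : ℂ)‖ ≤ 1 := by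
        rw [Complex.norm_real, Real.norm_eq_abs]; exact Real.abs_sin_le_one θ
      have hw := hφ θ
      set w := Complex.I * ((z - 2 * Real.cos θ : ℝ) : ℂ)
      rw [norm_mul, norm_div, norm_pow, Complex.norm_natCast,
        show (‖t‖ * B) ^ p / (p.factorial : ℝ) * (C1 + C2)
          = ‖t‖ ^ p / (p.factorial : ℝ) * (B ^ p * (C1 + C2)) by rw [mul_pow]; ring]
      gcongr
      rw [norm_mul]
      refine (mul_le_of_le_one_left (norm_nonneg _) hsin).trans ((norm_sub_le _ _).trans ?_)
      rw [norm_mul, norm_mul, norm_pow, norm_pow, norm_neg, mul_add]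
      gcongr
      · exact hC1 θ hθ'
      · exact hC2 θ hθ')
    (Eventually.of_forall fun θ _ => hsum)
    intervalIntegrable_const
    (Eventually.of_forall fun θ _ => by
      have e : ∀ w : ℂ, HasSum (fun p : ℕ => t ^ p / (p.factorial : ℂ) * w ^ p)
          (Complex.exp (t * w)) := fun w => by
        have := NormedSpace.expSeries_div_hasSum_exp (t * w)
        rw [← Complex.exp_eq_exp_ℂ] at this
        refine (congrArg (HasSum · _) (funext fun p => ?_)).mpr this
        rw [mul_pow]
        ring
      have := (((e (Complex.I * ((z - 2 * Real.cos θ : ℝ) : ℂ))).mul_right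
        (k (circlePt θ) (innerRoot z θ))).sub
        ((e (-(Complex.I * ((z - 2 * Real.cos θ : ℝ) : ℂ)))).mul_right
        (k (innerRoot z θ) (circlePt θ)))).mul_left (Real.sin θ : ℂ)
      refine (congrArg (HasSum · _) (funext fun p => ?_)).mpr this
      ring)
  have h2 := h.mul_left (Real.pi : ℂ)⁻¹
  unfold specInt
  refine (congrArg (HasSum · _) (funext fun p => ?_)).mpr h2
  rw [intervalIntegral.integral_const_mul]
  ring

end

/-! ### Spectral vectors -/

section

variable (m n c c' : ℂ)

/-- The component along `(1, i)` of the resolvent applied to `δ_y (c (1, i) + c' (1, -i))`. -/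
def resKernelPlus (x y : ℤ) (r s : ℂ) : ℂ :=
  -Complex.I * c * diagKernel m n x y r s + Complex.I * c' * offKernel m n x y r s

/-- The component along `(1, -i)` of the resolvent applied to `δ_y (c (1, i) + c' (1, -i))`. -/
def resKernelMinus (x y : ℤ) (r s : ℂ) : ℂ :=
  Complex.I * c' * diagKernel m n x y s r + -Complex.I * c * offKernel m n x y s r

variable {m n c c'}

theorem resKernelPlus_recurrence {r s z l : ℂ} (hr : r ≠ 0) (hr2 : 1 - r ^ 2 ≠ 0)
    (hD : resDet m n r s ≠ 0) (hz : r + r⁻¹ = z + Complex.I * l) (x y : ℤ) :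
    Complex.I * (z * resKernelPlus m n c c' x y r s - resKernelPlus m n c c' (x + 1) y r s -
      resKernelPlus m n c c' (x - 1) y r s - (if x = 0 then m * resKernelPlus m n c c' 0 y r s +
        n * resKernelMinus m n c c' 0 y r s else 0))
      = l * resKernelPlus m n c c' x y r s + (if x = y then c else 0) := by
  have h1 := diagKernel_recurrence hr hr2 hD x y
  have h2 := offKernel_recurrence (m := m) (n := n) (r := s) hr x y
  rw [hz] at h1 h2
  unfold resKernelPlus resKernelMinus
  have hI := Complex.I_mul_I
  have h3 : (if x = y then c else 0) = c * (if x = y then 1 else 0) := by split_ifs <;> ring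
  rw [h3, ← h1]
  by_cases hx : x = 0
  · simp only [hx, if_true] at h2 ⊢
    linear_combination (-c') * h2 + (-c * (z * diagKernel m n 0 y r s
      - diagKernel m n (0 + 1) y r s - diagKernel m n (0 - 1) y r s
      - (m * diagKernel m n 0 y r s + n * offKernel m n 0 y s r))
      + c' * (z * offKernel m n 0 y r s - offKernel m n (0 + 1) y r s - offKernel m n (0 - 1) y r s
      - (m * offKernel m n 0 y r s + n * diagKernel m n 0 y s r))) * hI
  · simp only [hx, if_false] at h2 ⊢
    linear_combination (-c') * h2 + (-c * (z * diagKernel m n x y r s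
      - diagKernel m n (x + 1) y r s - diagKernel m n (x - 1) y r s)
      + c' * (z * offKernel m n x y r s - offKernel m n (x + 1) y r s
      - offKernel m n (x - 1) y r s)) * hI

end

section

variable {m n c c' : ℂ}

/-- Exchanging (1, i) with (1, -i) amounts to exchanging r with s and l with -l, so the second row
of the resolvent equation follows from the first. -/
theorem resKernelMinus_eq (x y : ℤ) (r s : ℂ) :
    resKernelMinus m n c c' x y r s = -resKernelPlus m n c' c x y s r := by
  unfold resKernelMinus resKernelPlus; ring

theorem resKernelMinus_recurrence {r s z l : ℂ} (hs : s ≠ 0) (hs2 : 1 - s ^ 2 ≠ 0)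
    (hD : resDet m n r s ≠ 0) (hz : s + s⁻¹ = z - Complex.I * l) (x y : ℤ) :
    -Complex.I * (z * resKernelMinus m n c c' x y r s - resKernelMinus m n c c' (x + 1) y r s -
      resKernelMinus m n c c' (x - 1) y r s - (if x = 0 then m * resKernelMinus m n c c' 0 y r s +
        n * resKernelPlus m n c c' 0 y r s else 0))
      = l * resKernelMinus m n c c' x y r s + (if x = y then c' else 0) := by
  have h := resKernelPlus_recurrence (c := c') (c' := c) hs hs2
    (by rwa [resDet_symm] : resDet m n s r ≠ 0)
    (by rw [hz]; ring : s + s⁻¹ = z + Complex.I * (-l)) x y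
  have e : resKernelMinus m n c' c 0 y s r = -resKernelPlus m n c c' 0 y r s :=
    resKernelMinus_eq _ _ _ _
  rw [e] at h
  simp only [resKernelMinus_eq (c := c) (c' := c')]
  split_ifs at h ⊢ <;> linear_combination h

variable {z : ℝ} {g : ℂ → ℂ}

theorem specInt_combination {k1 k2 k3 k4 k5 : ℂ → ℂ → ℂ} (hg : Continuous g)
    (h1 : SpecContinuous z k1) (h2 : SpecContinuous z k2) (h3 : SpecContinuous z k3)
    (h4 : SpecContinuous z k4) (h5 : SpecContinuous z k5) (p w μ ν : ℂ) :
    specInt z g (fun r s => p * (w * k1 r s - k2 r s - k3 r s - (μ * k4 r s + ν * k5 r s))) =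
      p * (w * specInt z g k1 - specInt z g k2 - specInt z g k3 -
        (μ * specInt z g k4 + ν * specInt z g k5)) := by
  have e : (fun r s => p * (w * k1 r s - k2 r s - k3 r s - (μ * k4 r s + ν * k5 r s))) =
      fun r s => p * (w * k1 r s + ((-1) * k2 r s + ((-1) * k3 r s + (-μ * k4 r s + -ν * k5 r s)))) := by
    funext r s; ring
  rw [e, specInt_const_mul, specInt_add hg (h1.const_mul w) ((h2.const_mul _).add
    ((h3.const_mul _).add ((h4.const_mul _).add (h5.const_mul _)))),
    specInt_add hg (h2.const_mul _) ((h3.const_mul _).add ((h4.const_mul _).add (h5.const_mul _))),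
    specInt_add hg (h3.const_mul _) ((h4.const_mul _).add (h5.const_mul _)),
    specInt_add hg (h4.const_mul _) (h5.const_mul _)]
  simp only [specInt_const_mul]
  ring

theorem specContinuous_resKernelPlus (hz : 2 < |z|)
    (hD : ∀ θ, resDet m n (circlePt θ) (innerRoot z θ) ≠ 0) (x y : ℤ) :
    SpecContinuous z (resKernelPlus m n c c' x y) :=
  SpecContinuous.add (SpecContinuous.const_mul (continuous_diagKernel_circle hz hD x y) _)
    (SpecContinuous.const_mul (continuous_offKernel_circle hz hD x y) _)

theorem specContinuous_resKernelMinus (hz : 2 < |z|)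
    (hD : ∀ θ, resDet m n (circlePt θ) (innerRoot z θ) ≠ 0) (x y : ℤ) :
    SpecContinuous z (resKernelMinus m n c c' x y) :=
  SpecContinuous.add
    (SpecContinuous.const_mul (SpecContinuous.swap (continuous_diagKernel_circle hz hD x y)) _)
    (SpecContinuous.const_mul (SpecContinuous.swap (continuous_offKernel_circle hz hD x y)) _)

theorem one_sub_sq_ne_zero_of_norm_lt {r : ℂ} (h : ‖r‖ < 1) : 1 - r ^ 2 ≠ 0 := by
  intro h0
  have : ‖r ^ 2‖ = 1 := by rw [← sub_eq_zero.1 h0, norm_one]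
  rw [norm_pow] at this
  nlinarith [norm_nonneg r]

theorem one_sub_circlePt_sq_ne_zero {θ : ℝ} (h : Real.sin θ ≠ 0) : 1 - circlePt θ ^ 2 ≠ 0 := by
  intro h0
  have h1 : (1 - circlePt θ) * (1 + circlePt θ) = 0 := by rw [← h0]; ring
  apply h
  rcases mul_eq_zero.1 h1 with h2 | h2
  · have := congrArg Complex.im h2
    simpa [circlePt_eq] using this
  · have := congrArg Complex.im h2
    simpa [circlePt_eq] using this

theorem circlePt_add_inv' (z θ : ℝ) : circlePt θ + (circlePt θ)⁻¹ =
    z + Complex.I * (Complex.I * ((z - 2 * Real.cos θ : ℝ) : ℂ)) := by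
  rw [circlePt_add_inv]
  push_cast
  linear_combination (-(z : ℂ) + 2 * Complex.cos θ) * Complex.I_mul_I

theorem innerRoot_add_inv' (z θ : ℝ) : innerRoot z θ + (innerRoot z θ)⁻¹ =
    z - Complex.I * (Complex.I * ((z - 2 * Real.cos θ : ℝ) : ℂ)) := by
  rw [innerRoot_add_inv]
  push_cast
  linear_combination ((z : ℂ) - 2 * Complex.cos θ) * Complex.I_mul_I

theorem specInt_resKernelPlus_recurrence (hg : Continuous g) (hz : 2 < |z|)
    (hD : ∀ θ, resDet m n (circlePt θ) (innerRoot z θ) ≠ 0) (x y : ℤ) :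
    Complex.I * (z * specInt z g (resKernelPlus m n c c' x y) -
      specInt z g (resKernelPlus m n c c' (x + 1) y) -
      specInt z g (resKernelPlus m n c c' (x - 1) y) -
      (if x = 0 then m * specInt z g (resKernelPlus m n c c' 0 y) +
        n * specInt z g (resKernelMinus m n c c' 0 y) else 0))
      = specInt z (fun l => g l * l) (resKernelPlus m n c c' x y) := by
  have hite : ∀ A B : ℂ, (if x = 0 then m * A + n * B else 0)
      = (if x = 0 then m else 0) * A + (if x = 0 then n else 0) * B := fun A B => by
    split_ifs <;> ring
  rw [hite, ← specInt_combination hg (specContinuous_resKernelPlus hz hD _ _)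
    (specContinuous_resKernelPlus hz hD _ _) (specContinuous_resKernelPlus hz hD _ _)
    (specContinuous_resKernelPlus hz hD _ _) (specContinuous_resKernelMinus hz hD _ _)]
  simp only [← hite]
  refine specInt_eq_specInt_mul (c := if x = y then c else 0) hg
    (specContinuous_resKernelPlus hz hD _ _) (fun θ hs => ?_) (fun θ hs => ?_)
  · exact resKernelPlus_recurrence (circlePt_ne_zero θ) (one_sub_circlePt_sq_ne_zero hs) (hD θ)
      (circlePt_add_inv' z θ) x y
  · exact resKernelPlus_recurrence (innerRoot_ne_zero z θ)
      (one_sub_sq_ne_zero_of_norm_lt (norm_innerRoot_lt hz θ)) (by rw [resDet_symm]; exact hD θ)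
      (by rw [innerRoot_add_inv' z θ]; ring) x y

theorem specInt_resKernelMinus_recurrence (hg : Continuous g) (hz : 2 < |z|)
    (hD : ∀ θ, resDet m n (circlePt θ) (innerRoot z θ) ≠ 0) (x y : ℤ) :
    -Complex.I * (z * specInt z g (resKernelMinus m n c c' x y) -
      specInt z g (resKernelMinus m n c c' (x + 1) y) -
      specInt z g (resKernelMinus m n c c' (x - 1) y) -
      (if x = 0 then m * specInt z g (resKernelMinus m n c c' 0 y) +
        n * specInt z g (resKernelPlus m n c c' 0 y) else 0))
      = specInt z (fun l => g l * l) (resKernelMinus m n c c' x y) := by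
  have hite : ∀ A B : ℂ, (if x = 0 then m * A + n * B else 0)
      = (if x = 0 then m else 0) * A + (if x = 0 then n else 0) * B := fun A B => by
    split_ifs <;> ring
  rw [hite, ← specInt_combination hg (specContinuous_resKernelMinus hz hD _ _)
    (specContinuous_resKernelMinus hz hD _ _) (specContinuous_resKernelMinus hz hD _ _)
    (specContinuous_resKernelMinus hz hD _ _) (specContinuous_resKernelPlus hz hD _ _)]
  simp only [← hite]
  refine specInt_eq_specInt_mul (c := if x = y then c' else 0) hg
    (specContinuous_resKernelMinus hz hD _ _) (fun θ hs => ?_) (fun θ hs => ?_)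
  · exact resKernelMinus_recurrence (innerRoot_ne_zero z θ)
      (one_sub_sq_ne_zero_of_norm_lt (norm_innerRoot_lt hz θ)) (hD θ)
      (innerRoot_add_inv' z θ) x y
  · exact resKernelMinus_recurrence (circlePt_ne_zero θ) (one_sub_circlePt_sq_ne_zero hs)
      (by rw [resDet_symm]; exact hD θ) (by rw [circlePt_add_inv' z θ]; ring) x y

end

/-! ### The linearized operator in the eigenbasis of `j` -/

/-- The vector `α (1, i) + β (1, -i)`. -/
def siteVec (α β : ℂ) : Site := !₂[α + β, Complex.I * (α - β)]

theorem siteVec_surj (v : Site) :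
    v = siteVec ((v 0 - Complex.I * v 1) / 2) ((v 0 + Complex.I * v 1) / 2) := by
  have hI := Complex.I_mul_I
  ext i
  fin_cases i
  · simp [siteVec]; ring
  · simp [siteVec]; linear_combination v 1 * hI

theorem norm_siteVec_le (α β : ℂ) : ‖siteVec α β‖ ≤ 2 * (‖α‖ + ‖β‖) := by
  have h1 : ‖α + β‖ ≤ ‖α‖ + ‖β‖ := norm_add_le _ _
  have h2 : ‖α - β‖ ≤ ‖α‖ + ‖β‖ := norm_sub_le _ _
  have hp : 0 ≤ ‖α‖ + ‖β‖ := by positivity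
  rw [EuclideanSpace.norm_eq]
  refine Real.sqrt_le_iff.2 ⟨by positivity, ?_⟩
  simp only [siteVec, Fin.sum_univ_two]
  simp only [Matrix.cons_val_zero, Matrix.cons_val_one, norm_mul, Complex.norm_I,
    one_mul]
  nlinarith [norm_nonneg (α + β), norm_nonneg (α - β)]

theorem siteVec_add (α β α' β' : ℂ) :
    siteVec α β + siteVec α' β' = siteVec (α + α') (β + β') := by
  ext i
  fin_cases i <;> simp [siteVec] <;> ring

theorem siteVec_smul (l α β : ℂ) : l • siteVec α β = siteVec (l * α) (l * β) := by
  ext i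
  fin_cases i <;> simp [siteVec] <;> ring

theorem siteVec_eq_zero {α β : ℂ} (h : siteVec α β = 0) : α = 0 ∧ β = 0 := by
  have h0 := congrArg (fun v : Site => v 0) h
  have h1 := congrArg (fun v : Site => v 1) h
  simp [siteVec] at h0 h1
  have h2 := sub_eq_zero.1 h1
  subst h2
  constructor <;> linear_combination h0 / 2

theorem matJ_inv : matJ⁻¹ = !![0, 1; -1, 0] := by
  refine Matrix.inv_eq_right_inv ?_
  ext i j
  fin_cases i <;> fin_cases j <;> simp [matJ]

namespace SolitaryWave

variable (S : SolitaryWave)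

/-- `n = a'(C²) C²`. -/
def coupling : ℝ := S.a' * S.C ^ 2

/-- The decay factor `σ e^{-k}` of the solitary wave. -/
def rho : ℝ := S.σ * Real.exp (-S.k)

theorem _root_.siteMatrix_apply (M : Matrix (Fin 2) (Fin 2) ℂ) (v : Site) (i : Fin 2) :
    siteMatrix M v i = M i 0 * v 0 + M i 1 * v 1 := by
  rw [siteMatrix, Matrix.ofLp_toEuclideanCLM, Matrix.mulVec, dotProduct, Fin.sum_univ_two]

theorem couplingMatrix_eq : S.couplingMatrix =
    !![((S.a (S.C ^ 2) : ℝ) : ℂ) + 2 * S.coupling, 0; 0, ((S.a (S.C ^ 2) : ℝ) : ℂ)] := by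
  ext i j
  fin_cases i <;> fin_cases j <;> simp [couplingMatrix, matP1, coupling]
  ring

/-- j⁻¹ acts as i and -i on (1, i) and (1, -i), while P₁ maps each of them to half their sum. The
coupling therefore has diagonal entries m = a + a'C² and off-diagonal entries n = a'C², the
parameters of the kernels. -/
theorem exprC_siteVec (f g : ℤ → ℂ) (x : ℤ) :
    S.exprC (fun x => siteVec (f x) (g x)) x =
      siteVec (Complex.I * (((S.ω + 2 : ℝ) : ℂ) * f x - f (x + 1) - f (x - 1) -
          (if x = 0 then (((S.a (S.C ^ 2) : ℝ) : ℂ) + S.coupling) * f 0 + S.coupling * g 0 else 0)))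
        (-Complex.I * (((S.ω + 2 : ℝ) : ℂ) * g x - g (x + 1) - g (x - 1) -
          (if x = 0 then (((S.a (S.C ^ 2) : ℝ) : ℂ) + S.coupling) * g 0 + S.coupling * f 0 else 0))) := by
  have hI := Complex.I_mul_I
  unfold exprC
  rw [matJ_inv, couplingMatrix_eq]
  ext i
  by_cases hx : x = 0
  · fin_cases i
    · simp [hx, siteVec, siteMatrix_apply, -Matrix.toEuclideanCLM_toLp]
      ring
    · simp [hx, siteVec, siteMatrix_apply, -Matrix.toEuclideanCLM_toLp]
      linear_combination (f (-1) + g (-1) + f 1 + g 1 + (S.a (S.C ^ 2) - S.ω - 2 + 2 * S.coupling) *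
        (f 0 + g 0)) * hI
  · fin_cases i
    · simp [hx, siteVec, siteMatrix_apply, -Matrix.toEuclideanCLM_toLp]
      ring
    · simp [hx, siteVec, siteMatrix_apply, -Matrix.toEuclideanCLM_toLp]
      linear_combination (f (x - 1) + g (x - 1) + f (x + 1) + g (x + 1) - (S.ω + 2) *
        (f x + g x)) * hI

theorem rho_ne_zero : S.rho ≠ 0 := by
  unfold rho
  rcases S.σ_eq with h | h <;> simp [h]

theorem abs_rho_lt : |S.rho| < 1 := by
  unfold rho
  have h1 : |S.σ| = 1 := by rcases S.σ_eq with h | h <;> simp [h]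
  rw [abs_mul, h1, one_mul, Real.abs_exp]
  exact Real.exp_lt_one_iff.2 (by linarith [S.k_pos])

theorem rho_inv : S.rho⁻¹ = S.σ * Real.exp S.k := by
  unfold rho
  have h1 : S.σ⁻¹ = S.σ := by rcases S.σ_eq with h | h <;> simp [h]
  rw [mul_inv, h1, ← Real.exp_neg, neg_neg]

theorem omega_add_two : S.ω + 2 = S.rho + S.rho⁻¹ := by
  rw [rho_inv, rho, show S.ω = S.σ * (2 * Real.cosh S.k) - 2 from rfl, Real.cosh_eq]
  ring

theorem a_eq : S.a (S.C ^ 2) = S.rho⁻¹ - S.rho := by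
  have hσ : S.σ * S.σ = 1 := by rcases S.σ_eq with h | h <;> simp [h]
  have h := S.sinh_k
  rw [Real.sinh_eq] at h
  rw [rho_inv, rho]
  linear_combination (-S.a (S.C ^ 2)) * hσ - 2 * S.σ * h

theorem coupling_ne_zero (h : S.a' ≠ 0) : S.coupling ≠ 0 :=
  mul_ne_zero h (pow_ne_zero _ S.C_pos.ne')

/-- Since (ρ + ρ⁻¹)² = a² + 4, the numerator of `detCoeff` is 4a'C² - 4a - a³. -/
theorem detCoeff_ne_zero (h : S.a' ≠ (4 * S.a (S.C ^ 2) + S.a (S.C ^ 2) ^ 3) / (4 * S.C ^ 2)) :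
    detCoeff S.rho S.coupling ≠ 0 := by
  have hC : S.C ≠ 0 := S.C_pos.ne'
  have ha := inv_sub_ne_zero S.rho_ne_zero S.abs_rho_lt
  unfold detCoeff
  refine div_ne_zero (fun h0 => h ?_) (pow_ne_zero _ ha)
  have hr := S.rho_ne_zero
  have e : (S.rho + S.rho⁻¹) ^ 2 = (S.rho⁻¹ - S.rho) ^ 2 + 4 := by
    field_simp; ring
  rw [e, ← S.a_eq, coupling] at h0
  rw [eq_div_iff (by positivity)]
  linear_combination h0

end SolitaryWave

/-! ### Absence of zeros of the determinant -/

/-- Here s is real, because s + 1/s is real of modulus greater than 2. The determinant vanishes iff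
(r⁻¹ - r - m)(s⁻¹ - s - m) = n², and r⁻¹ is the conjugate of r. The imaginary part gives Im r = 0
unless the real factor vanishes, which n ≠ 0 excludes. There are thus no zeros inside the continuous
spectrum, only possibly at its edges. -/
theorem eq_one_or_neg_one_of_resDet_eq_zero {m n z : ℝ} {r s : ℂ} (hn : n ≠ 0) (hz : 2 < |z|)
    (hr : ‖r‖ = 1) (hs0 : s ≠ 0) (hs : s + s⁻¹ = ((2 * z - 2 * r.re : ℝ) : ℂ))
    (hD : resDet m n r s = 0) : r = 1 ∨ r = -1 := by
  have hr0 : r ≠ 0 := by rintro rfl; simp at hr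
  have hre : |r.re| ≤ 1 := hr ▸ Complex.abs_re_le_norm r
  have hs1 : ‖s‖ ≠ 1 := fun h => by
    rw [add_inv_of_norm_one h] at hs
    have h1 := Complex.ofReal_injective hs
    have h2 : |s.re| ≤ 1 := h ▸ Complex.abs_re_le_norm s
    rw [abs_le] at hre h2
    rcases lt_abs.1 hz with h | h <;> linarith
  have hsr : (starRingEnd ℂ) s = s := by
    have h1 := congrArg (starRingEnd ℂ) hs
    rw [Complex.conj_ofReal, ← hs, map_add, map_inv₀] at h1
    have hc0 : (starRingEnd ℂ) s ≠ 0 := by simpa using hs0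
    have h2 : ((starRingEnd ℂ) s - s) * (s * (starRingEnd ℂ) s - 1) = 0 := by
      field_simp at h1
      linear_combination h1
    rcases mul_eq_zero.1 h2 with h3 | h3
    · exact sub_eq_zero.1 h3
    · exfalso
      rw [Complex.mul_conj, Complex.normSq_eq_norm_sq] at h3
      have h4 : ‖s‖ ^ 2 = 1 := by exact_mod_cast sub_eq_zero.1 h3
      exact hs1 (by nlinarith [norm_nonneg s])
  obtain ⟨s', rfl⟩ : ∃ s' : ℝ, s = s' := ⟨s.re, (Complex.conj_eq_iff_re.1 hsr).symm⟩
  have hs0' : s' ≠ 0 := by exact_mod_cast hs0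
  have hinv : r⁻¹ = (starRingEnd ℂ) r := by
    rw [Complex.inv_def, Complex.normSq_eq_norm_sq, hr]; simp
  have h1 : (r⁻¹ - r - m) * ((s'⁻¹ - s' - m : ℝ) : ℂ) = ((n ^ 2 : ℝ) : ℂ) := by
    unfold resDet at hD
    push_cast
    field_simp
    linear_combination hD
  rw [hinv] at h1
  have h2 := congrArg Complex.im h1
  simp only [Complex.im_mul_ofReal, Complex.sub_im, Complex.conj_im, Complex.ofReal_im] at h2
  have him : r.im = 0 := by
    by_contra him
    have h3 : s'⁻¹ - s' - m = 0 := by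
      have : r.im * (s'⁻¹ - s' - m) = 0 := by linarith
      exact (mul_eq_zero.1 this).resolve_left him
    rw [h3] at h1
    have : n ^ 2 = 0 := by exact_mod_cast (by simpa using h1.symm : ((n : ℂ)) ^ 2 = 0)
    exact hn (by simpa using this)
  have hrr : r = (r.re : ℂ) := by
    apply Complex.ext <;> simp [him]
  have h5 : |r.re| = 1 := by
    rw [← hr]; conv_rhs => rw [hrr]
    rw [Complex.norm_real, Real.norm_eq_abs]
  rw [hrr]
  rcases eq_or_eq_neg_of_abs_eq h5 with h | h <;> rw [h] <;> simp

namespace SolitaryWave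

variable (S : SolitaryWave)

theorem two_lt_abs_omega : 2 < |S.ω + 2| := by
  rw [S.omega_add_two]
  exact two_lt_abs_add_inv S.rho_ne_zero S.abs_rho_lt

variable {S}

/-- When the determinant vanishes, (n, r⁻¹ - r - m) lies in the kernel of the matching matrix at the
site 0. Used as coefficients of r^{|x|} and s^{|x|}, its entries give a solution, nonzero because n
≠ 0; it is square summable or merely bounded according to the moduli of r and s. -/
theorem exists_solution_of_resDet_eq_zero (hn : S.coupling ≠ 0) {l r s : ℂ} (hr : r ≠ 0) (hs : s ≠ 0)
    (hr1 : r + r⁻¹ = ((S.ω + 2 : ℝ) : ℂ) + Complex.I * l)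
    (hs1 : s + s⁻¹ = ((S.ω + 2 : ℝ) : ℂ) - Complex.I * l)
    (hD : resDet (((S.a (S.C ^ 2) : ℝ) : ℂ) + S.coupling) S.coupling r s = 0) :
    ∃ u : ℤ → Site, ∃ A : ℝ, u ≠ 0 ∧ (∀ x, S.exprC u x = l • u x) ∧
      ∀ x, ‖u x‖ ≤ A * (‖r‖ ^ x.natAbs + ‖s‖ ^ x.natAbs) := by
  set m : ℂ := ((S.a (S.C ^ 2) : ℝ) : ℂ) + S.coupling with hm
  set n : ℂ := ((S.coupling : ℝ) : ℂ) with hn'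
  have hn0 : n ≠ 0 := by simpa [hn'] using hn
  have hI := Complex.I_mul_I
  refine ⟨fun x => siteVec (n * r ^ x.natAbs) ((r⁻¹ - r - m) * s ^ x.natAbs),
    2 * (‖n‖ + ‖r⁻¹ - r - m‖), fun h => ?_, fun x => ?_, fun x => ?_⟩
  · have := siteVec_eq_zero (congrFun h 0)
    simp [hn0] at this
  · rw [S.exprC_siteVec, siteVec_smul, ← hm, ← hn']
    have e1 := pow_natAbs_recurrence hr x
    have e2 := pow_natAbs_recurrence hs x
    have e3 : (r⁻¹ - r - m) * (s⁻¹ - s - m) = n ^ 2 := by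
      unfold resDet at hD
      field_simp
      linear_combination hD
    congr 1
    · rw [hr1] at e1
      split_ifs at e1 ⊢ with hx
      · subst hx
        simp at e1 ⊢
        linear_combination Complex.I * n * e1 - l * n * hI
      · linear_combination Complex.I * n * e1 - l * n * r ^ x.natAbs * hI
    · rw [hs1] at e2
      split_ifs at e2 ⊢ with hx
      · subst hx
        simp at e2 ⊢
        linear_combination -Complex.I * (r⁻¹ - r - m) * e2 - l * (r⁻¹ - r - m) * hI - Complex.I * e3
      · linear_combination -Complex.I * (r⁻¹ - r - m) * e2 - l * (r⁻¹ - r - m) * s ^ x.natAbs * hI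
  · refine (norm_siteVec_le _ _).trans ?_
    rw [norm_mul, norm_mul, norm_pow, norm_pow]
    have h1 : 0 ≤ ‖n‖ * ‖s‖ ^ x.natAbs := by positivity
    have h2 : 0 ≤ ‖r⁻¹ - r - m‖ * ‖r‖ ^ x.natAbs := by positivity
    linarith

theorem resDet_ne_zero_of_norm_lt (hSP : S.SpectralCondition) {l r s : ℂ} (hl : l ≠ 0)
    (hr : r ≠ 0) (hs : s ≠ 0)
    (hr1 : r + r⁻¹ = ((S.ω + 2 : ℝ) : ℂ) + Complex.I * l)
    (hs1 : s + s⁻¹ = ((S.ω + 2 : ℝ) : ℂ) - Complex.I * l) (hr2 : ‖r‖ < 1) (hs2 : ‖s‖ < 1) :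
    resDet (((S.a (S.C ^ 2) : ℝ) : ℂ) + S.coupling) S.coupling r s ≠ 0 := by
  intro hD
  obtain ⟨u, A, hu0, hu, hb⟩ :=
    exists_solution_of_resDet_eq_zero (S.coupling_ne_zero hSP.a'_ne_zero) hr hs hr1 hs1 hD
  have h1 : Memℓp u 1 := by
    refine memℓp_gen ?_
    have e1 := summable_weight (norm_nonneg r) hr2 A 0
    have e2 := summable_weight (norm_nonneg s) hs2 A 0
    refine Summable.of_nonneg_of_le (fun x => by positivity) (fun x => ?_) (e1.add e2)
    have := hb x
    simp
    linarith
  have h2 : Memℓp u 2 := h1.of_exponent_ge (by norm_num)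
  refine hl (hSP.eigenvalue_eq_zero l ?_)
  refine Module.End.hasEigenvalue_of_hasEigenvector (x := (⟨u, h2⟩ : LatL2)) ⟨?_, ?_⟩
  · rw [Module.End.mem_eigenspace_iff]
    refine Subtype.ext (funext fun x => ?_)
    exact (S.opC_apply ⟨u, h2⟩ x).trans (hu x)
  · exact fun h => hu0 (congrArg Subtype.val h)

theorem resDet_ne_zero_of_mem_edges (hSP : S.SpectralCondition)
    (hres : ∀ lam ∈ S.edges, ¬ S.IsResonance lam) {l r s : ℂ} (hl : l ∈ S.edges)
    (hr : r ≠ 0) (hs : s ≠ 0)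
    (hr1 : r + r⁻¹ = ((S.ω + 2 : ℝ) : ℂ) + Complex.I * l)
    (hs1 : s + s⁻¹ = ((S.ω + 2 : ℝ) : ℂ) - Complex.I * l) (hr2 : ‖r‖ ≤ 1) (hs2 : ‖s‖ ≤ 1) :
    resDet (((S.a (S.C ^ 2) : ℝ) : ℂ) + S.coupling) S.coupling r s ≠ 0 := by
  intro hD
  obtain ⟨u, A, hu0, hu, hb⟩ :=
    exists_solution_of_resDet_eq_zero (S.coupling_ne_zero hSP.a'_ne_zero) hr hs hr1 hs1 hD
  refine hres l hl ⟨u, hu0, ⟨|A| * 2, fun x => (hb x).trans ?_⟩, hu⟩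
  have e1 := pow_le_one₀ (n := x.natAbs) (norm_nonneg r) hr2
  have e2 := pow_le_one₀ (n := x.natAbs) (norm_nonneg s) hs2
  exact mul_le_mul (le_abs_self A) (by linarith) (by positivity) (abs_nonneg A)

/-- The resolvent kernel has no pole in the closed half plane except at the origin. -/
theorem resDet_ne_zero (hSP : S.SpectralCondition)
    (hres : ∀ lam ∈ S.edges, ¬ S.IsResonance lam) {l : ℂ} (hl : l ∈ puncturedHalfPlane) :
    resDet (((S.a (S.C ^ 2) : ℝ) : ℂ) + S.coupling) S.coupling
      (resPlus (S.ω + 2 : ℝ) l) (resMinus (S.ω + 2 : ℝ) l) ≠ 0 := by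
  have hI := Complex.I_mul_I
  have hr : resPlus (S.ω + 2 : ℝ) l ≠ 0 := joukInv_ne_zero _
  have hs : resMinus (S.ω + 2 : ℝ) l ≠ 0 := neg_ne_zero.2 (joukInv_ne_zero _)
  have hr1 := resPlus_add_inv (S.ω + 2 : ℝ) l
  have hs1 := resMinus_add_inv (S.ω + 2 : ℝ) l
  have hr2 : ‖resPlus (S.ω + 2 : ℝ) l‖ ≤ 1 :=
    norm_joukInv_le (by simpa using hl.1)
  have hs2 : ‖resMinus (S.ω + 2 : ℝ) l‖ ≤ 1 :=
    (norm_neg _).trans_le (norm_joukInv_le (by simpa using hl.1))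
  have hn := S.coupling_ne_zero hSP.a'_ne_zero
  generalize resPlus (S.ω + 2 : ℝ) l = r at *
  generalize resMinus (S.ω + 2 : ℝ) l = s at *
  intro hD
  -- A unimodular r puts l at i(z - 2 Re r), so r = 1 and r = -1 are the edges iω and i(ω + 4). A
  -- unimodular s gives their negatives. Otherwise both roots lie inside the disc and the zero would
  -- be an eigenvalue.
  by_cases h1 : ‖r‖ = 1
  · have e := add_inv_of_norm_one h1
    have hl' : l = Complex.I * ((S.ω + 2 - 2 * r.re : ℝ) : ℂ) := by
      rw [hr1] at e
      push_cast at e ⊢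
      linear_combination -Complex.I * e + l * hI
    have := eq_one_or_neg_one_of_resDet_eq_zero (m := S.a (S.C ^ 2) + S.coupling) hn
      S.two_lt_abs_omega h1 hs (by
        rw [hs1, hl']; push_cast
        linear_combination (-(S.ω : ℂ) - 2 + 2 * r.re) * hI) (by push_cast; exact hD)
    refine resDet_ne_zero_of_mem_edges hSP hres ?_ hr hs hr1 hs1 hr2 hs2 hD
    rcases this with rfl | rfl
    · exact Or.inl (by rw [hl']; simp)
    · exact Or.inr (Or.inr (Or.inl (by rw [hl']; push_cast; simp; ring)))
  · by_cases h2 : ‖s‖ = 1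
    · have e := add_inv_of_norm_one h2
      have hl' : l = -(Complex.I * ((S.ω + 2 - 2 * s.re : ℝ) : ℂ)) := by
        rw [hs1] at e
        push_cast at e ⊢
        linear_combination Complex.I * e + l * hI
      have := eq_one_or_neg_one_of_resDet_eq_zero (m := S.a (S.C ^ 2) + S.coupling) hn
        S.two_lt_abs_omega h2 hr (by
          rw [hr1, hl']; push_cast
          linear_combination (-(S.ω : ℂ) - 2 + 2 * s.re) * hI)
        (by push_cast; rw [resDet_symm]; exact hD)
      refine resDet_ne_zero_of_mem_edges hSP hres ?_ hr hs hr1 hs1 hr2 hs2 hD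
      rcases this with rfl | rfl
      · exact Or.inr (Or.inl (by rw [hl']; simp))
      · exact Or.inr (Or.inr (Or.inr (by rw [Set.mem_singleton_iff, hl']; push_cast; simp; ring)))
    · exact resDet_ne_zero_of_norm_lt hSP hl.2 hr hs hr1 hs1 (lt_of_le_of_ne hr2 h1)
        (lt_of_le_of_ne hs2 h2) hD

theorem resDet_circle_ne_zero' (hSP : S.SpectralCondition)
    (hres : ∀ lam ∈ S.edges, ¬ S.IsResonance lam) (θ : ℝ) :
    resDet (((S.a (S.C ^ 2) : ℝ) : ℂ) + S.coupling) S.coupling (circlePt θ)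
      (innerRoot (S.ω + 2) θ) ≠ 0 :=
  resDet_circle_ne_zero S.two_lt_abs_omega (fun _ hl => resDet_ne_zero hSP hres hl) θ

end SolitaryWave

/-! ### Spectral representation of the group -/

namespace SolitaryWave

variable (S : SolitaryWave)

/-- The lattice function whose components in the eigenbasis of `j` are the spectral integrals of `g`
against the two rows of the resolvent kernel. -/
def specVec (g : ℂ → ℂ) (c c' : ℂ) (y x : ℤ) : Site :=
  siteVec
    (specInt (S.ω + 2) g
      (resKernelPlus (((S.a (S.C ^ 2) : ℝ) : ℂ) + S.coupling) S.coupling c c' x y))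
    (specInt (S.ω + 2) g
      (resKernelMinus (((S.a (S.C ^ 2) : ℝ) : ℂ) + S.coupling) S.coupling c c' x y))

variable {S}

theorem exprC_specVec (hSP : S.SpectralCondition) (hres : ∀ lam ∈ S.edges, ¬ S.IsResonance lam)
    {g : ℂ → ℂ} (hg : Continuous g) (c c' : ℂ) (y x : ℤ) :
    S.exprC (S.specVec g c c' y) x = S.specVec (fun l => g l * l) c c' y x := by
  have hD := resDet_circle_ne_zero' hSP hres
  unfold specVec
  rw [S.exprC_siteVec, specInt_resKernelPlus_recurrence hg S.two_lt_abs_omega hD,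
    specInt_resKernelMinus_recurrence hg S.two_lt_abs_omega hD]

theorem opC_pow_apply (hSP : S.SpectralCondition) (hres : ∀ lam ∈ S.edges, ¬ S.IsResonance lam)
    {c c' : ℂ} {y : ℤ} {χ : LatL2} (hχ : ∀ x, χ x = S.specVec (fun _ => 1) c c' y x) (p : ℕ) :
    ∀ x, (S.opC ^ p) χ x = S.specVec (fun l => l ^ p) c c' y x := by
  induction p with
  | zero => simpa using hχ
  | succ p ih =>
    intro x
    rw [pow_succ', mul_apply_eq_comp, S.opC_apply,
      show (((S.opC ^ p) χ : LatL2) : ℤ → Site) = S.specVec (fun l => l ^ p) c c' y from funext ih,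
      exprC_specVec hSP hres (by fun_prop)]
    simp only [pow_succ]

theorem siteVec_eq (α β : ℂ) : siteVec α β = α • siteVec 1 0 + β • siteVec 0 1 := by
  rw [siteVec_smul, siteVec_smul, siteVec_add]; simp

theorem hasSum_group_apply (t : ℝ) (χ : LatL2) :
    HasSum (fun p : ℕ => ((t : ℂ) ^ p / (p.factorial : ℂ)) • (S.opC ^ p) χ) (S.group t χ) := by
  have h := NormedSpace.exp_series_hasSum_exp' (𝕂 := ℂ) ((t : ℂ) • S.opC)
  have h1 := h.mapL (ContinuousLinearMap.apply ℂ LatL2 χ)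
  refine (congrArg (HasSum · _) (funext fun p => ?_)).mpr h1
  rw [ContinuousLinearMap.apply_apply, smul_apply, smul_pow, smul_apply, smul_smul, div_eq_inv_mul]

/-- The spectral representation of the dynamical group. -/
theorem group_apply (hSP : S.SpectralCondition) (hres : ∀ lam ∈ S.edges, ¬ S.IsResonance lam)
    {c c' : ℂ} {y : ℤ} {χ : LatL2} (hχ : ∀ x, χ x = S.specVec (fun _ => 1) c c' y x) (t : ℝ)
    (x : ℤ) : S.group t χ x = S.specVec (fun l => Complex.exp (t * l)) c c' y x := by
  have hD := resDet_circle_ne_zero' hSP hres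
  have h1 := (hasSum_group_apply (S := S) t χ).mapL (lp.evalCLM ℂ (fun _ : ℤ => Site) 2 x)
  have h2 := hasSum_specInt_exp (specContinuous_resKernelPlus (c := c) (c' := c')
    S.two_lt_abs_omega hD x y) t
  have h3 := hasSum_specInt_exp (specContinuous_resKernelMinus (c := c) (c' := c')
    S.two_lt_abs_omega hD x y) t
  have h4 := (h2.smul_const (siteVec 1 0)).add (h3.smul_const (siteVec 0 1))
  rw [← siteVec_eq] at h4
  refine h1.unique ?_
  refine (congrArg (HasSum · _) (funext fun p => ?_)).mpr h4
  rw [map_smul, mul_smul, mul_smul, ← smul_add, ← siteVec_eq]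
  exact congrArg _ (opC_pow_apply hSP hres hχ p x)

/-- The delta comes from large l, the other term from the pole at 0. The profiles ρ^{|x|}(ω + 2 -
2n|x|) and ρ^{|x|} in its components are ∂_ωψ_ω and ψ_ω up to constants, so this term lies in the
generalized null space. -/
theorem specVec_one (hSP : S.SpectralCondition) (hres : ∀ lam ∈ S.edges, ¬ S.IsResonance lam)
    (c c' : ℂ) (y x : ℤ) : S.specVec (fun _ => 1) c c' y x =
      (if x = y then siteVec c c' else 0) +
      !₂[(c + c') * ((S.rho ^ y.natAbs / (S.a (S.C ^ 2) * detCoeff S.rho S.coupling) *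
          (S.rho ^ x.natAbs * (S.ω + 2 - 2 * S.coupling * x.natAbs)) : ℝ) : ℂ),
        Complex.I * (c - c') * ((S.rho ^ y.natAbs * (S.ω + 2 - 2 * S.coupling * y.natAbs) /
          (S.a (S.C ^ 2) * detCoeff S.rho S.coupling) * S.rho ^ x.natAbs : ℝ) : ℂ)] := by
  have hD := resDet_circle_ne_zero' hSP hres
  have hz := S.two_lt_abs_omega
  have hE := S.detCoeff_ne_zero hSP.a'_ne
  have hd := fun l hl => resDet_ne_zero hSP hres (l := l) hl
  have hI := Complex.I_mul_I
  have k1 := continuous_diagKernel_circle hz hD x y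
  have k2 := continuous_offKernel_circle hz hD x y
  unfold specVec resKernelPlus resKernelMinus
  rw [specInt_add (by fun_prop) (SpecContinuous.const_mul k1 _) (SpecContinuous.const_mul k2 _),
    specInt_add (by fun_prop) (SpecContinuous.const_mul (SpecContinuous.swap k1) _)
      (SpecContinuous.const_mul (SpecContinuous.swap k2) _)]
  simp only [specInt_const_mul, specInt_swap]
  have ha := inv_sub_ne_zero S.rho_ne_zero S.abs_rho_lt
  rw [← S.a_eq] at ha
  have e1 := specInt_one_diagKernel (n := S.coupling) S.rho_ne_zero S.abs_rho_lt hE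
    (by rw [← S.a_eq, ← S.omega_add_two]; exact hd) x y
  have e2 := specInt_one_offKernel (n := S.coupling) S.rho_ne_zero S.abs_rho_lt hE
    (by rw [← S.a_eq, ← S.omega_add_two]; exact hd) x y
  rw [← S.a_eq, ← S.omega_add_two] at e1 e2
  have e3 : ∀ P Q : ℂ, -Complex.I * c * (Complex.I * P) + Complex.I * c' * (-Complex.I * Q) =
      c * P + c' * Q := fun P Q => by linear_combination (-(c * P) - c' * Q) * hI
  have e4 : ∀ P Q : ℂ, Complex.I * c' * -(Complex.I * P) + -Complex.I * c * -(-Complex.I * Q) =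
      c' * P + c * Q := fun P Q => by linear_combination (-(c' * P) - c * Q) * hI
  rw [e1, e2, e3, e4]
  have ha' : ((S.a (S.C ^ 2) : ℝ) : ℂ) ≠ 0 := by exact_mod_cast ha
  have hE' : ((detCoeff S.rho S.coupling : ℝ) : ℂ) ≠ 0 := by exact_mod_cast hE
  ext i
  fin_cases i
  · split_ifs
    · simp [siteVec, pow_add]
      field_simp
      ring
    · simp [siteVec, pow_add]
      field_simp
      ring
  · split_ifs
    · simp [siteVec, pow_add]
      field_simp
      ring
    · simp [siteVec, pow_add]
      field_simp
      ring

end SolitaryWave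

/-! ### The generalized null space -/

theorem hasSum_int_natAbs {f : ℕ → ℝ} {A : ℝ} (hf : HasSum f A) :
    HasSum (fun x : ℤ => f x.natAbs) (2 * A - f 0) := by
  rw [two_mul]
  exact HasSum.of_nat_of_neg (f := fun x : ℤ => f x.natAbs) (by simpa using hf)
    (by simpa using hf)

theorem hasSum_geometric_int {R : ℝ} (h : |R| < 1) (A B : ℝ) :
    HasSum (fun x : ℤ => R ^ x.natAbs * (A - B * x.natAbs))
      (A * (1 + R) / (1 - R) - B * (2 * R / (1 - R) ^ 2)) := by
  have hR : 1 - R ≠ 0 := by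
    have := (abs_lt.1 h).2
    linarith
  have h1 := hasSum_geometric_of_abs_lt_one h
  have h2 := hasSum_coe_mul_geometric_of_norm_lt_one (r := R) (by simpa using h)
  have h3 := hasSum_int_natAbs ((h1.mul_left A).sub (h2.mul_left B))
  convert h3 using 1
  · funext x
    ring
  · field_simp
    simp
    ring

namespace SolitaryWave

variable (S : SolitaryWave)

theorem a_ne_zero : S.a (S.C ^ 2) ≠ 0 := by
  rw [S.a_eq]; exact inv_sub_ne_zero S.rho_ne_zero S.abs_rho_lt

theorem omega_add_two_ne_zero : S.ω + 2 ≠ 0 := by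
  have h := S.two_lt_abs_omega
  intro h0
  rw [h0, abs_zero] at h
  linarith

theorem ψ_eq (x : ℤ) : S.ψ x = S.C * S.rho ^ x.natAbs := by
  rw [rho, mul_pow, ← Real.exp_nat_mul, ψ, waveProfile, mul_assoc]
  congr 3
  change -(S.k * _) = _
  ring

theorem hasDerivAt_decayRate :
    HasDerivAt (decayRate S.a S.σ) (2 * S.a' * S.C / (S.ω + 2)) S.C := by
  have hσ : S.σ * S.σ = 1 := by rcases S.σ_eq with h | h <;> simp [h]
  have ha : HasDerivAt S.a S.a' (S.C ^ 2) :=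
    (S.contDiff_a.differentiable (by norm_num) _).hasDerivAt
  have h1 : HasDerivAt (fun c : ℝ => S.σ * S.a (c ^ 2) / 2) (S.σ * (S.a' * (2 * S.C)) / 2) S.C := by
    have := ((HasDerivAt.comp (h₂ := S.a) (h := fun c => c ^ 2) S.C ha (hasDerivAt_pow 2 S.C)).const_mul S.σ).div_const 2
    simpa using this
  refine ((Real.hasDerivAt_arsinh _).comp S.C h1).congr_deriv ?_
  rw [← Real.cosh_arsinh]
  change (Real.cosh S.k)⁻¹ * _ = _
  have h2 : S.ω + 2 = S.σ * (2 * Real.cosh S.k) := by simp [ω, waveFrequency, k]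
  have h3 : Real.cosh S.k ≠ 0 := (Real.cosh_pos _).ne'
  have h4 : S.σ ≠ 0 := by rcases S.σ_eq with h | h <;> simp [h]
  rw [h2]
  field_simp
  linear_combination S.a' * S.C * hσ

theorem deriv_waveFrequency :
    deriv (waveFrequency S.a S.σ) S.C = 2 * S.a (S.C ^ 2) * S.a' * S.C / (S.ω + 2) := by
  have hσ : S.σ * S.σ = 1 := by rcases S.σ_eq with h | h <;> simp [h]
  have h := ((S.hasDerivAt_decayRate.cosh.const_mul 2).const_mul S.σ).sub_const 2
  refine h.deriv.trans ?_
  change S.σ * (2 * (Real.sinh S.k * _)) = _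
  rw [S.sinh_k]
  linear_combination S.a (S.C ^ 2) * (2 * S.a' * S.C / (S.ω + 2)) * hσ

theorem dψ_eq (h : S.a' ≠ 0) (x : ℤ) : S.dψ x = (2 * S.a (S.C ^ 2) * S.a' * S.C)⁻¹ *
    (S.rho ^ x.natAbs * (S.ω + 2 - 2 * S.coupling * x.natAbs)) := by
  have hd : HasDerivAt (fun c => waveProfile S.a S.σ c x)
      (S.σ ^ x.natAbs * ((1 - S.C * (2 * S.a' * S.C / (S.ω + 2)) * (x.natAbs : ℝ)) *
        Real.exp (-(S.k * (x.natAbs : ℝ))))) S.C := by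
    unfold waveProfile
    have h2 := ((S.hasDerivAt_decayRate.mul_const (x.natAbs : ℝ)).neg).exp
    have h3 := ((hasDerivAt_id S.C).mul_const (S.σ ^ x.natAbs)).mul h2
    refine h3.congr_deriv ?_
    simp only [k, id, Pi.neg_apply]
    ring
  have hz := S.omega_add_two_ne_zero
  have ha := S.a_ne_zero
  have hC := S.C_pos.ne'
  have e : Real.exp (-(S.k * (x.natAbs : ℝ))) = Real.exp (-S.k) ^ x.natAbs := by
    rw [← Real.exp_nat_mul]; congr 1; ring
  rw [dψ, hd.deriv, S.deriv_waveFrequency, e, rho, mul_pow, coupling]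
  field_simp

/-- `j Φ_ω = (0, ψ_ω)`. -/
def jΦ : LatL2 := latMatrix matJ S.Φ

theorem Φ_apply (x : ℤ) : S.Φ x = !₂[(S.ψ x : ℂ), 0] := rfl

theorem dΦ_apply (x : ℤ) : S.dΦ x = !₂[(S.dψ x : ℂ), 0] := rfl

theorem siteMatrix_matJ (a b : ℂ) : siteMatrix matJ !₂[a, b] = !₂[-b, a] := by
  ext i
  fin_cases i <;> simp [siteMatrix_apply, matJ, -Matrix.toEuclideanCLM_toLp]

theorem jΦ_apply (x : ℤ) : S.jΦ x = !₂[0, (S.ψ x : ℂ)] := by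
  change siteMatrix matJ (S.Φ x) = _
  rw [Φ_apply, siteMatrix_matJ, neg_zero]

theorem jdΦ_apply (x : ℤ) : latMatrix matJ S.dΦ x = !₂[0, (S.dψ x : ℂ)] := by
  change siteMatrix matJ (S.dΦ x) = _
  rw [dΦ_apply, siteMatrix_matJ, neg_zero]

theorem opC_jΦ : S.opC S.jΦ = 0 := by
  refine Subtype.ext (funext fun x => ?_)
  rw [S.opC_apply]
  change _ = (0 : Site)
  unfold exprC
  rw [matJ_inv, couplingMatrix_eq]
  simp only [jΦ_apply]
  have h := S.stationary x
  rw [S.ψ_zero] at h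
  have h' := congrArg (fun a : ℝ => (a : ℂ)) h
  ext i
  fin_cases i
  · by_cases hx : x = 0
    · simp [hx, siteMatrix_apply, -Matrix.toEuclideanCLM_toLp, S.ψ_zero] at h' ⊢
      linear_combination -h'
    · simp [hx, siteMatrix_apply, -Matrix.toEuclideanCLM_toLp] at h' ⊢
      linear_combination -h'
  · by_cases hx : x = 0
    · simp [hx, siteMatrix_apply, -Matrix.toEuclideanCLM_toLp]
    · simp [hx, siteMatrix_apply, -Matrix.toEuclideanCLM_toLp]

theorem natAbs_mul_pow_recurrence {r : ℝ} (hr : r ≠ 0) (x : ℤ) :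
    (r + r⁻¹) * (x.natAbs * r ^ x.natAbs) - (x + 1).natAbs * r ^ (x + 1).natAbs -
      (x - 1).natAbs * r ^ (x - 1).natAbs
      = (r⁻¹ - r) * r ^ x.natAbs - if x = 0 then r + r⁻¹ else 0 := by
  rcases lt_trichotomy x 0 with hx | rfl | hx
  · obtain ⟨n, rfl⟩ : ∃ n : ℕ, x = -((n : ℤ) + 1) := ⟨(-x - 1).toNat, by omega⟩
    rw [if_neg hx.ne, show (-((n : ℤ) + 1)).natAbs = n + 1 by omega,
      show (-((n : ℤ) + 1) + 1).natAbs = n by omega,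
      show (-((n : ℤ) + 1) - 1).natAbs = n + 2 by omega]
    push_cast
    field_simp
    ring
  · simp
    ring
  · obtain ⟨n, rfl⟩ : ∃ n : ℕ, x = (n : ℤ) + 1 := ⟨(x - 1).toNat, by omega⟩
    rw [if_neg hx.ne', show ((n : ℤ) + 1).natAbs = n + 1 by omega,
      show ((n : ℤ) + 1 + 1).natAbs = n + 2 by omega,
      show ((n : ℤ) + 1 - 1).natAbs = n by omega]
    push_cast
    field_simp
    ring

/-- This is the stationary equation differentiated in ω, verified on the explicit profile: applying
the free operator to |x|ρ^{|x|} produces the multiple of ρ^{|x|} on the right. -/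
theorem dψ_recurrence (h : S.a' ≠ 0) (x : ℤ) :
    (S.ω + 2) * S.dψ x - S.dψ (x + 1) - S.dψ (x - 1) -
      (if x = 0 then (S.a (S.C ^ 2) + 2 * S.coupling) * S.dψ 0 else 0) = -S.ψ x := by
  have h1 := natAbs_mul_pow_recurrence S.rho_ne_zero x
  have h2 : (S.rho + S.rho⁻¹) * S.rho ^ x.natAbs - S.rho ^ (x + 1).natAbs - S.rho ^ (x - 1).natAbs
      = if x = 0 then S.rho⁻¹ - S.rho else 0 := by
    have := pow_natAbs_recurrence (r := (S.rho : ℂ)) (by exact_mod_cast S.rho_ne_zero) x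
    split_ifs at this ⊢ <;> exact_mod_cast this
  rw [← S.a_eq, ← S.omega_add_two] at h1
  rw [← S.omega_add_two, ← S.a_eq] at h2
  have ha := S.a_ne_zero
  have hC := S.C_pos.ne'
  set q := (2 * S.a (S.C ^ 2) * S.a' * S.C)⁻¹ with hq
  have hq' : q * (2 * S.coupling * S.a (S.C ^ 2)) = S.C := by
    rw [hq, coupling]; field_simp
  simp only [S.dψ_eq h, S.ψ_eq]
  rw [← hq]
  split_ifs at h1 h2 ⊢ with hx
  · subst hx
    simp at h1 h2 ⊢
    linear_combination q * (S.ω + 2) * h2 - 2 * q * S.coupling * h1 - hq'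
  · linear_combination q * (S.ω + 2) * h2 - 2 * q * S.coupling * h1 - S.rho ^ x.natAbs * hq'

theorem opC_dΦ (h : S.a' ≠ 0) : S.opC S.dΦ = S.jΦ := by
  refine Subtype.ext (funext fun x => ?_)
  rw [S.opC_apply, jΦ_apply]
  unfold exprC
  rw [matJ_inv, couplingMatrix_eq]
  simp only [dΦ_apply]
  have h' := congrArg (fun a : ℝ => (a : ℂ)) (S.dψ_recurrence h x)
  ext i
  fin_cases i
  · by_cases hx : x = 0
    · simp [hx, siteMatrix_apply, -Matrix.toEuclideanCLM_toLp]
    · simp [hx, siteMatrix_apply, -Matrix.toEuclideanCLM_toLp]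
  · by_cases hx : x = 0
    · simp [hx, siteMatrix_apply, -Matrix.toEuclideanCLM_toLp] at h' ⊢
      linear_combination -h'
    · simp [hx, siteMatrix_apply, -Matrix.toEuclideanCLM_toLp] at h' ⊢
      linear_combination -h'

/-- A geometric sum in ρ². The result ties the normalisation of 𝐏⁰ to the leading coefficient of the
determinant at 0: one and the same condition makes 𝐏⁰ well defined and the zero of the determinant
exactly double. -/
theorem inner_Φ_dΦ (h : S.a' ≠ 0) :
    inner ℂ S.Φ S.dΦ = ((-detCoeff S.rho S.coupling / (2 * S.a') : ℝ) : ℂ) := by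
  have hR : |S.rho ^ 2| < 1 := by
    rw [abs_pow]; exact pow_lt_one₀ (abs_nonneg _) S.abs_rho_lt two_ne_zero
  have h1 := (hasSum_geometric_int hR (S.ω + 2) (2 * S.coupling)).mul_left
    ((2 * S.a (S.C ^ 2) * S.a')⁻¹)
  rw [lp.inner_eq_tsum]
  have ha := S.a_ne_zero
  have hC := S.C_pos.ne'
  have e1 : ∀ x, inner ℂ (S.Φ x) (S.dΦ x) = ((((2 * S.a (S.C ^ 2) * S.a')⁻¹) *
      ((S.rho ^ 2) ^ x.natAbs * (S.ω + 2 - 2 * S.coupling * x.natAbs)) : ℝ) : ℂ) := by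
    intro x
    rw [Φ_apply, dΦ_apply, S.ψ_eq, S.dψ_eq h]
    simp [PiLp.inner_apply]
    have : (S.C : ℂ) ≠ 0 := by exact_mod_cast hC
    field_simp
    ring
  simp only [e1]
  rw [← Complex.ofReal_tsum, h1.tsum_eq]
  congr 1
  have hr := S.rho_ne_zero
  have hd : 1 - S.rho ^ 2 ≠ 0 := by
    have := (abs_lt.1 hR).2
    linarith
  rw [detCoeff, S.a_eq, S.omega_add_two]
  field_simp
  ring

theorem inner_dΦ_Φ (h : S.a' ≠ 0) : inner ℂ S.dΦ S.Φ = inner ℂ S.Φ S.dΦ := by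
  rw [← inner_conj_symm, S.inner_Φ_dΦ h, Complex.conj_ofReal]

theorem inner_jdΦ_jΦ : inner ℂ (latMatrix matJ S.dΦ) S.jΦ = inner ℂ S.dΦ S.Φ := by
  rw [lp.inner_eq_tsum, lp.inner_eq_tsum]
  congr 1
  funext x
  rw [jΦ_apply, jdΦ_apply, Φ_apply, dΦ_apply]
  simp [PiLp.inner_apply]

theorem inner_Φ_jΦ : inner ℂ S.Φ S.jΦ = 0 := by
  rw [lp.inner_eq_tsum]
  simp [Φ_apply, jΦ_apply, PiLp.inner_apply]

theorem inner_jdΦ_dΦ : inner ℂ (latMatrix matJ S.dΦ) S.dΦ = 0 := by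
  rw [lp.inner_eq_tsum]
  simp [jdΦ_apply, dΦ_apply, PiLp.inner_apply]

theorem projNull_apply (χ : LatL2) : S.projNull χ = (inner ℂ S.Φ S.dΦ)⁻¹ •
    (inner ℂ (latMatrix matJ S.dΦ) χ • S.jΦ + inner ℂ S.Φ χ • S.dΦ) := rfl

variable {S}

theorem inner_Φ_dΦ_ne_zero (hSP : S.SpectralCondition) : inner ℂ S.Φ S.dΦ ≠ 0 := by
  rw [S.inner_Φ_dΦ hSP.a'_ne_zero, Complex.ofReal_ne_zero]
  exact div_ne_zero (neg_ne_zero.2 (S.detCoeff_ne_zero hSP.a'_ne))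
    (mul_ne_zero two_ne_zero hSP.a'_ne_zero)

theorem projCont_jΦ (hSP : S.SpectralCondition) : S.projCont S.jΦ = 0 := by
  change S.jΦ - S.projNull S.jΦ = 0
  rw [S.projNull_apply, S.inner_jdΦ_jΦ, S.inner_Φ_jΦ, S.inner_dΦ_Φ hSP.a'_ne_zero, zero_smul,
    add_zero, smul_smul, inv_mul_cancel₀ (inner_Φ_dΦ_ne_zero hSP), one_smul, sub_self]

theorem projCont_dΦ (hSP : S.SpectralCondition) : S.projCont S.dΦ = 0 := by
  change S.dΦ - S.projNull S.dΦ = 0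
  rw [S.projNull_apply, S.inner_jdΦ_dΦ, zero_smul,
    zero_add, smul_smul, inv_mul_cancel₀ (inner_Φ_dΦ_ne_zero hSP), one_smul, sub_self]

/-- `𝐏ᶜ e^{𝐂t}` vanishes on the generalized null space. -/
theorem projCont_group_eq_zero (hSP : S.SpectralCondition) (t : ℝ) (A B : ℂ) :
    S.projCont (S.group t (A • S.dΦ + B • S.jΦ)) = 0 := by
  -- 𝐂 sends A ∂_ωΦ_ω + B jΦ_ω to A jΦ_ω, so the span is invariant and 𝐏ᶜ kills the exponential
  -- series term by term.
  have key : ∀ p : ℕ, ∃ A' B' : ℂ, (S.opC ^ p) (A • S.dΦ + B • S.jΦ) = A' • S.dΦ + B' • S.jΦ := by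
    intro p
    induction p with
    | zero => exact ⟨A, B, rfl⟩
    | succ p ih =>
      obtain ⟨A', B', h⟩ := ih
      refine ⟨0, A', ?_⟩
      rw [pow_succ', mul_apply_eq_comp, h, map_add, map_smul, map_smul, S.opC_jΦ,
        S.opC_dΦ hSP.a'_ne_zero, zero_smul, smul_zero, add_zero, zero_add]
  have h := (hasSum_group_apply (S := S) t (A • S.dΦ + B • S.jΦ)).mapL S.projCont
  refine h.unique ((congrArg (HasSum · _) (funext fun p => ?_)).mpr hasSum_zero)
  obtain ⟨A', B', h'⟩ := key p
  rw [h', map_smul, map_add, map_smul, map_smul, projCont_jΦ hSP, projCont_dΦ hSP]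
  simp

end SolitaryWave

/-! ### Weighted estimates -/

theorem summable_weight_pow {r : ℝ} (h0 : r ≠ 0) (h1 : |r| < 1) (p : ℕ) :
    Summable fun x : ℤ => (1 + |(x : ℝ)|) ^ p * |r| ^ x.natAbs := by
  have h : Summable fun n : ℕ => (1 + (n : ℝ)) ^ p * |r| ^ n := by
    have e : Summable fun n : ℕ => ((n + 1 : ℕ) : ℝ) ^ p * |r| ^ (n + 1) :=
      (summable_nat_add_iff (f := fun n : ℕ => (n : ℝ) ^ p * |r| ^ n) 1).2
        (summable_pow_mul_geometric_of_norm_lt_one p (by simpa using h1))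
    refine (e.mul_left (|r|⁻¹)).congr fun n => ?_
    have h2 : |r|⁻¹ * |r| = 1 := inv_mul_cancel₀ (abs_ne_zero.2 h0)
    push_cast
    rw [pow_succ, add_comm (n : ℝ) 1]
    linear_combination (1 + (n : ℝ)) ^ p * |r| ^ n * h2
  exact Summable.of_nat_of_neg (by simpa using h) (by simpa using h)

theorem norm_inner_le_of_weight {w u : LatL2} {g : ℤ → ℝ} {K : ℝ}
    (hw : Summable fun x => ‖w x‖ * g x) (hu : ∀ x, ‖u x‖ ≤ K * g x) :
    ‖inner ℂ w u‖ ≤ K * ∑' x, ‖w x‖ * g x := by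
  rw [lp.inner_eq_tsum]
  refine tsum_of_norm_bounded (hw.hasSum.mul_left K) fun x => ?_
  calc ‖inner ℂ (w x) (u x)‖ ≤ ‖w x‖ * ‖u x‖ := norm_inner_le_norm _ _
    _ ≤ ‖w x‖ * (K * g x) := by gcongr; exact hu x
    _ = _ := by ring

namespace SolitaryWave

variable (S : SolitaryWave)

theorem norm_Φ_apply (x : ℤ) : ‖S.Φ x‖ = |S.ψ x| := by
  simp [Φ_apply, EuclideanSpace.norm_eq, Real.sqrt_sq_eq_abs]

theorem norm_jdΦ_apply (x : ℤ) : ‖latMatrix matJ S.dΦ x‖ = |S.dψ x| := by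
  simp [jdΦ_apply, EuclideanSpace.norm_eq, Real.sqrt_sq_eq_abs]

theorem summable_norm_Φ_mul : Summable fun x : ℤ => ‖S.Φ x‖ * (1 + |(x : ℝ)|) ^ 2 := by
  refine ((summable_weight_pow S.rho_ne_zero S.abs_rho_lt 2).mul_left S.C).congr fun x => ?_
  rw [norm_Φ_apply, ψ_eq, abs_mul, abs_pow, abs_of_pos S.C_pos]
  ring

theorem summable_norm_jdΦ_mul (h : S.a' ≠ 0) :
    Summable fun x : ℤ => ‖latMatrix matJ S.dΦ x‖ * (1 + |(x : ℝ)|) ^ 2 := by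
  set q := (2 * S.a (S.C ^ 2) * S.a' * S.C)⁻¹ with hq
  refine Summable.of_nonneg_of_le (fun x => by positivity) (fun x => ?_)
    ((summable_weight_pow S.rho_ne_zero S.abs_rho_lt 3).mul_left
      (|q| * (|S.ω + 2| + |2 * S.coupling|)))
  rw [norm_jdΦ_apply, S.dψ_eq h, ← hq, abs_mul, abs_mul, abs_pow]
  have e : (x.natAbs : ℝ) = |(x : ℝ)| := by simp
  have h1 : |S.ω + 2 - 2 * S.coupling * x.natAbs| ≤
      (|S.ω + 2| + |2 * S.coupling|) * (1 + |(x : ℝ)|) := by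
    refine (abs_sub _ _).trans ?_
    rw [abs_mul, e, abs_abs]
    nlinarith [abs_nonneg (S.ω + 2), abs_nonneg (2 * S.coupling), abs_nonneg (x : ℝ)]
  calc |q| * (|S.rho| ^ x.natAbs * |S.ω + 2 - 2 * S.coupling * x.natAbs|) * (1 + |(x : ℝ)|) ^ 2
      ≤ |q| * (|S.rho| ^ x.natAbs * ((|S.ω + 2| + |2 * S.coupling|) * (1 + |(x : ℝ)|))) *
        (1 + |(x : ℝ)|) ^ 2 := by gcongr
    _ = _ := by ring

/-- 𝐏⁰ has finite rank and is built from exponentially decaying vectors, so pairing with a function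
of quadratic growth converges and 𝐏ᶜ preserves the pointwise weighted bound. -/
theorem exists_projCont_bound (h : S.a' ≠ 0) : ∃ K₀ : ℝ, 0 ≤ K₀ ∧ ∀ (u : LatL2) (K : ℝ), 0 ≤ K →
    (∀ x, ‖u x‖ ≤ K * (1 + |(x : ℝ)|) ^ 2) →
    ∀ x, ‖S.projCont u x‖ ≤ K₀ * K * (1 + |(x : ℝ)|) ^ 2 := by
  set s1 := ∑' x : ℤ, ‖latMatrix matJ S.dΦ x‖ * (1 + |(x : ℝ)|) ^ 2
  set s2 := ∑' x : ℤ, ‖S.Φ x‖ * (1 + |(x : ℝ)|) ^ 2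
  have hs1 : 0 ≤ s1 := tsum_nonneg fun x => by positivity
  have hs2 : 0 ≤ s2 := tsum_nonneg fun x => by positivity
  set i := ‖(inner ℂ S.Φ S.dΦ)⁻¹‖
  refine ⟨1 + i * (s1 * ‖S.jΦ‖ + s2 * ‖S.dΦ‖), by positivity, fun u K hK hu x => ?_⟩
  have h1 : ‖inner ℂ (latMatrix matJ S.dΦ) u‖ ≤ K * s1 :=
    norm_inner_le_of_weight (S.summable_norm_jdΦ_mul h) hu
  have h2 : ‖inner ℂ S.Φ u‖ ≤ K * s2 := norm_inner_le_of_weight S.summable_norm_Φ_mul hu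
  have h3 := lp.norm_apply_le_norm (two_ne_zero) S.jΦ x
  have h4 := lp.norm_apply_le_norm (two_ne_zero) S.dΦ x
  have e : S.projCont u x = u x - (inner ℂ S.Φ S.dΦ)⁻¹ •
    (inner ℂ (latMatrix matJ S.dΦ) u • S.jΦ x + inner ℂ S.Φ u • S.dΦ x) := rfl
  have hw : 1 ≤ (1 + |(x : ℝ)|) ^ 2 := one_le_pow₀ (by linarith [abs_nonneg (x : ℝ)])
  calc ‖S.projCont u x‖ ≤ ‖u x‖ + i * (‖inner ℂ (latMatrix matJ S.dΦ) u‖ * ‖S.jΦ x‖ +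
        ‖inner ℂ S.Φ u‖ * ‖S.dΦ x‖) := by
        rw [e]
        refine (norm_sub_le _ _).trans ?_
        rw [norm_smul]
        gcongr
        refine (norm_add_le _ _).trans ?_
        rw [norm_smul, norm_smul]
    _ ≤ K * (1 + |(x : ℝ)|) ^ 2 + i * (K * s1 * ‖S.jΦ‖ + K * s2 * ‖S.dΦ‖) * 1 := by
        rw [mul_one]
        gcongr
        exact hu x
    _ ≤ K * (1 + |(x : ℝ)|) ^ 2 + i * (K * s1 * ‖S.jΦ‖ + K * s2 * ‖S.dΦ‖) *
        (1 + |(x : ℝ)|) ^ 2 := by gcongr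
    _ = _ := by ring

/-! ### Decay of the matrix elements -/

variable {S}

theorem exists_specVec_bound (hSP : S.SpectralCondition)
    (hres : ∀ lam ∈ S.edges, ¬ S.IsResonance lam) : ∃ K : ℝ, 0 ≤ K ∧
    ∀ (c c' : ℂ) (x y : ℤ) (t : ℝ), 1 ≤ t →
      ‖S.specVec (fun l => Complex.exp (t * l)) c c' y x‖ ≤
        K * (‖c‖ + ‖c'‖) * ((1 + |(x : ℝ)|) ^ 2 * (1 + |(y : ℝ)|) ^ 2) * t ^ (-(3 / 2) : ℝ) := by
  have hD := resDet_circle_ne_zero' hSP hres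
  have hz := S.two_lt_abs_omega
  obtain ⟨K, hK⟩ := exists_C2Bound_kernels hz hD
  -- 224 = 2 · 2 · 56: the factor of `norm_siteVec_le`, the two components, and the bound for each
  -- spectral integral.
  refine ⟨224 * |K|, by positivity, fun c c' x y t ht => ?_⟩
  have ht' : 1 ≤ |t| := ht.trans (le_abs_self t)
  have k1 := continuous_diagKernel_circle hz hD x y
  have k2 := continuous_offKernel_circle hz hD x y
  set m : ℂ := ((S.a (S.C ^ 2) : ℝ) : ℂ) + S.coupling
  set n : ℂ := ((S.coupling : ℝ) : ℂ)
  set w : ℝ := (1 + |(x : ℝ)|) ^ 2 * (1 + |(y : ℝ)|) ^ 2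
  have hw : 0 ≤ w := by positivity
  obtain ⟨d1, d2⟩ := hK x y (diagKernel m n x y) (Or.inl rfl)
  obtain ⟨o1, o2⟩ := hK x y (offKernel m n x y) (Or.inr rfl)
  set T : ℝ := |t| ^ (-(3 / 2) : ℝ) with hT
  have hT0 : 0 ≤ T := by positivity
  set g : ℂ → ℂ := fun l => Complex.exp (t * l) with hg
  have hgc : Continuous g := by fun_prop
  have hB : 56 * (K * w) * T ≤ 56 * (|K| * w) * T := by
    gcongr; exact le_abs_self K
  have b1 := (norm_specInt_exp_le d1 d2 ht').trans hB
  have b2 := (norm_specInt_exp_le o1 o2 ht').trans hB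
  have b3 := (norm_specInt_exp_le (k := fun r s => diagKernel m n x y s r) d2 d1 ht').trans hB
  have b4 := (norm_specInt_exp_le (k := fun r s => offKernel m n x y s r) o2 o1 ht').trans hB
  rw [← hg] at b1 b2 b3 b4
  have tri : ∀ (a b A B : ℂ), ‖A‖ ≤ 56 * (|K| * w) * T → ‖B‖ ≤ 56 * (|K| * w) * T →
      ‖a‖ = ‖c‖ ∧ ‖b‖ = ‖c'‖ ∨ ‖a‖ = ‖c'‖ ∧ ‖b‖ = ‖c‖ →
      ‖a * A + b * B‖ ≤ (‖c‖ + ‖c'‖) * (56 * (|K| * w) * T) := by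
    intro a b A B hA hB h
    refine (norm_add_le _ _).trans ?_
    rw [norm_mul, norm_mul]
    rcases h with ⟨h, h'⟩ | ⟨h, h'⟩ <;> rw [h, h'] <;>
    nlinarith [mul_le_mul_of_nonneg_left hA (norm_nonneg c),
      mul_le_mul_of_nonneg_left hA (norm_nonneg c'), mul_le_mul_of_nonneg_left hB (norm_nonneg c),
      mul_le_mul_of_nonneg_left hB (norm_nonneg c')]
  unfold specVec resKernelPlus resKernelMinus
  rw [specInt_add hgc (SpecContinuous.const_mul k1 _) (SpecContinuous.const_mul k2 _),
    specInt_add hgc (SpecContinuous.const_mul (SpecContinuous.swap k1) _)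
      (SpecContinuous.const_mul (SpecContinuous.swap k2) _),
    specInt_const_mul, specInt_const_mul,
    specInt_const_mul _ (k := fun r s => diagKernel m n x y s r),
    specInt_const_mul _ (k := fun r s => offKernel m n x y s r)]
  refine (norm_siteVec_le _ _).trans ?_
  have f1 := tri (-Complex.I * c) (Complex.I * c') _ _ b1 b2 (Or.inl (by simp))
  have f2 := tri (Complex.I * c') (-Complex.I * c) _ _ b3 b4 (Or.inr (by simp))
  rw [← abs_of_pos (lt_of_lt_of_le one_pos ht), ← hT]
  linarith

/-- The spectral integral with multiplier `1` is `δ_y` up to the generalized null space. -/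
theorem exists_specVec_eq (hSP : S.SpectralCondition)
    (hres : ∀ lam ∈ S.edges, ¬ S.IsResonance lam) (c c' : ℂ) (y : ℤ) : ∃ A B : ℂ, ∀ x,
    (lp.single (E := fun _ : ℤ => Site) 2 y (siteVec c c') + (A • S.dΦ + B • S.jΦ) : LatL2) x =
      S.specVec (fun _ => 1) c c' y x := by
  -- The last factors, 2aa'C and 1/C, undo the normalisations of ∂_ωψ_ω in `dψ_eq` and of ψ_ω in
  -- `ψ_eq`.
  refine ⟨(c + c') * ((S.rho ^ y.natAbs / (S.a (S.C ^ 2) * detCoeff S.rho S.coupling) *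
    (2 * S.a (S.C ^ 2) * S.a' * S.C) : ℝ) : ℂ), Complex.I * (c - c') *
    ((S.rho ^ y.natAbs * (S.ω + 2 - 2 * S.coupling * y.natAbs) /
          (S.a (S.C ^ 2) * detCoeff S.rho S.coupling) / S.C : ℝ) : ℂ), fun x => ?_⟩
  rw [specVec_one hSP hres]
  have e : (lp.single (E := fun _ : ℤ => Site) 2 y (siteVec c c')) x =
      if x = y then siteVec c c' else 0 := by
    by_cases hx : x = y
    · subst hx; simp
    · simp [hx]
  have ha := S.a_ne_zero
  have ha' := hSP.a'_ne_zero
  have hC := S.C_pos.ne'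
  rw [lp.coeFn_add, Pi.add_apply, e]
  congr 1
  rw [lp.coeFn_add, lp.coeFn_smul, lp.coeFn_smul, Pi.add_apply, Pi.smul_apply, Pi.smul_apply,
    S.dΦ_apply, S.jΦ_apply, S.dψ_eq ha', S.ψ_eq]
  have q1 : (2 * S.a (S.C ^ 2) * S.a' * S.C) * (2 * S.a (S.C ^ 2) * S.a' * S.C)⁻¹ = 1 :=
    mul_inv_cancel₀ (by positivity)
  have q2 : S.C⁻¹ * S.C = 1 := inv_mul_cancel₀ hC
  ext i
  fin_cases i
  · simp only [Fin.zero_eta, PiLp.add_apply, PiLp.smul_apply, Matrix.cons_val_zero, smul_eq_mul,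
      mul_zero, add_zero]
    rw [mul_assoc, ← Complex.ofReal_mul]
    congr 2
    linear_combination (S.rho ^ y.natAbs / (S.a (S.C ^ 2) * detCoeff S.rho S.coupling) *
      (S.rho ^ x.natAbs * (S.ω + 2 - 2 * S.coupling * x.natAbs))) * q1
  · simp only [Fin.mk_one, PiLp.add_apply, PiLp.smul_apply, Matrix.cons_val_one, smul_eq_mul,
      Matrix.cons_val_fin_one, mul_zero, zero_add]
    rw [mul_assoc (Complex.I * (c - c')), ← Complex.ofReal_mul]
    congr 2
    linear_combination (S.rho ^ y.natAbs * (S.ω + 2 - 2 * S.coupling * y.natAbs) /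
      (S.a (S.C ^ 2) * detCoeff S.rho S.coupling) * S.rho ^ x.natAbs) * q2

/-- Decay of the matrix elements of the group on the continuous spectral subspace. -/
theorem exists_kernel_bound (hSP : S.SpectralCondition)
    (hres : ∀ lam ∈ S.edges, ¬ S.IsResonance lam) : ∃ K : ℝ, 0 ≤ K ∧
    ∀ (v : Site) (x y : ℤ) (t : ℝ), 1 ≤ t →
      ‖S.projCont (S.group t (lp.single (E := fun _ : ℤ => Site) 2 y v)) x‖ ≤
        K * t ^ (-(3 / 2) : ℝ) * (1 + |(x : ℝ)|) ^ 2 * ((1 + |(y : ℝ)|) ^ 2 * ‖v‖) := by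
  obtain ⟨K, hK0, hK⟩ := exists_specVec_bound hSP hres
  obtain ⟨K₀, hK₀, hP⟩ := S.exists_projCont_bound hSP.a'_ne_zero
  refine ⟨2 * (K₀ * K), by positivity, fun v x y t ht => ?_⟩
  obtain ⟨c, c', hv, hc, hc'⟩ : ∃ c c' : ℂ, v = siteVec c c' ∧ ‖c‖ ≤ ‖v‖ ∧ ‖c'‖ ≤ ‖v‖ := by
    have h0 : ‖v 0‖ ≤ ‖v‖ := PiLp.norm_apply_le v 0
    have h1 : ‖v 1‖ ≤ ‖v‖ := PiLp.norm_apply_le v 1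
    refine ⟨_, _, siteVec_surj v, ?_, ?_⟩
    · rw [norm_div, Complex.norm_ofNat]
      have := norm_sub_le (v 0) (Complex.I * v 1)
      rw [norm_mul, Complex.norm_I, one_mul] at this
      linarith
    · rw [norm_div, Complex.norm_ofNat]
      have := norm_add_le (v 0) (Complex.I * v 1)
      rw [norm_mul, Complex.norm_I, one_mul] at this
      linarith
  obtain ⟨A, B, hAB⟩ := exists_specVec_eq hSP hres c c' y
  rw [← hv] at hAB
  set χ : LatL2 := lp.single (E := fun _ : ℤ => Site) 2 y v + (A • S.dΦ + B • S.jΦ) with hχ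
  -- Null vectors may be added freely under 𝐏ᶜe^{𝐂t}; this replaces δ_y v by a vector with a purely
  -- continuous spectral representation.
  have e : S.projCont (S.group t (lp.single (E := fun _ : ℤ => Site) 2 y v)) =
      S.projCont (S.group t χ) := by
    rw [hχ, map_add, map_add, projCont_group_eq_zero hSP, add_zero]
  rw [e]
  have ht0 : 0 ≤ t := by linarith
  have hT : 0 ≤ t ^ (-(3 / 2) : ℝ) := Real.rpow_nonneg ht0 _
  refine (hP (S.group t χ) (K * (‖v‖ + ‖v‖) * (1 + |(y : ℝ)|) ^ 2 * t ^ (-(3 / 2) : ℝ))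
    (by positivity) (fun x => ?_) x).trans_eq (by ring)
  rw [group_apply hSP hres hAB]
  calc _ ≤ K * (‖c‖ + ‖c'‖) * ((1 + |(x : ℝ)|) ^ 2 * (1 + |(y : ℝ)|) ^ 2) *
        t ^ (-(3 / 2) : ℝ) := hK c c' x y t ht
    _ ≤ K * (‖v‖ + ‖v‖) * ((1 + |(x : ℝ)|) ^ 2 * (1 + |(y : ℝ)|) ^ 2) *
        t ^ (-(3 / 2) : ℝ) := by gcongr
    _ = _ := by ring

end SolitaryWave

/-- By continuity T χ is the sum of its columns T(δ_y χ(y)). The quadratic weight in y is dominated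
by that of l¹_β, and the one in x by that of l^∞_{-β}. -/
theorem opNormB_le_of_kernel_bound {β : ℝ} (hβ : 2 ≤ β) {T : LatL2 →L[ℂ] LatL2} {K : ℝ}
    (hT : ∀ (v : Site) (x y : ℤ), ‖T (lp.single (E := fun _ : ℤ => Site) 2 y v) x‖ ≤
      K * (1 + |(x : ℝ)|) ^ 2 * ((1 + |(y : ℝ)|) ^ 2 * ‖v‖)) :
    opNormB β T ≤ ENNReal.ofReal K := by
  have hw : ∀ x : ℤ, 1 ≤ 1 + |(x : ℝ)| := fun x => by linarith [abs_nonneg (x : ℝ)]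
  have hw2 : ∀ x : ℤ, (1 + |(x : ℝ)|) ^ 2 ≤ (1 + |(x : ℝ)|) ^ β := fun x => by
    rw [← Real.rpow_natCast]
    exact Real.rpow_le_rpow_of_exponent_le (hw x) (by simpa using hβ)
  refine iSup₂_le fun χ hχ => iSup_le fun x => ?_
  have h1 := (lp.hasSum_single (E := fun _ : ℤ => Site) (p := 2) (by norm_num) χ).mapL T
  have h2 := h1.mapL (lp.evalCLM ℂ (fun _ : ℤ => Site) 2 x)
  have h3 : ‖T χ x‖ₑ ≤ ∑' y, ‖T (lp.single (E := fun _ : ℤ => Site) 2 y (χ y)) x‖ₑ := by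
    have e : T χ x = ∑' y, T (lp.single (E := fun _ : ℤ => Site) 2 y (χ y)) x := h2.tsum_eq.symm
    rw [e]
    exact enorm_tsum_le_tsum_enorm
  have h4 : ∀ y, ‖T (lp.single (E := fun _ : ℤ => Site) 2 y (χ y)) x‖ₑ ≤
      ENNReal.ofReal (K * (1 + |(x : ℝ)|) ^ 2) *
        (ENNReal.ofReal ((1 + |(y : ℝ)|) ^ β) * ‖χ y‖ₑ) := by
    intro y
    rw [← ofReal_norm, ← ofReal_norm, ← ENNReal.ofReal_mul (by positivity)]
    refine (ENNReal.ofReal_le_ofReal (hT _ x y)).trans ?_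
    rw [← ENNReal.ofReal_mul' (by positivity)]
    -- No sign of K is assumed; for K < 0 the left side is 0.
    rcases le_or_gt 0 K with hK | hK
    · refine ENNReal.ofReal_le_ofReal ?_
      gcongr
      exact hw2 y
    · rw [ENNReal.ofReal_of_nonpos]
      · exact zero_le
      · exact mul_nonpos_of_nonpos_of_nonneg
          (mul_nonpos_of_nonpos_of_nonneg hK.le (by positivity)) (by positivity)
  have h5 : ‖T χ x‖ₑ ≤ ENNReal.ofReal (K * (1 + |(x : ℝ)|) ^ 2) := by
    refine (h3.trans (ENNReal.tsum_le_tsum h4)).trans ?_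
    rw [ENNReal.tsum_mul_left]
    exact (mul_le_mul_right hχ _).trans_eq (mul_one _)
  calc ENNReal.ofReal ((1 + |(x : ℝ)|) ^ (-β)) * ‖T χ x‖ₑ
      ≤ ENNReal.ofReal ((1 + |(x : ℝ)|) ^ (-β)) * ENNReal.ofReal (K * (1 + |(x : ℝ)|) ^ 2) := by
        gcongr
    _ = ENNReal.ofReal K *
        ENNReal.ofReal ((1 + |(x : ℝ)|) ^ (-β) * (1 + |(x : ℝ)|) ^ 2) := by
        rw [← ENNReal.ofReal_mul (by positivity), ← ENNReal.ofReal_mul' (by positivity)]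
        congr 1
        ring
    _ ≤ ENNReal.ofReal K * 1 := by
        gcongr
        rw [← ENNReal.ofReal_one]
        refine ENNReal.ofReal_le_ofReal ?_
        rw [Real.rpow_neg (by positivity), inv_mul_le_iff₀ (by positivity), mul_one]
        exact hw2 x
    _ = _ := mul_one _

end

theorem mainTheorem2 (S : SolitaryWave) (hSP : S.SpectralCondition)
    (hres : ∀ lam ∈ S.edges, ¬ S.IsResonance lam) (β : ℝ) (hβ : 2 ≤ β) :
    ∃ K : ℝ, ∀ᶠ t : ℝ in atTop,
      opNormB β (S.projCont.comp (S.group t)) ≤ ENNReal.ofReal (K * t ^ (-(3 / 2) : ℝ)) := by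
  obtain ⟨K, -, hK⟩ := SolitaryWave.exists_kernel_bound hSP hres
  refine ⟨K, (eventually_ge_atTop 1).mono fun t ht => ?_⟩
  exact opNormB_le_of_kernel_bound hβ fun v x y => hK v x y t ht
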